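/- **Data.** Let $\mathfrak h$ be a finite-dimensional complex vector space with a non-degenerate symmetric bilinear form $(\cdot,\cdot)$, and let $\alpha_1,\dots,\alpha_R\in\mathfrak h^*$ be linearly independent. Let $H_i\in\mathfrak h$ be defined by $(H_i,\cdot)=\alpha_i$, and put $b_{ij}=\alpha_j(H_i)=(\alpha_i,\alpha_j)$. Let $\mathfrak g$ be the complex Lie algebra with generators $E_i,F_i$ ($1\le i\le R$) and $H\in\mathfrak h$ (depending linearly on $H$) and relations $[E_i,F_j]=\delta_{ij}H_i$, $[H,E_i]=\alpha_i(H)E_i$, $[H,F_i]=-\alpha_i(H)F_i$, $[H,H']=0$. Then $\mathfrak g=\mathfrak n\oplus\mathfrak h\oplus\mathfrak n_+$, where $\mathfrak n$ and $\mathfrak n_+$ are free Lie algebras on the $F_i$ and on the $E_i$. Let $\sigma$ be an automorphism of $\mathfrak g$ with $\sigma(E_i)=E_{\sigma(i)}$, $\sigma(F_i)=F_{\sigma(i)}$, $\sigma(H_i)=H_{\sigma(i)}$ for a permutation $\sigma$ of $\{1,\dots,R\}$; let $T\ge1$ be an integer with $\sigma^T=1$ on $\{1,\dots,R\}$ (for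 instance the order of $\sigma$), and $\omega$ a primitive $T$-th root of unity. Let $\iota(1),\dots,\iota(r)$ be representatives of the cycles of the permutation $\sigma$, and $T_1,\dots,T_r$ the lengths of these cycles. Let $\mathfrak g^\sigma$ be the fixed-point subalgebra. **The form $\mathrm{Geom}_0$.** For a non-zero $\lambda\in\mathbb Z_{\ge0}^r$ let $m=\lambda_1+\dots+\lambda_r$; divide $\{1,\dots,m\}$ into $r$ consecutive blocks of lengths $\lambda_1,\dots,\lambda_r$. Let $\mathfrak a$ be the free Lie algebra on ${}^kf_p$ ($k\in\mathbb Z_T$, $1\le p\le m$), $\tau({}^kf_p)={}^{k+1}f_p$, and $\bar u=\sum_{k\in\mathbb Z_T}\tau^ku$. Consider in $\mathbb C^m$ the arrangement of all hyperplanes $H_{pq}^k:\ t_p=\omega^kt_q$ ($p<q$, $k\in\mathbb Z_T$), with weights $a(H_{pq}^k)=b_{\iota(i),\sigma^k\iota(j)}$ if $p,q$ lie in the blocks $i,j$. For a commutator $g\in\mathfrak a$ of weight $(1,\dots,1)$ (each index $p$ occurs exactly once) let $\psi(\bar gv_0)$ be the following full flag of subspaces of $\mathbb C^m$, with a sign.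 Start from $\bar f_1\wedge\dots\wedge\bar f_m$, to which the trivial flag $(\mathbb C^m)$ with sign $+$ is attached; whenever the last two factors of $\dots\wedge\bar g_2\wedge\bar g_1$ are replaced by $\overline{[g_1,g_2]}$, the last member of the flag is intersected with $L_{[g_1,g_2]}$; here the wedge product is skew-symmetric and $L_h$ is the subspace $\omega^{k_1}t_{p_1}=\dots=\omega^{k_l}t_{p_l}$ if ${}^{k_1}f_{p_1},\dots,{}^{k_l}f_{p_l}$ are the letters of $h$. Once $\bar g$ has been formed, add the last member $\{0\}$. An ordered tuple $(H_1,\dots,H_m)$ of hyperplanes of the arrangement is adjacent to a flag $F$, with sign $\mathrm{sgn}(s)$, if $F=(H_{s(1)}\supset H_{s(1)}\cap H_{s(2)}\supset\cdots)$ for a permutation $s$. The pairing $\langle\psi(\bar gv_0),(H_1,\dots,H_m)\rangle$ is the sign of $\psi(\bar gv_0)$ times the sign of adjacency, and $0$ if the tuple is not adjacent; it extends linearly to all $g\in\mathfrak a_{(1,\dots,1)}$. Put $$\mathrm{Geom}_0(\bar g,\bar g')=\sum_{(H_1,\dots,H_m)}\langle\psi(\bar gv_0),(H_1,\dots,H_m)\rangle\,\langle\psi(\bar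 g'v_0),(H_1,\dots,H_m)\rangle\,a(H_1)\cdots a(H_m),$$ the sum over tuples up to reordering. **The form $\Omega$.** Let $\jmath:\mathfrak n\to\mathfrak a$ be the homomorphism which sends $F_q$ to the sum of all ${}^kf_p$ with $q=\sigma^k\iota(i)$, where $i$ is the block of $p$, and let $\mathsf s=\mathsf s_\lambda$ be $\jmath$ followed by the projection to weight $(1,\dots,1)$; likewise for $\mathfrak n_+$ (with values in the free Lie algebra $\mathfrak a_+$ on letters ${}^ke_p$). Let $\varphi:\mathfrak a_+\to\mathfrak a$ be the linear map with $\varphi({}^ke_p)={}^kf_p$ and $\varphi([x,y])=-[\varphi(x),\varphi(y)]$. Grade $\mathfrak n$ and $\mathfrak n_+$ by $\mathbb Z_{\ge0}^r$ so that $F_q$ and $E_q$ have degree the $i$-th unit vector if $q$ lies in the cycle of $\iota(i)$. Let $\Omega$ be the skew-symmetric bilinear form on $\mathfrak g^\sigma$ with $$\Omega(x,y)=-\Omega(y,x)=\frac{1}{\prod_{i=1}^r(T/T_i)^{\lambda_i}\lambda_i!}\,\mathrm{Geom}_0\big(\varphi(\mathsf s(x)),\mathsf s(y)\big)$$ for $x\in(\mathfrak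 n_+^\sigma)_\lambda$, $y\in(\mathfrak n^\sigma)_\lambda$, $\lambda\ne0$, and $\Omega=0$ on all other pairs of weight components. **Statement.** Let $\mathfrak g(B^\sigma)\subset\mathfrak g^\sigma$ be the Lie subalgebra generated by the projected generators $\sum_{k=0}^{T-1}\sigma^kE_i$, $\sum_{k=0}^{T-1}\sigma^kF_i$ ($1\le i\le R$) and the $\sigma$-fixed elements of $\mathfrak h$. Then $\Omega(y,x)=0$ for all $x\in\mathfrak g(B^\sigma)$ and all $y\in\mathfrak g^\sigma$. Consequently, if $\mathfrak g(B^\sigma)=\mathfrak g^\sigma$, then $\Omega=0$. -/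

import Mathlib

noncomputable section

namespace Cyclotomic

/-- The element of the free Lie algebra obtained by evaluating a non-associative word. -/
def commutatorOf {X : Type*} : FreeMagma X → FreeLieAlgebra ℂ X
  | .of x => FreeLieAlgebra.of ℂ x
  | .mul a b => ⁅commutatorOf a, commutatorOf b⁆

/-- A linear map on the free Lie algebra may be prescribed on all commutators, provided the
prescription respects antisymmetry and the Jacobi identity. -/
theorem exists_linear_of_words {X K : Type*} [AddCommGroup K] [Module ℂ K]
    (Φ : FreeMagma X → K) (β : K →ₗ[ℂ] K →ₗ[ℂ] K)
    (hmul : ∀ a b, Φ (a * b) = β (Φ a) (Φ b))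
    (anti : ∀ a b, β (Φ a) (Φ b) = - β (Φ b) (Φ a))
    (jac : ∀ a b c, β (Φ a) (β (Φ b) (Φ c)) =
      β (β (Φ a) (Φ b)) (Φ c) + β (Φ b) (β (Φ a) (Φ c))) :
    ∃ L : FreeLieAlgebra ℂ X →ₗ[ℂ] K, ∀ w, L (commutatorOf w) = Φ w := by
  classical
  let N := FreeNonUnitalNonAssocAlgebra ℂ X
  let F : N →ₗ[ℂ] K := (Finsupp.lift K ℂ (FreeMagma X) Φ) ∘ₗ
    (MonoidAlgebra.coeffLinearEquiv ℂ).toLinearMap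
  have hF : ∀ w r, F (MonoidAlgebra.single w r) = r • Φ w := by
    intro w r
    change (Finsupp.single w r).sum (fun x r => r • Φ x) = _
    exact Finsupp.sum_single_index (zero_smul _ _)
  have ind : ∀ {p : N → Prop}, (∀ a b, p a → p b → p (a + b)) →
      (∀ w r, p (MonoidAlgebra.single w r)) → p 0 → ∀ a, p a := by
    intro p h1 h2 h3 a
    induction a using MonoidAlgebra.induction_linear with
    | zero => exact h3
    | add f g hf hg => exact h1 _ _ hf hg
    | single a b => exact h2 _ _
  have Fmul : ∀ a b : N, F (a * b) = β (F a) (F b) := by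
    intro a b
    revert b
    refine ind (p := fun a => ∀ b, F (a * b) = β (F a) (F b)) ?_ ?_ ?_ a
    · intro a a' h h' b; simp [add_mul, h, h']
    · intro w r b
      refine ind (p := fun b => F (_ * b) = β (F _) (F b)) ?_ ?_ ?_ b
      · intro a a' h h'; simp [mul_add, h, h']
      · intro w' r'
        rw [MonoidAlgebra.single_mul_single, hF, hF, hF, hmul]
        simp [smul_smul, mul_comm]
      · simp
    · intro b; simp
  have Fanti : ∀ a b : N, β (F a) (F b) = - β (F b) (F a) := by
    intro a b
    revert b
    refine ind (p := fun a => ∀ b, β (F a) (F b) = - β (F b) (F a)) ?_ ?_ ?_ a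
    · intro a a' h h' b; simp [h, h']; abel
    · intro w r b
      refine ind (p := fun b => β (F _) (F b) = - β (F b) (F _)) ?_ ?_ ?_ b
      · intro a a' h h'; simp [h, h']; abel
      · intro w' r'
        rw [hF, hF]
        simp only [map_smul, LinearMap.smul_apply]
        rw [anti, smul_comm]; simp
      · simp
    · intro b; simp
  have Fjac : ∀ a b c : N, β (F a) (β (F b) (F c)) =
      β (β (F a) (F b)) (F c) + β (F b) (β (F a) (F c)) := by
    intro a
    refine ind (p := fun a => ∀ b c, β (F a) (β (F b) (F c)) =
      β (β (F a) (F b)) (F c) + β (F b) (β (F a) (F c))) ?_ ?_ ?_ a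
    · intro a a' h h' b c; simp only [map_add, LinearMap.add_apply, h, h']; abel
    · intro w r b
      refine ind (p := fun b => ∀ c, β (F _) (β (F b) (F c)) =
        β (β (F _) (F b)) (F c) + β (F b) (β (F _) (F c))) ?_ ?_ ?_ b
      · intro a a' h h' c; simp only [map_add, LinearMap.add_apply, h, h']; abel
      · intro w' r' c
        refine ind (p := fun c => β (F _) (β (F _) (F c)) =
          β (β (F _) (F _)) (F c) + β (F _) (β (F _) (F c))) ?_ ?_ ?_ c
        · intro a a' h h'; simp only [map_add, h, h']; abel
        · intro w'' r''
          simp only [hF, map_smul, LinearMap.smul_apply]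
          rw [jac w w' w'']
          simp only [smul_add, smul_smul]
          (congr 2; ring)
        · simp
      · intro c; simp
    · intro b c; simp
  have key : ∀ a b : N, FreeLieAlgebra.Rel ℂ X a b → F a = F b := by
    intro a b h
    induction h with
    | lie_self a =>
      rw [Fmul, map_zero]
      have h := Fanti a a
      have h2 : (2 : ℂ) • β (F a) (F a) = 0 := by
        rw [two_smul]; nth_rewrite 1 [h]; exact neg_add_cancel _
      exact (smul_eq_zero.mp h2).resolve_left two_ne_zero
    | leibniz_lie a b c => simp only [map_add, Fmul]; exact Fjac a b c
    | smul t _ h => simp only [map_smul, h]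
    | add_right c _ h => simp only [map_add, h]
    | mul_left a _ h => simp only [Fmul, h]
    | mul_right c _ h => simp only [Fmul, h]
  let L : FreeLieAlgebra ℂ X →ₗ[ℂ] K :=
    { toFun := Quot.lift F key
      map_add' := by rintro ⟨a⟩ ⟨b⟩; exact F.map_add a b
      map_smul' := by rintro t ⟨a⟩; exact F.map_smul t a }
  have hmk : ∀ w : FreeMagma X, commutatorOf w =
      FreeLieAlgebra.mk ℂ (MonoidAlgebra.single w 1) := by
    intro w
    induction w using FreeMagma.recOnMul with
    | ih1 x => rfl
    | ih2 x y hx hy =>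
      change ⁅commutatorOf x, commutatorOf y⁆ = _
      rw [hx, hy]
      have := (FreeLieAlgebra.mk ℂ (X := X)).map_mul (MonoidAlgebra.single x 1)
        (MonoidAlgebra.single y 1)
      rw [MonoidAlgebra.single_mul_single, mul_one] at this
      exact this.symm
  refine ⟨L, fun w => ?_⟩
  rw [hmk]
  change F _ = _
  rw [hF, one_smul]


/-! ### The Lie algebra `𝔤` and its triangular decomposition -/

/-- Generators of the Lie algebra `𝔤`: `E i`, `F i` and all elements of `𝔥`. -/
inductive Gen (R : ℕ) (𝔥 : Type*) where
  | E (i : Fin R)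
  | F (i : Fin R)
  | H (h : 𝔥)

section Triangular

attribute [local instance] LieRing.ofAssociativeRing

variable {R : ℕ} {𝔥 : Type*} [AddCommGroup 𝔥] [Module ℂ 𝔥]

abbrev genE (𝔥 : Type*) (i : Fin R) : FreeLieAlgebra ℂ (Gen R 𝔥) := FreeLieAlgebra.of ℂ (Gen.E i)
abbrev genF (𝔥 : Type*) (i : Fin R) : FreeLieAlgebra ℂ (Gen R 𝔥) := FreeLieAlgebra.of ℂ (Gen.F i)
abbrev genH (R : ℕ) (h : 𝔥) : FreeLieAlgebra ℂ (Gen R 𝔥) := FreeLieAlgebra.of ℂ (Gen.H h)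

/-- The defining relations of `𝔤`: the generators `H h` depend linearly on `h : 𝔥`, and
`[H, H'] = 0`, `[H, E i] = α i (H) E i`, `[H, F i] = - α i (H) F i`, `[E i, F j] = δ_ij H_i`,
where `cr i` stands for the element `H_i` of `𝔥`. -/
inductive Relator (α : Fin R → Module.Dual ℂ 𝔥) (cr : Fin R → 𝔥) :
    FreeLieAlgebra ℂ (Gen R 𝔥) → Prop
  | add (h h' : 𝔥) : Relator α cr (genH R (h + h') - genH R h - genH R h')
  | smul (c : ℂ) (h : 𝔥) : Relator α cr (genH R (c • h) - c • genH R h)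
  | HH (h h' : 𝔥) : Relator α cr ⁅genH R h, genH R h'⁆
  | HE (h : 𝔥) (i : Fin R) : Relator α cr (⁅genH R h, genE 𝔥 i⁆ - α i h • genE 𝔥 i)
  | HF (h : 𝔥) (i : Fin R) : Relator α cr (⁅genH R h, genF 𝔥 i⁆ + α i h • genF 𝔥 i)
  | EF_same (i : Fin R) : Relator α cr (⁅genE 𝔥 i, genF 𝔥 i⁆ - genH R (cr i))
  | EF_ne (i j : Fin R) (hij : i ≠ j) : Relator α cr ⁅genE 𝔥 i, genF 𝔥 j⁆

/-- The ideal generated by the relations. -/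
abbrev relatorIdeal (α : Fin R → Module.Dual ℂ 𝔥) (cr : Fin R → 𝔥) :
    LieIdeal ℂ (FreeLieAlgebra ℂ (Gen R 𝔥)) :=
  LieSubmodule.lieSpan ℂ _ {x | Relator α cr x}

/-- The Lie algebra `𝔤`: a Kac--Moody type Lie algebra without Serre relations. -/
abbrev 𝔤 (α : Fin R → Module.Dual ℂ 𝔥) (cr : Fin R → 𝔥) : Type _ :=
  FreeLieAlgebra ℂ (Gen R 𝔥) ⧸ relatorIdeal α cr

variable (α : Fin R → Module.Dual ℂ 𝔥) (cr : Fin R → 𝔥)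

/-- The quotient map onto `𝔤`. -/
def toG : FreeLieAlgebra ℂ (Gen R 𝔥) →ₗ⁅ℂ⁆ 𝔤 α cr where
  __ := (relatorIdeal α cr).toSubmodule.mkQ
  map_lie' := fun {_ _} => rfl

theorem toG_surjective : Function.Surjective (toG α cr) := Submodule.Quotient.mk_surjective _

theorem toG_relator {x : FreeLieAlgebra ℂ (Gen R 𝔥)} (hx : Relator α cr x) : toG α cr x = 0 :=
  (Submodule.Quotient.mk_eq_zero _).mpr (LieSubmodule.subset_lieSpan hx)

/-- The element `E i` of `𝔤`. -/
def Eg (i : Fin R) : 𝔤 α cr := toG α cr (genE 𝔥 i)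
/-- The element `F i` of `𝔤`. -/
def Fg (i : Fin R) : 𝔤 α cr := toG α cr (genF 𝔥 i)
/-- The map `𝔥 → 𝔤`. -/
def Hg : 𝔥 →ₗ[ℂ] 𝔤 α cr where
  toFun h := toG α cr (genH R h)
  map_add' h h' := by
    have := toG_relator α cr (Relator.add h h')
    rw [map_sub, map_sub, sub_sub, sub_eq_zero] at this
    exact this
  map_smul' c h := by
    have := toG_relator α cr (Relator.smul c h)
    rw [map_sub, sub_eq_zero, map_smul] at this
    exact this

theorem lie_HH (h h' : 𝔥) : ⁅Hg α cr h, Hg α cr h'⁆ = 0 := by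
  have := toG_relator α cr (Relator.HH h h')
  rwa [LieHom.map_lie] at this

theorem lie_HE (h : 𝔥) (i : Fin R) : ⁅Hg α cr h, Eg α cr i⁆ = α i h • Eg α cr i := by
  have := toG_relator α cr (Relator.HE h i)
  rw [map_sub, sub_eq_zero, LieHom.map_lie, map_smul] at this
  exact this

theorem lie_HF (h : 𝔥) (i : Fin R) : ⁅Hg α cr h, Fg α cr i⁆ = - (α i h • Fg α cr i) := by
  have := toG_relator α cr (Relator.HF h i)
  rw [map_add, LieHom.map_lie, map_smul] at this
  exact eq_neg_of_add_eq_zero_left this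

theorem lie_EF (i j : Fin R) :
    ⁅Eg α cr i, Fg α cr j⁆ = if i = j then Hg α cr (cr i) else 0 := by
  split_ifs with h
  · subst h
    have := toG_relator α cr (Relator.EF_same i)
    rw [map_sub, sub_eq_zero, LieHom.map_lie] at this
    exact this
  · have := toG_relator α cr (Relator.EF_ne i j h)
    rwa [LieHom.map_lie] at this

/-- Lie algebra maps out of `𝔤`. -/
theorem exists_lift {A : Type*} [LieRing A] [LieAlgebra ℂ A]
    (e f : Fin R → A) (k : 𝔥 →ₗ[ℂ] A)
    (hk : ∀ h h', ⁅k h, k h'⁆ = 0) (he : ∀ h i, ⁅k h, e i⁆ = α i h • e i)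
    (hf : ∀ h i, ⁅k h, f i⁆ = - (α i h • f i))
    (hef : ∀ i j, ⁅e i, f j⁆ = if i = j then k (cr i) else 0) :
    ∃ ρ : 𝔤 α cr →ₗ⁅ℂ⁆ A, (∀ i, ρ (Eg α cr i) = e i) ∧ (∀ i, ρ (Fg α cr i) = f i) ∧
      ∀ h, ρ (Hg α cr h) = k h := by
  let g : Gen R 𝔥 → A := fun x => match x with
    | .E i => e i
    | .F i => f i
    | .H h => k h
  let ρ₀ := FreeLieAlgebra.lift ℂ g
  have hE : ∀ i, ρ₀ (genE 𝔥 i) = e i := fun i => FreeLieAlgebra.lift_of_apply _ _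
  have hF : ∀ i, ρ₀ (genF 𝔥 i) = f i := fun i => FreeLieAlgebra.lift_of_apply _ _
  have hH : ∀ h, ρ₀ (genH R h) = k h := fun i => FreeLieAlgebra.lift_of_apply _ _
  have hle : relatorIdeal α cr ≤ ρ₀.ker := by
    rw [LieSubmodule.lieSpan_le]
    intro x hx
    change Relator α cr x at hx
    rw [SetLike.mem_coe, LieHom.mem_ker]
    cases hx with
    | add h h' => simp [hH]
    | smul c h => simp [hH]
    | HH h h' => simp [hH, hk]
    | HE h i => simp [hH, hE, he]
    | HF h i => simp [hH, hF, hf]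
    | EF_same i => simp [hH, hE, hF, hef]
    | EF_ne i j hij => simp [hE, hF, hef, hij]
  let ρ : 𝔤 α cr →ₗ⁅ℂ⁆ A :=
    { (relatorIdeal α cr).toSubmodule.liftQ ρ₀.toLinearMap
        (fun x hx => LieHom.mem_ker.mp (hle hx)) with
      map_lie' := by
        intro x y
        obtain ⟨x, rfl⟩ := toG_surjective α cr x
        obtain ⟨y, rfl⟩ := toG_surjective α cr y
        exact ρ₀.map_lie x y }
  exact ⟨ρ, hE, hF, hH⟩

/-- The map of the free Lie algebra on `R` letters onto the subalgebra `𝔫` generated by the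
`F i`. -/
def jF : FreeLieAlgebra ℂ (Fin R) →ₗ⁅ℂ⁆ 𝔤 α cr := FreeLieAlgebra.lift ℂ (Fg α cr)
/-- The map of the free Lie algebra on `R` letters onto the subalgebra `𝔫₊` generated by the
`E i`. -/
def jE : FreeLieAlgebra ℂ (Fin R) →ₗ⁅ℂ⁆ 𝔤 α cr := FreeLieAlgebra.lift ℂ (Eg α cr)

@[simp] theorem jF_of (i : Fin R) : jF α cr (FreeLieAlgebra.of ℂ i) = Fg α cr i :=
  FreeLieAlgebra.lift_of_apply _ _
@[simp] theorem jE_of (i : Fin R) : jE α cr (FreeLieAlgebra.of ℂ i) = Eg α cr i :=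
  FreeLieAlgebra.lift_of_apply _ _

/-- The sum map `𝔫 × 𝔥 × 𝔫₊ → 𝔤`, where `𝔫` and `𝔫₊` are free Lie algebras. -/
def triSum : (FreeLieAlgebra ℂ (Fin R) × 𝔥 × FreeLieAlgebra ℂ (Fin R)) →ₗ[ℂ] 𝔤 α cr :=
  LinearMap.coprod (jF α cr : _ →ₗ[ℂ] 𝔤 α cr)
    (LinearMap.coprod (Hg α cr) (jE α cr : _ →ₗ[ℂ] 𝔤 α cr))


/-- The space with basis the words in `R` letters; it carries the Verma modules of `𝔤`, which
serve to show that the triangular decomposition is direct. -/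
abbrev Words (R : ℕ) : Type := List (Fin R) →₀ ℂ

/-- The action of `F i`. -/
def consW (i : Fin R) : Words R →ₗ[ℂ] Words R := Finsupp.lmapDomain ℂ ℂ (List.cons i)

theorem consW_single (i : Fin R) (w : List (Fin R)) (c : ℂ) :
    consW i (Finsupp.single w c) = Finsupp.single (i :: w) c := by
  simp [consW]

/-- The weight of a word in the Verma module of highest weight `lam`. -/
def wtOf (α : Fin R → Module.Dual ℂ 𝔥) (lam : Module.Dual ℂ 𝔥) (w : List (Fin R)) :
    Module.Dual ℂ 𝔥 := lam - (w.map α).sum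

/-- The action of `E i` on a word. -/
def raise (lam : Module.Dual ℂ 𝔥) (i : Fin R) : List (Fin R) → Words R
  | [] => 0
  | j :: w => consW j (raise lam i w) +
      if i = j then wtOf α lam w (cr i) • Finsupp.single w 1 else 0

/-- The action of `E i`. -/
def actE (lam : Module.Dual ℂ 𝔥) (i : Fin R) : Words R →ₗ[ℂ] Words R :=
  Finsupp.linearCombination ℂ (raise α cr lam i)

/-- The action of `𝔥`. -/
def actH (lam : Module.Dual ℂ 𝔥) : 𝔥 →ₗ[ℂ] Words R →ₗ[ℂ] Words R :=
  LinearMap.flip (Finsupp.linearCombination ℂ fun w =>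
    LinearMap.smulRight (wtOf α lam w) (Finsupp.single w (1 : ℂ)))

theorem actE_single (lam : Module.Dual ℂ 𝔥) (i : Fin R) (w : List (Fin R)) :
    actE α cr lam i (Finsupp.single w 1) = raise α cr lam i w := by
  simp [actE]

theorem actH_single (lam : Module.Dual ℂ 𝔥) (h : 𝔥) (w : List (Fin R)) :
    actH α lam h (Finsupp.single w 1) = wtOf α lam w h • Finsupp.single w 1 := by
  simp [actH]

theorem wtOf_cons (lam : Module.Dual ℂ 𝔥) (i : Fin R) (w : List (Fin R)) (h : 𝔥) :
    wtOf α lam (i :: w) h = wtOf α lam w h - α i h := by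
  simp [wtOf]; ring

theorem actH_consW (lam : Module.Dual ℂ 𝔥) (h : 𝔥) (i : Fin R) (v : Words R) :
    actH α lam h (consW i v) = consW i (actH α lam h v) - α i h • consW i v := by
  have : actH α lam h ∘ₗ consW i = consW i ∘ₗ actH α lam h - α i h • consW i := by
    refine Finsupp.lhom_ext' fun w => LinearMap.ext_ring ?_
    simp only [LinearMap.comp_apply, Finsupp.lsingle_apply, LinearMap.sub_apply,
      LinearMap.smul_apply, consW_single, actH_single, wtOf_cons, map_smul]
    rw [sub_smul]
  exact LinearMap.congr_fun this v

theorem actH_raise (lam : Module.Dual ℂ 𝔥) (h : 𝔥) (i : Fin R) (w : List (Fin R)) :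
    actH α lam h (raise α cr lam i w) = (wtOf α lam w h + α i h) • raise α cr lam i w := by
  induction w with
  | nil => simp [raise]
  | cons j w ih =>
    simp only [raise, map_add, actH_consW, ih, map_smul, wtOf_cons]
    split_ifs with hij
    · subst hij
      rw [map_smul, actH_single]
      module
    · simp only [map_zero]
      module

theorem exists_verma (lam : Module.Dual ℂ 𝔥) :
    ∃ ρ : 𝔤 α cr →ₗ⁅ℂ⁆ Module.End ℂ (Words R), (∀ i, ρ (Eg α cr i) = actE α cr lam i) ∧
      (∀ i, ρ (Fg α cr i) = consW i) ∧ ∀ h, ρ (Hg α cr h) = actH α lam h := by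
  refine exists_lift α cr (A := Module.End ℂ (Words R)) _ _ (actH α lam) ?_ ?_ ?_ ?_
  · intro h h'
    refine Finsupp.lhom_ext' fun w => LinearMap.ext_ring ?_
    simp only [LinearMap.comp_apply, Finsupp.lsingle_apply, Ring.lie_def, LinearMap.sub_apply,
      Module.End.mul_apply, actH_single, map_smul, LinearMap.zero_apply]
    module
  · intro h i
    refine Finsupp.lhom_ext' fun w => LinearMap.ext_ring ?_
    simp only [LinearMap.comp_apply, Finsupp.lsingle_apply, Ring.lie_def, LinearMap.sub_apply,
      Module.End.mul_apply, actH_single, map_smul, actE_single, actH_raise, LinearMap.smul_apply]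
    module
  · intro h i
    refine LinearMap.ext fun v => ?_
    simp only [Ring.lie_def, LinearMap.sub_apply, Module.End.mul_apply, actH_consW,
      LinearMap.neg_apply, LinearMap.smul_apply]
    module
  · intro i j
    refine Finsupp.lhom_ext' fun w => LinearMap.ext_ring ?_
    simp only [LinearMap.comp_apply, Finsupp.lsingle_apply, Ring.lie_def, LinearMap.sub_apply,
      Module.End.mul_apply, consW_single, actE_single, raise]
    split_ifs with hij
    · rw [actH_single]; module
    · simp

/-- Right-nested commutators. -/
def nest : List (Fin R) → FreeLieAlgebra ℂ (Fin R)
  | [] => 0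
  | [i] => FreeLieAlgebra.of ℂ i
  | i :: j :: w => ⁅FreeLieAlgebra.of ℂ i, nest (j :: w)⁆

/-- The linear extension of `nest`. -/
def nestL : Words R →ₗ[ℂ] FreeLieAlgebra ℂ (Fin R) :=
  Finsupp.linearCombination ℂ nest

/-- Right-nested commutators, divided by the length. -/
def dyn : Words R →ₗ[ℂ] FreeLieAlgebra ℂ (Fin R) :=
  Finsupp.linearCombination ℂ
    (fun w : List (Fin R) => ((w.length : ℂ)⁻¹ • nest w : FreeLieAlgebra ℂ (Fin R)))

/-- Words of a given length. -/
def homog (R n : ℕ) : Submodule ℂ (Words R) := Finsupp.supported ℂ ℂ {w : List (Fin R) | w.length = n}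

theorem consW_mem_homog {n : ℕ} {v : Words R} (i : Fin R) (hv : v ∈ homog R n) :
    consW i v ∈ homog R (n + 1) := by
  have : homog R n ≤ (homog R (n + 1)).comap (consW i) := by
    unfold homog
    rw [Finsupp.supported_eq_span_single, Submodule.span_le]
    rintro _ ⟨w, hw, rfl⟩
    change consW i (Finsupp.single w 1) ∈ homog R (n + 1)
    rw [consW_single]
    exact Finsupp.single_mem_supported _ _ (by simpa using hw)
  exact this hv

theorem nestL_consW {n : ℕ} {v : Words R} (i : Fin R) (hv : v ∈ homog R (n + 1)) :
    nestL (consW i v) = ⁅FreeLieAlgebra.of ℂ i, nestL v⁆ := by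
  have : homog R (n + 1) ≤ LinearMap.eqLocus (nestL ∘ₗ consW i)
      ((LieAlgebra.ad ℂ (FreeLieAlgebra ℂ (Fin R)) (FreeLieAlgebra.of ℂ i)) ∘ₗ nestL) := by
    unfold homog
    rw [Finsupp.supported_eq_span_single, Submodule.span_le]
    rintro _ ⟨w, hw, rfl⟩
    change nestL (consW i _) = ⁅FreeLieAlgebra.of ℂ i, nestL _⁆
    rw [consW_single]
    cases w with
    | nil => simp at hw
    | cons j w => simp [nestL, nest]
  exact this hv

theorem dyn_of_homog {n : ℕ} {v : Words R} (hv : v ∈ homog R n) :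
    dyn v = (n : ℂ)⁻¹ • nestL v := by
  have : homog R n ≤ LinearMap.eqLocus dyn ((n : ℂ)⁻¹ • nestL) := by
    unfold homog
    rw [Finsupp.supported_eq_span_single, Submodule.span_le]
    rintro _ ⟨w, hw, rfl⟩
    change dyn _ = (n : ℂ)⁻¹ • nestL _
    have : w.length = n := hw
    simp [dyn, nestL, this]
  exact this hv

variable {lam : Module.Dual ℂ 𝔥} {ρ : 𝔤 α cr →ₗ⁅ℂ⁆ Module.End ℂ (Words R)}

/-- The action of a commutator raises the length. -/
theorem verma_comm_homog (hF : ∀ i, ρ (Fg α cr i) = consW i) (x : FreeMagma (Fin R)) :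
    ∀ {n : ℕ} {v : Words R}, v ∈ homog R n →
      ρ (jF α cr (commutatorOf x)) v ∈ homog R (n + x.length) := by
  induction x using FreeMagma.recOnMul with
  | ih1 i =>
    intro n v hv
    change ρ (jF α cr (FreeLieAlgebra.of ℂ i)) v ∈ _
    rw [jF_of, hF]
    exact consW_mem_homog i hv
  | ih2 a b ha hb =>
    intro n v hv
    change ρ (jF α cr ⁅commutatorOf a, commutatorOf b⁆) v ∈ homog R (n + (a.length + b.length))
    rw [LieHom.map_lie, LieHom.map_lie, Ring.lie_def, LinearMap.sub_apply, Module.End.mul_apply,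
      Module.End.mul_apply]
    refine Submodule.sub_mem _ ?_ ?_
    · have := ha (hb hv)
      rwa [add_assoc, add_comm b.length] at this
    · have := hb (ha hv)
      rwa [add_assoc] at this

theorem nestL_verma (hF : ∀ i, ρ (Fg α cr i) = consW i) (x : FreeMagma (Fin R)) :
    ∀ {n : ℕ} {v : Words R}, v ∈ homog R (n + 1) →
      nestL (ρ (jF α cr (commutatorOf x)) v) = ⁅commutatorOf x, nestL v⁆ := by
  induction x using FreeMagma.recOnMul with
  | ih1 i =>
    intro n v hv
    change nestL (ρ (jF α cr (FreeLieAlgebra.of ℂ i)) v) = ⁅FreeLieAlgebra.of ℂ i, _⁆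
    rw [jF_of, hF]
    exact nestL_consW i hv
  | ih2 a b ha hb =>
    intro n v hv
    change nestL (ρ (jF α cr ⁅commutatorOf a, commutatorOf b⁆) v) =
      ⁅⁅commutatorOf a, commutatorOf b⁆, nestL v⁆
    rw [LieHom.map_lie, LieHom.map_lie, Ring.lie_def, LinearMap.sub_apply, Module.End.mul_apply,
      Module.End.mul_apply, map_sub]
    have h1 : ρ (jF α cr (commutatorOf b)) v ∈ homog R (n + b.length + 1) := by
      have := verma_comm_homog α cr hF b hv
      rwa [add_right_comm] at this
    have h2 : ρ (jF α cr (commutatorOf a)) v ∈ homog R (n + a.length + 1) := by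
      have := verma_comm_homog α cr hF a hv
      rwa [add_right_comm] at this
    rw [ha h1, hb h2, ha hv, hb hv, lie_lie]

theorem nestL_vacuum (hF : ∀ i, ρ (Fg α cr i) = consW i) (x : FreeMagma (Fin R)) :
    nestL (ρ (jF α cr (commutatorOf x)) (Finsupp.single [] 1)) =
      (x.length : ℂ) • commutatorOf x := by
  have h0 : (Finsupp.single [] 1 : Words R) ∈ homog R 0 :=
    Finsupp.single_mem_supported _ _ rfl
  induction x using FreeMagma.recOnMul with
  | ih1 i =>
    change nestL (ρ (jF α cr (FreeLieAlgebra.of ℂ i)) _) = ((1 : ℕ) : ℂ) • FreeLieAlgebra.of ℂ i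
    rw [jF_of, hF, consW_single]
    simp [nestL, nest]
  | ih2 a b ha hb =>
    change nestL (ρ (jF α cr ⁅commutatorOf a, commutatorOf b⁆) _) =
      ((a.length + b.length : ℕ) : ℂ) • ⁅commutatorOf a, commutatorOf b⁆
    rw [LieHom.map_lie, LieHom.map_lie, Ring.lie_def, LinearMap.sub_apply, Module.End.mul_apply,
      Module.End.mul_apply, map_sub]
    have h1 : ρ (jF α cr (commutatorOf b)) (Finsupp.single [] 1) ∈
        homog R (b.length - 1 + 1) := by
      have := verma_comm_homog α cr hF b h0
      rwa [zero_add, ← Nat.sub_add_cancel b.length_pos] at this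
    have h2 : ρ (jF α cr (commutatorOf a)) (Finsupp.single [] 1) ∈
        homog R (a.length - 1 + 1) := by
      have := verma_comm_homog α cr hF a h0
      rwa [zero_add, ← Nat.sub_add_cancel a.length_pos] at this
    rw [nestL_verma α cr hF a h1, nestL_verma α cr hF b h2, ha, hb, lie_smul, lie_smul,
      ← lie_skew (commutatorOf a)]
    push_cast
    module

theorem span_commutators (X : Type*) :
    Submodule.span ℂ (Set.range (commutatorOf (X := X))) = ⊤ := by
  let S : LieSubalgebra ℂ (FreeLieAlgebra ℂ X) :=
    { Submodule.span ℂ (Set.range (commutatorOf (X := X))) with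
      lie_mem' := by
        intro x y hx hy
        change x ∈ Submodule.span ℂ _ at hx
        change y ∈ Submodule.span ℂ _ at hy
        change ⁅x, y⁆ ∈ Submodule.span ℂ _
        induction hx using Submodule.span_induction with
        | mem x hx =>
          obtain ⟨a, rfl⟩ := hx
          induction hy using Submodule.span_induction with
          | mem y hy =>
            obtain ⟨b, rfl⟩ := hy
            exact Submodule.subset_span ⟨a * b, rfl⟩
          | zero => simp
          | add y z _ _ h1 h2 => rw [lie_add]; exact add_mem h1 h2
          | smul c y _ h => rw [lie_smul]; exact Submodule.smul_mem _ _ h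
        | zero => simp
        | add y z _ _ h1 h2 => rw [add_lie]; exact add_mem h1 h2
        | smul c y _ h => rw [smul_lie]; exact Submodule.smul_mem _ _ h }
  let g : FreeLieAlgebra ℂ X →ₗ⁅ℂ⁆ S :=
    FreeLieAlgebra.lift ℂ fun x => ⟨FreeLieAlgebra.of ℂ x, Submodule.subset_span ⟨.of x, rfl⟩⟩
  have h : S.incl.comp g = LieHom.id := by
    apply FreeLieAlgebra.hom_ext
    intro x
    simp [g]
  rw [eq_top_iff]
  intro x _
  have := LieHom.congr_fun h x
  rw [show x = S.incl (g x) from this.symm]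
  exact (g x).2

theorem dyn_verma (hF : ∀ i, ρ (Fg α cr i) = consW i) (a : FreeLieAlgebra ℂ (Fin R)) :
    dyn (ρ (jF α cr a) (Finsupp.single [] 1)) = a := by
  have ha : a ∈ Submodule.span ℂ (Set.range (commutatorOf (X := Fin R))) := by
    rw [span_commutators]; trivial
  have h0 : (Finsupp.single [] 1 : Words R) ∈ homog R 0 :=
    Finsupp.single_mem_supported _ _ rfl
  induction ha using Submodule.span_induction with
  | mem x hx =>
    obtain ⟨w, rfl⟩ := hx
    rw [dyn_of_homog (verma_comm_homog α cr hF w h0), nestL_vacuum α cr hF, smul_smul, zero_add,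
      inv_mul_cancel₀ (Nat.cast_ne_zero.mpr w.length_pos.ne'), one_smul]
  | zero => simp
  | add x y _ _ h1 h2 => simp [h1, h2]
  | smul c x _ h => simp [h]

theorem verma_const (hF : ∀ i, ρ (Fg α cr i) = consW i) (a : FreeLieAlgebra ℂ (Fin R)) :
    ρ (jF α cr a) (Finsupp.single [] 1) [] = 0 := by
  have ha : a ∈ Submodule.span ℂ (Set.range (commutatorOf (X := Fin R))) := by
    rw [span_commutators]; trivial
  have h0 : (Finsupp.single [] 1 : Words R) ∈ homog R 0 :=
    Finsupp.single_mem_supported _ _ rfl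
  induction ha using Submodule.span_induction with
  | mem x hx =>
    obtain ⟨w, rfl⟩ := hx
    have := verma_comm_homog α cr hF w h0
    by_contra hne
    have h1 := (Finsupp.mem_supported ℂ _).mp this (Finsupp.mem_support_iff.mpr hne)
    have h2 : 0 = 0 + w.length := h1
    have := w.length_pos
    omega
  | zero => simp
  | add x y _ _ h1 h2 => simp [h1, h2]
  | smul c x _ h => simp [h]

theorem verma_jE (hE : ∀ i, ρ (Eg α cr i) = actE α cr lam i) (b : FreeLieAlgebra ℂ (Fin R)) :
    ρ (jE α cr b) (Finsupp.single [] 1) = 0 := by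
  have hb : b ∈ Submodule.span ℂ (Set.range (commutatorOf (X := Fin R))) := by
    rw [span_commutators]; trivial
  induction hb using Submodule.span_induction with
  | mem x hx =>
    obtain ⟨w, rfl⟩ := hx
    induction w using FreeMagma.recOnMul with
    | ih1 i =>
      change ρ (jE α cr (FreeLieAlgebra.of ℂ i)) _ = 0
      rw [jE_of, hE, actE_single]; rfl
    | ih2 a b ha hb =>
      change ρ (jE α cr ⁅commutatorOf a, commutatorOf b⁆) _ = 0
      rw [LieHom.map_lie, LieHom.map_lie, Ring.lie_def, LinearMap.sub_apply, Module.End.mul_apply,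
        Module.End.mul_apply, ha, hb]
      simp
  | zero => simp
  | add x y _ _ h1 h2 => simp [h1, h2]
  | smul c x _ h => simp [h]

/-- The involution exchanging the `E i` and the `F i`. -/
theorem exists_chevalley : ∃ θ : 𝔤 α cr →ₗ⁅ℂ⁆ 𝔤 α cr, (∀ i, θ (Eg α cr i) = Fg α cr i) ∧
    (∀ i, θ (Fg α cr i) = Eg α cr i) ∧ ∀ h, θ (Hg α cr h) = - Hg α cr h := by
  refine exists_lift α cr (Fg α cr) (Eg α cr) (- Hg α cr) ?_ ?_ ?_ ?_
  · intro h h'; simp [lie_HH]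
  · intro h i; simp [lie_HF]
  · intro h i; simp [lie_HE]
  · intro i j
    rw [← lie_skew, lie_EF]
    by_cases h : i = j
    · subst h; simp
    · rw [if_neg h, if_neg (Ne.symm h), neg_zero]

theorem triSum_injective : Function.Injective (triSum α cr) := by
  have hminus : ∀ a h b, triSum α cr (a, h, b) = 0 → a = 0 ∧ h = 0 := by
    intro a h b h0
    have h0' : jF α cr a + (Hg α cr h + jE α cr b) = 0 := h0
    have key : ∀ lam : Module.Dual ℂ 𝔥, ∃ ρ : 𝔤 α cr →ₗ⁅ℂ⁆ Module.End ℂ (Words R),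
        (∀ i, ρ (Fg α cr i) = consW i) ∧
        ρ (jF α cr a) (Finsupp.single [] 1) + lam h • Finsupp.single [] 1 = 0 := by
      intro lam
      obtain ⟨ρ, hE, hF, hH⟩ := exists_verma α cr lam
      refine ⟨ρ, hF, ?_⟩
      have := congrArg (fun z => ρ z (Finsupp.single [] 1)) h0'
      simp only [map_add, LinearMap.add_apply, map_zero, LinearMap.zero_apply, hH,
        actH_single, verma_jE α cr hE, add_zero] at this
      simpa [wtOf] using this
    constructor
    · obtain ⟨ρ, hF, h1⟩ := key 0
      rw [LinearMap.zero_apply, zero_smul, add_zero] at h1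
      rw [← dyn_verma α cr hF a, h1, map_zero]
    · rw [← Module.forall_dual_apply_eq_zero_iff ℂ]
      intro lam
      obtain ⟨ρ, hF, h1⟩ := key lam
      have := congrArg (fun v : Words R => v []) h1
      simpa [verma_const α cr hF a] using this
  obtain ⟨θ, hE, hF, hH⟩ := exists_chevalley α cr
  have hθ : ∀ b, θ (jE α cr b) = jF α cr b := by
    intro b
    have : θ.comp (jE α cr) = jF α cr := by
      apply FreeLieAlgebra.hom_ext
      intro i
      simp [hE]
    exact LieHom.congr_fun this b
  rw [← LinearMap.ker_eq_bot, LinearMap.ker_eq_bot']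
  rintro ⟨a, h, b⟩ h0
  obtain ⟨rfl, rfl⟩ := hminus a h b h0
  have h1 : jE α cr b = 0 := by simpa [triSum] using h0
  have h2 : triSum α cr (b, 0, 0) = 0 := by
    simp [triSum, ← hθ, h1]
  rw [(hminus b 0 0 h2).1]
  rfl

theorem lie_H_jF (h : 𝔥) (a : FreeLieAlgebra ℂ (Fin R)) :
    ∃ a', ⁅Hg α cr h, jF α cr a⁆ = jF α cr a' := by
  have ha : a ∈ Submodule.span ℂ (Set.range (commutatorOf (X := Fin R))) := by
    rw [span_commutators]; trivial
  induction ha using Submodule.span_induction with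
  | mem x hx =>
    obtain ⟨w, rfl⟩ := hx
    induction w using FreeMagma.recOnMul with
    | ih1 i =>
      refine ⟨- (α i h • FreeLieAlgebra.of ℂ i), ?_⟩
      change ⁅Hg α cr h, jF α cr (FreeLieAlgebra.of ℂ i)⁆ = _
      rw [jF_of, lie_HF]; simp
    | ih2 a b ha hb =>
      obtain ⟨a', ha'⟩ := ha
      obtain ⟨b', hb'⟩ := hb
      refine ⟨⁅a', commutatorOf b⁆ + ⁅commutatorOf a, b'⁆, ?_⟩
      change ⁅Hg α cr h, jF α cr ⁅commutatorOf a, commutatorOf b⁆⁆ = _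
      rw [LieHom.map_lie, leibniz_lie, ha', hb', map_add, LieHom.map_lie, LieHom.map_lie]
  | zero => exact ⟨0, by simp⟩
  | add x y _ _ h1 h2 =>
    obtain ⟨a', ha'⟩ := h1
    obtain ⟨b', hb'⟩ := h2
    exact ⟨a' + b', by rw [map_add, lie_add, ha', hb', map_add]⟩
  | smul c x _ h =>
    obtain ⟨a', ha'⟩ := h
    exact ⟨c • a', by rw [map_smul, lie_smul, ha', map_smul]⟩

theorem lie_E_jF (i : Fin R) (a : FreeLieAlgebra ℂ (Fin R)) :
    ∃ a' h', ⁅Eg α cr i, jF α cr a⁆ = jF α cr a' + Hg α cr h' := by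
  have ha : a ∈ Submodule.span ℂ (Set.range (commutatorOf (X := Fin R))) := by
    rw [span_commutators]; trivial
  induction ha using Submodule.span_induction with
  | mem x hx =>
    obtain ⟨w, rfl⟩ := hx
    induction w using FreeMagma.recOnMul with
    | ih1 j =>
      refine ⟨0, if i = j then cr i else 0, ?_⟩
      change ⁅Eg α cr i, jF α cr (FreeLieAlgebra.of ℂ j)⁆ = _
      rw [jF_of, lie_EF]; split_ifs <;> simp
    | ih2 a b ha hb =>
      obtain ⟨a', h1, ha'⟩ := ha
      obtain ⟨b', h2, hb'⟩ := hb
      obtain ⟨c, hc⟩ := lie_H_jF α cr h1 (commutatorOf b)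
      obtain ⟨d, hd⟩ := lie_H_jF α cr h2 (commutatorOf a)
      refine ⟨⁅a', commutatorOf b⁆ + c + (⁅commutatorOf a, b'⁆ - d), 0, ?_⟩
      change ⁅Eg α cr i, jF α cr ⁅commutatorOf a, commutatorOf b⁆⁆ = _
      rw [LieHom.map_lie, leibniz_lie, ha', hb', add_lie, lie_add, hc,
        ← lie_skew _ (Hg α cr h2), hd]
      simp only [map_add, map_sub, LieHom.map_lie, map_zero]
      abel
  | zero => exact ⟨0, 0, by simp⟩
  | add x y _ _ h1 h2 =>
    obtain ⟨a', h1, ha'⟩ := h1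
    obtain ⟨b', h2, hb'⟩ := h2
    refine ⟨a' + b', h1 + h2, ?_⟩
    rw [map_add, lie_add, ha', hb', map_add, map_add]; abel
  | smul c x _ h =>
    obtain ⟨a', h, ha'⟩ := h
    exact ⟨c • a', c • h, by rw [map_smul, lie_smul, ha', map_smul, map_smul, smul_add]⟩

theorem triSum_surjective : Function.Surjective (triSum α cr) := by
  obtain ⟨θ, hθE, hθF, hθH⟩ := exists_chevalley α cr
  have θE : ∀ b, θ (jE α cr b) = jF α cr b := by
    intro b
    have : θ.comp (jE α cr) = jF α cr := by
      apply FreeLieAlgebra.hom_ext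
      intro i
      simp [hθE]
    exact LieHom.congr_fun this b
  have θF : ∀ b, θ (jF α cr b) = jE α cr b := by
    intro b
    have : θ.comp (jF α cr) = jE α cr := by
      apply FreeLieAlgebra.hom_ext
      intro i
      simp [hθF]
    exact LieHom.congr_fun this b
  let S := LinearMap.range (triSum α cr)
  have memF : ∀ a, jF α cr a ∈ S := fun a => ⟨(a, 0, 0), by simp [triSum]⟩
  have memH : ∀ h, Hg α cr h ∈ S := fun h => ⟨(0, h, 0), by simp [triSum]⟩
  have memE : ∀ b, jE α cr b ∈ S := fun b => ⟨(0, 0, b), by simp [triSum]⟩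
  have θS : ∀ s ∈ S, θ s ∈ S ∧ θ (θ s) = s := by
    rintro _ ⟨⟨a, h, b⟩, rfl⟩
    constructor
    · refine ⟨(b, -h, a), ?_⟩
      simp [triSum, θE, θF, hθH]; abel
    · simp [triSum, θE, θF, hθH]
  have adE : ∀ i, ∀ s ∈ S, ⁅Eg α cr i, s⁆ ∈ S := by
    rintro i _ ⟨⟨a, h, b⟩, rfl⟩
    change ⁅Eg α cr i, jF α cr a + (Hg α cr h + jE α cr b)⁆ ∈ S
    rw [lie_add, lie_add]
    obtain ⟨a', h', e⟩ := lie_E_jF α cr i a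
    rw [e, ← lie_skew (Eg α cr i) (Hg α cr h), lie_HE, ← jE_of, ← LieHom.map_lie]
    exact add_mem (add_mem (memF _) (memH _))
      (add_mem (neg_mem (S.smul_mem _ (memE _))) (memE _))
  have adF : ∀ i, ∀ s ∈ S, ⁅Fg α cr i, s⁆ ∈ S := by
    intro i s hs
    have := (θS _ (adE i (θ s) (θS s hs).1)).1
    rwa [LieHom.map_lie, hθE, (θS s hs).2] at this
  have adH' : ∀ h a, ⁅Hg α cr h, jF α cr a⁆ ∈ S := by
    intro h a
    obtain ⟨a', e⟩ := lie_H_jF α cr h a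
    rw [e]; exact memF _
  have adH : ∀ h, ∀ s ∈ S, ⁅Hg α cr h, s⁆ ∈ S := by
    rintro h _ ⟨⟨a, h', b⟩, rfl⟩
    change ⁅Hg α cr h, jF α cr a + (Hg α cr h' + jE α cr b)⁆ ∈ S
    rw [lie_add, lie_add, lie_HH]
    refine add_mem (adH' h a) (add_mem (zero_mem _) ?_)
    have := (θS _ (adH' (-h) b)).1
    rwa [LieHom.map_lie, θF, hθH, map_neg, neg_neg] at this
  have key : ∀ x : FreeLieAlgebra ℂ (Gen R 𝔥), toG α cr x ∈ S ∧
      ∀ s ∈ S, ⁅toG α cr x, s⁆ ∈ S := by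
    intro x
    have hx : x ∈ Submodule.span ℂ (Set.range (commutatorOf (X := Gen R 𝔥))) := by
      rw [span_commutators]; trivial
    induction hx using Submodule.span_induction with
    | mem x hx =>
      obtain ⟨w, rfl⟩ := hx
      induction w using FreeMagma.recOnMul with
      | ih1 g =>
        change toG α cr (FreeLieAlgebra.of ℂ g) ∈ S ∧
          ∀ s ∈ S, ⁅toG α cr (FreeLieAlgebra.of ℂ g), s⁆ ∈ S
        cases g with
        | E i =>
          have := memE (FreeLieAlgebra.of ℂ i)
          rw [jE_of] at this
          exact ⟨this, adE i⟩
        | F i =>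
          have := memF (FreeLieAlgebra.of ℂ i)
          rw [jF_of] at this
          exact ⟨this, adF i⟩
        | H h => exact ⟨memH h, adH h⟩
      | ih2 a b ha hb =>
        change toG α cr ⁅commutatorOf a, commutatorOf b⁆ ∈ S ∧
          ∀ s ∈ S, ⁅toG α cr ⁅commutatorOf a, commutatorOf b⁆, s⁆ ∈ S
        rw [LieHom.map_lie]
        refine ⟨ha.2 _ hb.1, fun s hs => ?_⟩
        rw [lie_lie]
        exact sub_mem (ha.2 _ (hb.2 _ hs)) (hb.2 _ (ha.2 _ hs))
    | zero => simp
    | add x y _ _ h1 h2 =>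
      refine ⟨by rw [map_add]; exact add_mem h1.1 h2.1, fun s hs => ?_⟩
      rw [map_add, add_lie]
      exact add_mem (h1.2 s hs) (h2.2 s hs)
    | smul c x _ h =>
      refine ⟨by rw [map_smul]; exact S.smul_mem _ h.1, fun s hs => ?_⟩
      rw [map_smul, smul_lie]
      exact S.smul_mem _ (h.2 s hs)
  intro y
  obtain ⟨x, rfl⟩ := toG_surjective α cr y
  exact (key x).1

/-- The triangular decomposition `𝔤 = 𝔫 ⊕ 𝔥 ⊕ 𝔫₊`. -/
def triangular : (FreeLieAlgebra ℂ (Fin R) × 𝔥 × FreeLieAlgebra ℂ (Fin R)) ≃ₗ[ℂ] 𝔤 α cr :=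
  LinearEquiv.ofBijective (triSum α cr) ⟨triSum_injective α cr, triSum_surjective α cr⟩


end Triangular

/-! ### The cyclotomic arrangement and flags -/

section Arrangement

variable {T m : ℕ}

/-- The generators `f^k_p` of the free Lie algebra `𝔞`; the letter `(k, p)` stands for `f^k_p`. -/
abbrev Letter (T m : ℕ) : Type := ZMod T × Fin m

/-- Indices of the diagonal hyperplanes in `ℂ^m`: the triple `(i, j, k)` with `i < j` stands for
`t_i = ω^k t_j`. -/
abbrev Diag (T m : ℕ) : Type := {p : Fin m × Fin m × ZMod T // p.1 < p.2.1}

/-- The hyperplane `t_i = ω^k t_j`. -/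
def diagHyperplane (ω : ℂ) (h : Diag T m) : Submodule ℂ (Fin m → ℂ) where
  carrier := {t | t h.1.1 = ω ^ h.1.2.2.val * t h.1.2.1}
  zero_mem' := by simp
  add_mem' := by
    intro s t hs ht
    simp only [Set.mem_ofPred_eq, Pi.add_apply] at *
    rw [hs, ht, mul_add]
  smul_mem' := by
    intro c t ht
    simp only [Set.mem_ofPred_eq, Pi.smul_apply, smul_eq_mul] at *
    rw [ht]; ring

/-- The edge `L_g`: `ω^{k_1} t_{i_1} = ⋯ = ω^{k_l} t_{i_l}`, where `c = {(k_1, i_1), …, (k_l, i_l)}` is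
the content of the commutator `g`. -/
def edge (ω : ℂ) (c : Multiset (Letter T m)) : Submodule ℂ (Fin m → ℂ) where
  carrier := {t | ∀ x ∈ c, ∀ y ∈ c, ω ^ x.1.val * t x.2 = ω ^ y.1.val * t y.2}
  zero_mem' := by simp
  add_mem' := by
    intro s t hs ht x hx y hy
    simp only [Pi.add_apply, mul_add]
    rw [hs x hx y hy, ht x hx y hy]
  smul_mem' := by
    intro r t ht x hx y hy
    have := ht x hx y hy
    simp only [Pi.smul_apply, smul_eq_mul]
    linear_combination r * this

/-- The edge `L_g^0`: `t_{i_1} = ⋯ = t_{i_l} = 0`. -/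
def zeroEdge (c : Multiset (Letter T m)) : Submodule ℂ (Fin m → ℂ) where
  carrier := {t | ∀ x ∈ c, t x.2 = 0}
  zero_mem' := by simp
  add_mem' := by
    intro s t hs ht x hx
    simp [hs x hx, ht x hx]
  smul_mem' := by
    intro r t ht x hx
    simp [ht x hx]

/-- The content of a word, as a multiset. A word in the free magma stands for a (formal)
commutator. -/
def content {X : Type*} : FreeMagma X → Multiset X
  | .of x => {x}
  | .mul a b => content a + content b

/-- The edges by which one successively intersects in forming the flag of the projected commutator of
a word. For `w = [a, b]` one starts from `… ∧ b ∧ a`, forms the commutators `b` and `a`, and finally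
intersects with `L_{[a, b]}`. -/
def joins (ω : ℂ) : FreeMagma (Letter T m) → List (Submodule ℂ (Fin m → ℂ))
  | .of _ => []
  | .mul a b => joins ω b ++ joins ω a ++ [edge ω (content a + content b)]

/-- The order in which the letters of a word appear in the wedge product from which the commutator
is formed: `[a, b]` is formed from `b ∧ a`. -/
def wedgeOrder {X : Type*} : FreeMagma X → List X
  | .of x => [x]
  | .mul a b => wedgeOrder b ++ wedgeOrder a

/-- The sign arising when the steps in `joins` are carried out. Only the last factors of a wedge
product may be combined, so the letters of `b` (in `b ∧ a`) have to be moved to the end past the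
`a.length` letters of `a`, and after `b` has been formed, `b` is moved back. -/
def psiSign {X : Type*} : FreeMagma X → ℂ
  | .of _ => 1
  | .mul a b => psiSign a * psiSign b * (-1) ^ (a.length * (b.length - 1))

/-- The coefficient of the wedge product of the letters in the list `c` with respect to
`f_1 ∧ ⋯ ∧ f_m` (projected letters, which do not depend on the superscript). It is a sign if every
index in `{1, …, m}` occurs exactly once in `c`, and zero otherwise; the latter implements the
projection to the weight `(1, …, 1)`. -/
def wedgeCoeff (c : List (Letter T m)) : ℂ :=
  if h : c.length = m then
    Matrix.det (Matrix.of fun a b : Fin m => if (c.get (Fin.cast h.symm a)).2 = b then (1 : ℂ) else 0)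
  else 0

/-- The intersection of the first `n` members of a list of subspaces. -/
def cumInf (Ls : List (Submodule ℂ (Fin m → ℂ))) (n : ℕ) : Submodule ℂ (Fin m → ℂ) :=
  (Ls.take n).foldr (· ⊓ ·) ⊤

/-- The members `L^1 ⊃ ⋯ ⊃ L^m` of the full flag attached to the vector `\bar g v_0`, where `g` is the
commutator given by the word `w`: the flag of `\bar g`, followed by the intersection with `L_g^0`. -/
def wordFlag (ω : ℂ) (w : FreeMagma (Letter T m)) (i : Fin m) : Submodule ℂ (Fin m → ℂ) :=
  cumInf (joins ω w ++ [zeroEdge (content w)]) (i + 1)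

open Classical in
/-- The pairing `⟨F, H_1 ∧ ⋯ ∧ H_m⟩` of a full flag with a tuple of diagonal hyperplanes: the sum of the
signs of the permutations `s` for which `F` is the flag
`H_{s 1} ⊃ H_{s 1} ∩ H_{s 2} ⊃ ⋯`. It is the sign of adjacency if the tuple is adjacent to the flag,
and zero otherwise. -/
def flagPairing (ω : ℂ) (F : Fin m → Submodule ℂ (Fin m → ℂ)) (H : Fin m → Diag T m) : ℂ :=
  ∑ s : Equiv.Perm (Fin m),
    if ∀ i, F i = ⨅ (j : Fin m) (_ : j ≤ i), diagHyperplane ω (H (s j))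
    then ((Equiv.Perm.sign s : ℤ) : ℂ) else 0

/-- The flag `ψ(\bar g v_0)`, with its sign, as a functional on `m`-tuples of diagonal hyperplanes; here
`g` is the commutator given by the word `w`, projected to the weight `(1, …, 1)`. -/
def psiWord (ω : ℂ) (w : FreeMagma (Letter T m)) (H : Fin m → Diag T m) : ℂ :=
  psiSign w * wedgeCoeff (wedgeOrder w) * flagPairing ω (wordFlag ω w) H

end Arrangement

/-! ### Linearity of `ψ`

The rule `psiWord` respects the relations between commutators, hence defines a linear map on the free
Lie algebra. The proof compares it with products in an exterior algebra. -/

section ExistsPsi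

variable {T m : ℕ}

theorem root_add {ω : ℂ} [NeZero T] (hω : IsPrimitiveRoot ω T) (k l : ZMod T) :
    ω ^ (k + l).val = ω ^ k.val * ω ^ l.val := by
  rw [ZMod.val_add, ← pow_add]
  exact (pow_eq_pow_mod _ hω.pow_eq_one).symm

theorem root_inj {ω : ℂ} [NeZero T] (hω : IsPrimitiveRoot ω T) {k l : ZMod T}
    (h : ω ^ k.val = ω ^ l.val) : k = l :=
  ZMod.val_injective T (hω.pow_inj (ZMod.val_lt k) (ZMod.val_lt l) h)

theorem root_ne {ω : ℂ} [NeZero T] (hω : IsPrimitiveRoot ω T) (k : ZMod T) : ω ^ k.val ≠ 0 :=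
  pow_ne_zero _ (hω.ne_zero (NeZero.ne T))

/-- The indicator of the hyperplane joining two letters. -/
def linkVec (x y : Letter T m) : Diag T m → ℂ := fun h =>
  if (h.1.1 = x.2 ∧ h.1.2.1 = y.2 ∧ h.1.2.2 = y.1 - x.1) ∨
     (h.1.1 = y.2 ∧ h.1.2.1 = x.2 ∧ h.1.2.2 = x.1 - y.1) then 1 else 0

theorem linkVec_comm (x y : Letter T m) : linkVec x y = linkVec y x := by
  ext h; simp only [linkVec, or_comm]

/-- The sum of the indicators of all hyperplanes that join two multisets of letters. -/
def linkSum (c d : Multiset (Letter T m)) : Diag T m → ℂ :=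
  (c.map fun x => (d.map fun y => linkVec x y).sum).sum

theorem linkSum_add_left (c c' d : Multiset (Letter T m)) :
    linkSum (c + c') d = linkSum c d + linkSum c' d := by simp [linkSum]

theorem linkSum_add_right (c d d' : Multiset (Letter T m)) :
    linkSum c (d + d') = linkSum c d + linkSum c d' := by simp [linkSum]

theorem linkSum_comm (c d : Multiset (Letter T m)) : linkSum c d = linkSum d c := by
  unfold linkSum
  rw [Multiset.sum_map_sum_map]
  simp_rw [linkVec_comm]

/-- Exterior algebra on the letters and the diagonal hyperplanes. -/
abbrev Ext (T m : ℕ) : Type := ExteriorAlgebra ℂ ((Fin m → ℂ) × (Diag T m → ℂ))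

/-- The exterior generator of a letter. -/
def xiVec (x : Letter T m) : (Fin m → ℂ) × (Diag T m → ℂ) := (Pi.single x.2 1, 0)

/-- The exterior generator of a combination of hyperplanes. -/
def eVec (v : Diag T m → ℂ) : (Fin m → ℂ) × (Diag T m → ℂ) := (0, v)

theorem eVec_add (v w : Diag T m → ℂ) : eVec (v + w) = eVec v + eVec w := by simp [eVec]

/-- The exterior algebra counterpart of `psiWord`. -/
def wordExt : FreeMagma (Letter T m) → Ext T m
  | .of x => ExteriorAlgebra.ι ℂ (xiVec x)
  | .mul a b => wordExt b * wordExt a *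
      ExteriorAlgebra.ι ℂ (eVec (linkSum (content a) (content b)))

theorem iota_anti (u v : (Fin m → ℂ) × (Diag T m → ℂ)) :
    ExteriorAlgebra.ι ℂ u * ExteriorAlgebra.ι ℂ v =
      - (ExteriorAlgebra.ι ℂ v * ExteriorAlgebra.ι ℂ u) :=
  eq_neg_of_add_eq_zero_left (ExteriorAlgebra.ι_add_mul_swap u v)

/-- Elements anticommuting with all generators. -/
def OddEl (y : Ext T m) : Prop :=
  ∀ v, y * ExteriorAlgebra.ι ℂ v = - (ExteriorAlgebra.ι ℂ v * y)

theorem OddEl.mul3 {a b c : Ext T m} (ha : OddEl a) (hb : OddEl b) (hc : OddEl c) :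
    OddEl (a * b * c) := by
  intro v
  rw [mul_assoc, hc v, mul_neg, ← mul_assoc, mul_assoc a b, hb v, mul_neg, ← mul_assoc a, ha v]
  noncomm_ring

theorem oddEl_wordExt (w : FreeMagma (Letter T m)) : OddEl (wordExt w) := by
  induction w using FreeMagma.recOnMul with
  | ih1 x => exact fun v => iota_anti _ _
  | ih2 a b ha hb => exact hb.mul3 ha (fun v => iota_anti _ _)

theorem OddEl.mul_wordExt {y : Ext T m} (hy : OddEl y) (w : FreeMagma (Letter T m)) :
    y * wordExt w = - (wordExt w * y) := by
  induction w using FreeMagma.recOnMul with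
  | ih1 x => exact hy _
  | ih2 a b ha hb =>
    change y * (wordExt b * wordExt a * _) = - (wordExt b * wordExt a * _ * y)
    rw [← mul_assoc, ← mul_assoc, hb, neg_mul, mul_assoc (wordExt b), ha, mul_neg, neg_neg,
      ← mul_assoc (wordExt b), mul_assoc _ y, hy]
    noncomm_ring

/-- Exterior algebra elements, graded by content. -/
abbrev WordSpace (T m : ℕ) : Type := Multiset (Letter T m) →₀ Ext T m

/-- The bilinear operation corresponding to the commutator. -/
def wordBracket : WordSpace T m →ₗ[ℂ] WordSpace T m →ₗ[ℂ] WordSpace T m :=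
  Finsupp.lsum ℂ fun c => LinearMap.flip (Finsupp.lsum ℂ fun d =>
    (LinearMap.compr₂ (LinearMap.mul ℂ (Ext T m))
      (Finsupp.lsingle (c + d) ∘ₗ
        LinearMap.mulRight ℂ (ExteriorAlgebra.ι ℂ (eVec (linkSum c d))))))

theorem wordBracket_single (c d : Multiset (Letter T m)) (φ χ : Ext T m) :
    wordBracket (Finsupp.single c φ) (Finsupp.single d χ) =
      Finsupp.single (c + d) (χ * φ * ExteriorAlgebra.ι ℂ (eVec (linkSum c d))) := by
  simp [wordBracket]

theorem exists_wordExt_lift : ∃ L : FreeLieAlgebra ℂ (Letter T m) →ₗ[ℂ] WordSpace T m,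
    ∀ w, L (commutatorOf w) = Finsupp.single (content w) (wordExt w) := by
  refine exists_linear_of_words _ wordBracket ?_ ?_ ?_
  · intro a b
    rw [wordBracket_single]; rfl
  · intro a b
    rw [wordBracket_single, wordBracket_single, (oddEl_wordExt b).mul_wordExt a,
      linkSum_comm, add_comm, neg_mul, Finsupp.single_neg]
  · intro a b c
    have hab := (oddEl_wordExt a).mul_wordExt b
    simp only [wordBracket_single]
    rw [← add_assoc, ← add_assoc, add_comm (content b) (content a), ← Finsupp.single_add]
    congr 1
    simp only [linkSum_add_left, linkSum_add_right, eVec_add, map_add]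
    rw [linkSum_comm (content b) (content a)]
    set p := eVec (linkSum (content a) (content b))
    set q := eVec (linkSum (content b) (content c))
    set r := eVec (linkSum (content a) (content c))
    set A := wordExt a with hA
    set B := wordExt b with hB
    set C := wordExt c
    have hq : ExteriorAlgebra.ι ℂ q * A = - (A * ExteriorAlgebra.ι ℂ q) := by
      rw [oddEl_wordExt a q, neg_neg]
    have hr : ExteriorAlgebra.ι ℂ r * B = - (B * ExteriorAlgebra.ι ℂ r) := by
      rw [oddEl_wordExt b r, neg_neg]
    have e1 : C * B * ExteriorAlgebra.ι ℂ q * A = - (C * B * A * ExteriorAlgebra.ι ℂ q) := by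
      rw [mul_assoc, hq]; noncomm_ring
    have e2 : C * A * ExteriorAlgebra.ι ℂ r * B = C * B * A * ExteriorAlgebra.ι ℂ r := by
      rw [mul_assoc, hr, mul_neg, ← mul_assoc, mul_assoc C A B, hab]; noncomm_ring
    have e3 : C * (B * A * ExteriorAlgebra.ι ℂ p) = C * B * A * ExteriorAlgebra.ι ℂ p := by
      noncomm_ring
    rw [e1, e2, e3]
    have a1 := iota_anti q p
    have a2 := iota_anti r p
    have a3 := iota_anti q r
    simp only [mul_add, neg_mul, mul_assoc] at *
    rw [a1, a2, a3]
    noncomm_ring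

end ExistsPsi

section Coefficient

variable {T m : ℕ}

/-- The coordinates picking out the letters and the hyperplanes `H`. -/
def coordMap (H : Fin m → Diag T m) :
    ((Fin m → ℂ) × (Diag T m → ℂ)) →ₗ[ℂ] (Fin m ⊕ Fin m → ℂ) :=
  LinearMap.pi fun i => Sum.elim
    (fun i => (LinearMap.proj i) ∘ₗ (LinearMap.fst ℂ _ _))
    (fun b => (LinearMap.proj (H b)) ∘ₗ (LinearMap.snd ℂ _ _)) i

/-- The alternating form given by the determinant of the coordinates. -/
def coefAlt (H : Fin m → Diag T m) :
    ((Fin m → ℂ) × (Diag T m → ℂ)) [⋀^Fin (m + m)]→ₗ[ℂ] ℂ :=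
  ((Matrix.detRowAlternating (n := Fin m ⊕ Fin m) (R := ℂ)).compLinearMap
    (coordMap H)).domDomCongr finSumFinEquiv

/-- The coefficient functional on the exterior algebra. -/
def coefExt (H : Fin m → Diag T m) : Ext T m →ₗ[ℂ] ℂ :=
  ExteriorAlgebra.liftAlternating (Pi.single (m + m) (coefAlt H))

theorem coefExt_prod (H : Fin m → Diag T m) (l : List ((Fin m → ℂ) × (Diag T m → ℂ)))
    (hl : l.length = m + m) :
    coefExt H (l.map (ExteriorAlgebra.ι ℂ)).prod =
      Matrix.det (Matrix.of fun i j : Fin m ⊕ Fin m =>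
        coordMap H (l.get (Fin.cast hl.symm (finSumFinEquiv i))) j) := by
  obtain ⟨v, rfl⟩ : ∃ v : Fin (m + m) → _, l = List.ofFn v :=
    ⟨fun i => l.get (Fin.cast hl.symm i), by
      apply List.ext_get
      · simp [hl]
      · intro n h1 h2; simp⟩
  have : (List.map (ExteriorAlgebra.ι ℂ) (List.ofFn v)).prod = ExteriorAlgebra.ιMulti ℂ (m + m) v := by
    rw [ExteriorAlgebra.ιMulti_apply, List.map_ofFn]; rfl
  rw [this, coefExt, ExteriorAlgebra.liftAlternating_apply_ιMulti, Pi.single_eq_same]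
  simp [coefAlt, Matrix.detRowAlternating]
  rfl

theorem coefExt_prod_of_ne (H : Fin m → Diag T m) (l : List ((Fin m → ℂ) × (Diag T m → ℂ)))
    (hl : l.length ≠ m + m) :
    coefExt H (l.map (ExteriorAlgebra.ι ℂ)).prod = 0 := by
  have : (List.map (ExteriorAlgebra.ι ℂ) l).prod = ExteriorAlgebra.ιMulti ℂ l.length l.get := by
    rw [ExteriorAlgebra.ιMulti_apply]
    congr 1
    apply List.ext_get
    · simp
    · intro n h1 h2; simp
  rw [this, coefExt, ExteriorAlgebra.liftAlternating_apply_ιMulti, Pi.single_eq_of_ne hl]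
  simp

theorem coefExt_append (H : Fin m → Diag T m) (c : List (Letter T m)) (ts : List (Diag T m → ℂ))
    (hc : c.length = m) (ht : ts.length = m) :
    coefExt H ((c.map fun x => ExteriorAlgebra.ι ℂ (xiVec x)).prod *
        (ts.map fun t => ExteriorAlgebra.ι ℂ (eVec t)).prod) =
      wedgeCoeff c * Matrix.det (Matrix.of fun a b : Fin m => ts.get (Fin.cast ht.symm a) (H b)) := by
  have h1 : (c.map fun x => ExteriorAlgebra.ι ℂ (xiVec x)).prod *
        (ts.map fun t => ExteriorAlgebra.ι ℂ (eVec t)).prod =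
      ((c.map xiVec ++ ts.map eVec).map (ExteriorAlgebra.ι ℂ)).prod := by
    rw [List.map_append, List.prod_append, List.map_map, List.map_map]; rfl
  rw [h1, coefExt_prod H _ (by simp [hc, ht]), wedgeCoeff, dif_pos hc]
  rw [← Matrix.det_fromBlocks_zero₂₁ _ 0]
  congr 1
  ext i j
  rcases i with i | i <;> rcases j with j | j <;>
    simp [coordMap, Matrix.fromBlocks, hc, xiVec, eVec, List.getElem_append, Pi.single_apply,
      eq_comm]

/-- The counterparts of `joins`. -/
def linkList : FreeMagma (Letter T m) → List (Diag T m → ℂ)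
  | .of _ => []
  | .mul a b => linkList b ++ linkList a ++ [linkSum (content a) (content b)]

theorem length_wedgeOrder {X : Type*} (w : FreeMagma X) : (wedgeOrder w).length = w.length := by
  induction w using FreeMagma.recOnMul with
  | ih1 x => rfl
  | ih2 a b ha hb =>
    change (wedgeOrder b ++ wedgeOrder a).length = a.length + b.length
    rw [List.length_append, ha, hb, add_comm]

theorem length_linkList (w : FreeMagma (Letter T m)) : (linkList w).length + 1 = w.length := by
  induction w using FreeMagma.recOnMul with
  | ih1 x => rfl
  | ih2 a b ha hb =>
    change (linkList b ++ linkList a ++ [_]).length + 1 = a.length + b.length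
    simp only [List.length_append, List.length_singleton]; omega

theorem length_joins (ω : ℂ) (w : FreeMagma (Letter T m)) :
    (joins ω w).length + 1 = w.length := by
  induction w using FreeMagma.recOnMul with
  | ih1 x => rfl
  | ih2 a b ha hb =>
    change (joins ω b ++ joins ω a ++ [_]).length + 1 = a.length + b.length
    simp only [List.length_append, List.length_singleton]; omega

theorem prod_swap (u v : List ((Fin m → ℂ) × (Diag T m → ℂ))) :
    (u.map (ExteriorAlgebra.ι ℂ)).prod * (v.map (ExteriorAlgebra.ι ℂ)).prod =
      (-1 : ℂ) ^ (u.length * v.length) •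
        ((v.map (ExteriorAlgebra.ι ℂ)).prod * (u.map (ExteriorAlgebra.ι ℂ)).prod) := by
  induction u with
  | nil => simp
  | cons a u ih =>
    have h1 : ∀ v : List ((Fin m → ℂ) × (Diag T m → ℂ)),
        ExteriorAlgebra.ι ℂ a * (v.map (ExteriorAlgebra.ι ℂ)).prod = (-1 : ℂ) ^ v.length •
          ((v.map (ExteriorAlgebra.ι ℂ)).prod * ExteriorAlgebra.ι ℂ a) := by
      intro v
      induction v with
      | nil => simp
      | cons b v ih2 =>
        simp only [List.map_cons, List.prod_cons, List.length_cons]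
        rw [← mul_assoc, iota_anti, neg_mul, mul_assoc, ih2, pow_succ]
        simp [mul_assoc]
    simp only [List.map_cons, List.prod_cons, List.length_cons]
    rw [mul_assoc, ih, mul_smul_comm, ← mul_assoc, h1, smul_mul_assoc, smul_smul, mul_assoc,
      ← pow_add]
    congr 2; ring

theorem wordExt_eq (w : FreeMagma (Letter T m)) :
    wordExt w = psiSign w • (((wedgeOrder w).map fun x => ExteriorAlgebra.ι ℂ (xiVec x)).prod *
        ((linkList w).map fun t => ExteriorAlgebra.ι ℂ (eVec t)).prod) := by
  induction w using FreeMagma.recOnMul with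
  | ih1 x => simp [wordExt, psiSign, wedgeOrder, linkList]
  | ih2 a b ha hb =>
    change wordExt b * wordExt a * _ = (psiSign a * psiSign b * _) •
      (((wedgeOrder b ++ wedgeOrder a).map _).prod * ((linkList b ++ linkList a ++ [_]).map _).prod)
    rw [ha, hb]
    have hs := prod_swap ((linkList b).map eVec) ((wedgeOrder a).map xiVec)
    simp only [List.map_map, List.length_map, length_wedgeOrder] at hs
    have hl : (linkList b).length = b.length - 1 := by have := length_linkList b; omega
    rw [hl] at hs
    simp only [Function.comp_def] at hs
    simp only [List.map_append, List.prod_append, List.map_singleton, List.prod_singleton]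
    generalize (List.map (fun x => ExteriorAlgebra.ι ℂ (xiVec x)) (wedgeOrder a)).prod = A at *
    generalize (List.map (fun x => ExteriorAlgebra.ι ℂ (xiVec x)) (wedgeOrder b)).prod = B at *
    generalize (List.map (fun x => ExteriorAlgebra.ι ℂ (eVec x)) (linkList a)).prod = A' at *
    generalize (List.map (fun x => ExteriorAlgebra.ι ℂ (eVec x)) (linkList b)).prod = B' at *
    simp only [smul_mul_assoc, mul_smul_comm, smul_smul]
    rw [mul_assoc B B', ← mul_assoc B' A, hs]
    simp only [smul_mul_assoc, mul_smul_comm, smul_smul, mul_assoc]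
    congr 1
    ring

end Coefficient

section Flags

variable {T m : ℕ}

theorem cumInf_succ (Ls : List (Submodule ℂ (Fin m → ℂ))) (n : ℕ) (hn : n < Ls.length) :
    cumInf Ls (n + 1) = cumInf Ls n ⊓ Ls.get ⟨n, hn⟩ := by
  unfold cumInf
  induction Ls generalizing n with
  | nil => simp at hn
  | cons L Ls ih =>
    cases n with
    | zero => simp
    | succ n =>
      have := ih n (by simpa using hn)
      simp only [List.take_succ_cons, List.foldr_cons, List.get_cons_succ]
      rw [this, inf_assoc]

theorem step_aux (K : Fin m → Submodule ℂ (Fin m → ℂ)) (n : ℕ) (hn : n < m) :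
    (⨅ (j : Fin m) (_ : j ≤ ⟨n, hn⟩), K j) =
        (⨅ (j : Fin m) (_ : (j : ℕ) < n), K j) ⊓ K ⟨n, hn⟩ := by
  ext t
  simp only [Submodule.mem_inf, Submodule.mem_iInf]
  constructor
  · intro h
    exact ⟨fun j hj => h j (Fin.le_def.mpr hj.le), h _ le_rfl⟩
  · rintro ⟨h1, h2⟩ j hj
    rcases (Fin.le_def.mp hj).lt_or_eq with h | h
    · exact h1 j h
    · have : j = ⟨n, hn⟩ := Fin.ext h
      rw [this]; exact h2

theorem step_aux' (K : Fin m → Submodule ℂ (Fin m → ℂ)) (n : ℕ) (hn : n < m) :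
    (⨅ (j : Fin m) (_ : j ≤ ⟨n, hn⟩), K j) =
        ⨅ (j : Fin m) (_ : (j : ℕ) < n + 1), K j := by
  ext t
  simp only [Submodule.mem_iInf]
  exact ⟨fun h j hj => h j (Fin.le_def.mpr (Nat.lt_succ_iff.mp hj)),
    fun h j hj => h j (Nat.lt_succ_iff.mpr (Fin.le_def.mp hj))⟩

theorem flagPairing_eq_det (ω : ℂ) (Ls : List (Submodule ℂ (Fin m → ℂ))) (H : Fin m → Diag T m)
    (e : Matrix (Fin m) (Fin m) ℂ)
    (he1 : ∀ a b : Fin m, cumInf Ls a ⊓ diagHyperplane ω (H b) = cumInf Ls (a + 1) → e a b = 1)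
    (he0 : ∀ a b : Fin m, cumInf Ls a ⊓ diagHyperplane ω (H b) ≠ cumInf Ls (a + 1) → e a b = 0) :
    flagPairing ω (fun i : Fin m => cumInf Ls (i + 1)) H = e.det := by
  classical
  rw [← Matrix.det_transpose, Matrix.det_apply', flagPairing]
  refine Finset.sum_congr rfl fun s _ => ?_
  have key : (∀ i : Fin m, cumInf Ls (i + 1) = ⨅ (j : Fin m) (_ : j ≤ i), diagHyperplane ω (H (s j)))
      ↔ ∀ i : Fin m, cumInf Ls i ⊓ diagHyperplane ω (H (s i)) = cumInf Ls (i + 1) := by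
    have step := step_aux (fun j => diagHyperplane ω (H (s j)))
    have step' := step_aux' (fun j => diagHyperplane ω (H (s j)))
    constructor
    · intro h i
      obtain ⟨n, hn⟩ := i
      rw [h ⟨n, hn⟩, step n hn]
      congr 1
      cases n with
      | zero => simp [cumInf]
      | succ n =>
        have := h ⟨n, by omega⟩
        rw [step'] at this
        exact this
    · intro h i
      obtain ⟨n, hn⟩ := i
      induction n with
      | zero =>
        rw [step 0 hn, ← h]
        simp [cumInf]
      | succ n ih =>
        rw [step (n + 1) hn, ← h]
        have := ih (by omega)
        rw [step'] at this
        rw [← this]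
  rw [if_congr key rfl rfl]
  split_ifs with h
  · have : ∏ i, e.transpose (s i) i = 1 :=
      Finset.prod_eq_one fun i _ => he1 _ _ (h i)
    rw [this, mul_one]
  · push Not at h
    obtain ⟨i, hi⟩ := h
    have : ∏ i, e.transpose (s i) i = 0 :=
      Finset.prod_eq_zero (Finset.mem_univ i) (he0 _ _ hi)
    rw [this, mul_zero]

/-- Distinct letters of `c` have distinct indices. -/
def Multilinear (c : Multiset (Letter T m)) : Prop := (c.map Prod.snd).Nodup

theorem Multilinear.left {c d : Multiset (Letter T m)} (h : Multilinear (c + d)) :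
    Multilinear c := by
  unfold Multilinear at *
  rw [Multiset.map_add] at h
  exact (Multiset.nodup_add.mp h).1

theorem Multilinear.right {c d : Multiset (Letter T m)} (h : Multilinear (c + d)) :
    Multilinear d := by
  rw [add_comm] at h; exact h.left

theorem Multilinear.disj {c d : Multiset (Letter T m)} (h : Multilinear (c + d))
    {x y : Letter T m} (hx : x ∈ c) (hy : y ∈ d) : x.2 ≠ y.2 := by
  unfold Multilinear at h
  rw [Multiset.map_add] at h
  have := (Multiset.nodup_add.mp h).2.2
  intro he
  exact Multiset.disjoint_left.mp this (Multiset.mem_map_of_mem _ hx)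
    (he ▸ Multiset.mem_map_of_mem _ hy)

theorem Multilinear.inj {c : Multiset (Letter T m)} (h : Multilinear c)
    {x y : Letter T m} (hx : x ∈ c) (hy : y ∈ c) (he : x.2 = y.2) : x = y :=
  Multiset.inj_on_of_nodup_map h x hx y hy he

theorem linkVec_ne_zero {x y : Letter T m} {h : Diag T m} (hv : linkVec x y h ≠ 0) :
    (h.1.1 = x.2 ∧ h.1.2.1 = y.2 ∧ h.1.2.2 = y.1 - x.1) ∨
     (h.1.1 = y.2 ∧ h.1.2.1 = x.2 ∧ h.1.2.2 = x.1 - y.1) := by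
  by_contra hc
  exact hv (if_neg hc)

theorem sum_map_eq_zero' {α : Type*} (c : Multiset α) (f : α → ℂ) (h : ∀ x ∈ c, f x = 0) :
    (c.map f).sum = 0 :=
  Multiset.sum_eq_zero fun y hy => by
    obtain ⟨x, hx, rfl⟩ := Multiset.mem_map.mp hy
    exact h x hx

theorem linkSum_apply (c d : Multiset (Letter T m)) (h : Diag T m) :
    linkSum c d h = (c.map fun x => (d.map fun y => linkVec x y h).sum).sum := by
  have hh : ∀ s : Multiset (Diag T m → ℂ), s.sum h = (s.map fun v => v h).sum := by
    intro s
    exact map_multiset_sum (Pi.evalAddMonoidHom (fun _ : Diag T m => ℂ) h) s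
  simp [linkSum, hh, Multiset.map_map]

theorem linkSum_eq_one {c d : Multiset (Letter T m)} (hcd : Multilinear (c + d)) {h : Diag T m}
    {x y : Letter T m} (hx : x ∈ c) (hy : y ∈ d) (hxy : linkVec x y h ≠ 0) :
    linkSum c d h = 1 := by
  obtain ⟨c', rfl⟩ := Multiset.exists_cons_of_mem hx
  obtain ⟨d', rfl⟩ := Multiset.exists_cons_of_mem hy
  have hc := hcd.left
  have hd := hcd.right
  have hxne : ∀ z ∈ c', z.2 ≠ x.2 := by
    intro z hz he
    unfold Multilinear at hc
    rw [Multiset.map_cons, Multiset.nodup_cons] at hc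
    exact hc.1 (he ▸ Multiset.mem_map_of_mem _ hz)
  have hyne : ∀ z ∈ d', z.2 ≠ y.2 := by
    intro z hz he
    unfold Multilinear at hd
    rw [Multiset.map_cons, Multiset.nodup_cons] at hd
    exact hd.1 (he ▸ Multiset.mem_map_of_mem _ hz)
  have h1 : linkVec x y h = 1 := by
    unfold linkVec; rw [if_pos (linkVec_ne_zero hxy)]
  have hxd : ∀ z ∈ y ::ₘ d', x.2 ≠ z.2 := fun z hz => hcd.disj hx hz
  have hyc : ∀ z ∈ x ::ₘ c', z.2 ≠ y.2 := fun z hz => hcd.disj hz hy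
  have hl := linkVec_ne_zero hxy
  have z1 : ∀ z ∈ d', linkVec x z h = 0 := by
    intro z hz
    by_contra hne
    have a1 := hyne z hz
    have a2 := hxd z (Multiset.mem_cons_of_mem hz)
    have a3 := hxd y (Multiset.mem_cons_self _ _)
    rcases linkVec_ne_zero hne with ⟨b1, b2, -⟩ | ⟨b1, b2, -⟩ <;>
    rcases hl with ⟨c1, c2, -⟩ | ⟨c1, c2, -⟩ <;> grind
  have z2 : ∀ u ∈ c', ∀ z ∈ y ::ₘ d', linkVec u z h = 0 := by
    intro u hu z hz
    by_contra hne
    have a1 := hxne u hu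
    have a2 := hxd z hz
    have a3 := hyc u (Multiset.mem_cons_of_mem hu)
    have a4 := hxd y (Multiset.mem_cons_self _ _)
    rcases linkVec_ne_zero hne with ⟨b1, b2, -⟩ | ⟨b1, b2, -⟩ <;>
    rcases hl with ⟨c1, c2, -⟩ | ⟨c1, c2, -⟩ <;> grind
  rw [linkSum_apply, Multiset.map_cons, Multiset.sum_cons, Multiset.map_cons, Multiset.sum_cons, h1,
    sum_map_eq_zero' d' _ z1, sum_map_eq_zero' c' _ (fun u hu => sum_map_eq_zero' _ _ (z2 u hu))]
  ring

theorem linkSum_eq_zero {c d : Multiset (Letter T m)} {h : Diag T m}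
    (hxy : ∀ x ∈ c, ∀ y ∈ d, linkVec x y h = 0) : linkSum c d h = 0 := by
  rw [linkSum_apply]
  exact sum_map_eq_zero' _ _ fun x hx => sum_map_eq_zero' _ _ fun y hy => hxy x hx y hy

/-- `V` contains all vectors supported on the indices of `c`. -/
def FreeOn (V : Submodule ℂ (Fin m → ℂ)) (c : Multiset (Letter T m)) : Prop :=
  ∀ t : Fin m → ℂ, (∀ i, t i ≠ 0 → ∃ x ∈ c, x.2 = i) → t ∈ V

open Classical in
/-- The vector on the line of the island `c`, zero elsewhere. -/
def islandVec (ω : ℂ) (c : Multiset (Letter T m)) : Fin m → ℂ := fun i =>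
  if h : ∃ x ∈ c, x.2 = i then (ω ^ (h.choose).1.val)⁻¹ else 0

theorem islandVec_mem {ω : ℂ} {c : Multiset (Letter T m)} (hc : Multilinear c)
    {x : Letter T m} (hx : x ∈ c) : islandVec ω c x.2 = (ω ^ x.1.val)⁻¹ := by
  have h : ∃ z ∈ c, z.2 = x.2 := ⟨x, hx, rfl⟩
  unfold islandVec
  rw [dif_pos h, hc.inj h.choose_spec.1 hx h.choose_spec.2]

theorem islandVec_not_mem {ω : ℂ} {c : Multiset (Letter T m)} {i : Fin m}
    (hi : ∀ x ∈ c, x.2 ≠ i) : islandVec ω c i = 0 := by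
  unfold islandVec
  rw [dif_neg]
  rintro ⟨x, hx, rfl⟩
  exact hi x hx rfl

theorem islandVec_supp {ω : ℂ} {c : Multiset (Letter T m)} {i : Fin m}
    (hi : islandVec ω c i ≠ 0) : ∃ x ∈ c, x.2 = i := by
  by_contra h
  push Not at h
  exact hi (islandVec_not_mem h)

theorem edge_of_eq {ω : ℂ} {c : Multiset (Letter T m)} {t : Fin m → ℂ} (r : ℂ)
    (h : ∀ x ∈ c, ω ^ x.1.val * t x.2 = r) : t ∈ edge ω c :=
  fun x hx y hy => (h x hx).trans (h y hy).symm

theorem edge_mono {ω : ℂ} {c d : Multiset (Letter T m)} (h : c ⊆ d) : edge ω d ≤ edge ω c :=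
  fun _ ht x hx y hy => ht x (h hx) y (h hy)

theorem join_iff {ω : ℂ} [NeZero T] (hω : IsPrimitiveRoot ω T) {V : Submodule ℂ (Fin m → ℂ)}
    {c d : Multiset (Letter T m)} (hcd : Multilinear (c + d)) (hc0 : c ≠ 0) (hd0 : d ≠ 0)
    (hV : FreeOn V (c + d)) (h : Diag T m) :
    V ⊓ edge ω c ⊓ edge ω d ⊓ diagHyperplane ω h = V ⊓ edge ω c ⊓ edge ω d ⊓ edge ω (c + d) ↔
      ∃ x ∈ c, ∃ y ∈ d, linkVec x y h ≠ 0 := by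
  have hne := root_ne hω
  obtain ⟨x0, hx0⟩ := Multiset.exists_mem_of_ne_zero hc0
  obtain ⟨y0, hy0⟩ := Multiset.exists_mem_of_ne_zero hd0
  constructor
  · intro heq
    -- test vectors
    have test1 : islandVec ω (c + d) ∈ diagHyperplane ω h := by
      have : islandVec ω (c + d) ∈ V ⊓ edge ω c ⊓ edge ω d ⊓ edge ω (c + d) := by
        have he : ∀ x ∈ c + d, ω ^ x.1.val * islandVec ω (c + d) x.2 = 1 := fun x hx => by
          rw [islandVec_mem hcd hx, mul_inv_cancel₀ (hne _)]
        refine ⟨⟨⟨hV _ fun i hi => islandVec_supp hi, ?_⟩, ?_⟩, ?_⟩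
        · exact edge_of_eq 1 fun x hx => he x (Multiset.mem_add.mpr (Or.inl hx))
        · exact edge_of_eq 1 fun x hx => he x (Multiset.mem_add.mpr (Or.inr hx))
        · exact edge_of_eq 1 he
      rw [← heq] at this
      exact this.2
    have test2 : islandVec ω c ∉ diagHyperplane ω h := by
      intro hmem
      have : islandVec ω c ∈ V ⊓ edge ω c ⊓ edge ω d ⊓ diagHyperplane ω h := by
        refine ⟨⟨⟨hV _ fun i hi => ?_, ?_⟩, ?_⟩, hmem⟩
        · obtain ⟨x, hx, hxi⟩ := islandVec_supp hi
          exact ⟨x, Multiset.mem_add.mpr (Or.inl hx), hxi⟩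
        · exact edge_of_eq 1 fun x hx => by
            rw [islandVec_mem hcd.left hx, mul_inv_cancel₀ (hne _)]
        · exact edge_of_eq 0 fun x hx => by
            rw [islandVec_not_mem fun z hz => hcd.disj hz hx, mul_zero]
      rw [heq] at this
      have h2 := this.2 x0 (Multiset.mem_add.mpr (Or.inl hx0)) y0
        (Multiset.mem_add.mpr (Or.inr hy0))
      rw [islandVec_mem hcd.left hx0, mul_inv_cancel₀ (hne _),
        islandVec_not_mem fun z hz => hcd.disj hz hy0, mul_zero] at h2
      exact one_ne_zero h2
    have test3 : islandVec ω d ∉ diagHyperplane ω h := by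
      intro hmem
      have : islandVec ω d ∈ V ⊓ edge ω c ⊓ edge ω d ⊓ diagHyperplane ω h := by
        refine ⟨⟨⟨hV _ fun i hi => ?_, ?_⟩, ?_⟩, hmem⟩
        · obtain ⟨x, hx, hxi⟩ := islandVec_supp hi
          exact ⟨x, Multiset.mem_add.mpr (Or.inr hx), hxi⟩
        · exact edge_of_eq 0 fun x hx => by
            rw [islandVec_not_mem fun z hz => (hcd.disj hx hz).symm, mul_zero]
        · exact edge_of_eq 1 fun x hx => by
            rw [islandVec_mem hcd.right hx, mul_inv_cancel₀ (hne _)]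
      rw [heq] at this
      have h2 := this.2 x0 (Multiset.mem_add.mpr (Or.inl hx0)) y0
        (Multiset.mem_add.mpr (Or.inr hy0))
      rw [islandVec_mem hcd.right hy0, mul_inv_cancel₀ (hne _),
        islandVec_not_mem fun z hz => (hcd.disj hx0 hz).symm, mul_zero] at h2
      exact zero_ne_one h2
    obtain ⟨⟨i, j, k⟩, hij⟩ := h
    change islandVec ω (c + d) i = ω ^ k.val * islandVec ω (c + d) j at test1
    change ¬ (islandVec ω c i = ω ^ k.val * islandVec ω c j) at test2
    change ¬ (islandVec ω d i = ω ^ k.val * islandVec ω d j) at test3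
    have hk : ∀ x ∈ c + d, ∀ y ∈ c + d, x.2 = i → y.2 = j → k = y.1 - x.1 := by
      rintro x hx y hy rfl rfl
      rw [islandVec_mem hcd hx, islandVec_mem hcd hy] at test1
      have : ω ^ y.1.val = ω ^ (k + x.1).val := by
        rw [root_add hω]
        have h1 := hne y.1
        have h2 := hne x.1
        field_simp at test1
        linear_combination test1
      rw [root_inj hω this]; ring
    by_cases hic : ∃ x ∈ c, x.2 = i
    · obtain ⟨x, hx, hxi⟩ := hic
      by_cases hjc : ∃ y ∈ c, y.2 = j
      · obtain ⟨y, hy, hyj⟩ := hjc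
        exfalso
        apply test3
        rw [islandVec_not_mem fun z hz he => hcd.disj hx hz (hxi.trans he.symm),
          islandVec_not_mem fun z hz he => hcd.disj hy hz (hyj.trans he.symm), mul_zero]
      · by_cases hjd : ∃ y ∈ d, y.2 = j
        · obtain ⟨y, hy, hyj⟩ := hjd
          refine ⟨x, hx, y, hy, ?_⟩
          have := hk x (Multiset.mem_add.mpr (Or.inl hx)) y (Multiset.mem_add.mpr (Or.inr hy))
            hxi hyj
          unfold linkVec
          rw [if_pos (Or.inl ⟨hxi.symm, hyj.symm, this⟩)]
          exact one_ne_zero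
        · exfalso
          push Not at hjc hjd
          rw [← hxi, islandVec_mem hcd (Multiset.mem_add.mpr (Or.inl hx)),
            islandVec_not_mem (i := j) (fun z hz => ?_), mul_zero] at test1
          · exact inv_ne_zero (hne _) test1
          · rcases Multiset.mem_add.mp hz with hz | hz
            · exact hjc z hz
            · exact hjd z hz
    · by_cases hid : ∃ x ∈ d, x.2 = i
      · obtain ⟨x, hx, hxi⟩ := hid
        by_cases hjc : ∃ y ∈ c, y.2 = j
        · obtain ⟨y, hy, hyj⟩ := hjc
          refine ⟨y, hy, x, hx, ?_⟩
          have := hk x (Multiset.mem_add.mpr (Or.inr hx)) y (Multiset.mem_add.mpr (Or.inl hy))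
            hxi hyj
          unfold linkVec
          rw [if_pos (Or.inr ⟨hxi.symm, hyj.symm, this⟩)]
          exact one_ne_zero
        · by_cases hjd : ∃ y ∈ d, y.2 = j
          · obtain ⟨y, hy, hyj⟩ := hjd
            exfalso
            apply test2
            rw [islandVec_not_mem fun z hz he => hcd.disj hz hx (he.trans hxi.symm),
              islandVec_not_mem fun z hz he => hcd.disj hz hy (he.trans hyj.symm), mul_zero]
          · exfalso
            push Not at hjc hjd
            rw [← hxi, islandVec_mem hcd (Multiset.mem_add.mpr (Or.inr hx)),
              islandVec_not_mem (i := j) (fun z hz => ?_), mul_zero] at test1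
            · exact inv_ne_zero (hne _) test1
            · rcases Multiset.mem_add.mp hz with hz | hz
              · exact hjc z hz
              · exact hjd z hz
      · exfalso
        push Not at hic hid
        apply test2
        rw [islandVec_not_mem hic]
        by_cases hjc : ∃ y ∈ c, y.2 = j
        · obtain ⟨y, hy, hyj⟩ := hjc
          exfalso
          rw [← hyj, islandVec_mem hcd (Multiset.mem_add.mpr (Or.inl hy)),
            islandVec_not_mem (i := i) (fun z hz => ?_)] at test1
          · exact mul_ne_zero (hne _) (inv_ne_zero (hne _)) test1.symm
          · rcases Multiset.mem_add.mp hz with hz | hz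
            · exact hic z hz
            · exact hid z hz
        · push Not at hjc
          rw [islandVec_not_mem hjc, mul_zero]
  · rintro ⟨x, hx, y, hy, hxy⟩
    have hiff : ∀ t, t ∈ edge ω c → t ∈ edge ω d →
        (t ∈ diagHyperplane ω h ↔ ω ^ x.1.val * t x.2 = ω ^ y.1.val * t y.2) := by
      intro t _ _
      change (t h.1.1 = ω ^ h.1.2.2.val * t h.1.2.1) ↔ _
      have hx' := hne x.1
      have hy' := hne y.1
      rcases linkVec_ne_zero hxy with ⟨h1, h2, h3⟩ | ⟨h1, h2, h3⟩
      · have e : ω ^ y.1.val = ω ^ h.1.2.2.val * ω ^ x.1.val := by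
          rw [← root_add hω, h3]; congr 2; ring
        rw [h1, h2, e]
        constructor
        · intro hh; rw [hh]; ring
        · intro hh
          apply mul_left_cancel₀ hx'
          rw [hh]; ring
      · have e : ω ^ x.1.val = ω ^ h.1.2.2.val * ω ^ y.1.val := by
          rw [← root_add hω, h3]; congr 2; ring
        rw [h1, h2, e]
        constructor
        · intro hh; rw [hh]; ring
        · intro hh
          apply mul_left_cancel₀ hy'
          rw [← hh]; ring
    ext t
    constructor
    · rintro ⟨⟨⟨hv, hc⟩, hd⟩, hh⟩
      refine ⟨⟨⟨hv, hc⟩, hd⟩, ?_⟩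
      refine edge_of_eq (ω ^ x.1.val * t x.2) fun z hz => ?_
      rcases Multiset.mem_add.mp hz with hz | hz
      · exact hc z hz x hx
      · exact (hd z hz y hy).trans ((hiff t hc hd).mp hh).symm
    · rintro ⟨⟨⟨hv, hc⟩, hd⟩, hh⟩
      refine ⟨⟨⟨hv, hc⟩, hd⟩, (hiff t hc hd).mpr ?_⟩
      exact hh x (Multiset.mem_add.mpr (Or.inl hx)) y (Multiset.mem_add.mpr (Or.inr hy))

/-- The vectors `ts` record which hyperplanes cut out the successive members of the flag. -/
def IsChain (ω : ℂ) : Submodule ℂ (Fin m → ℂ) → List (Submodule ℂ (Fin m → ℂ)) →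
    List (Diag T m → ℂ) → Prop
  | _, [], [] => True
  | V, L :: Ls, t :: ts =>
    (∀ h, (V ⊓ diagHyperplane ω h = V ⊓ L → t h = 1) ∧
      (V ⊓ diagHyperplane ω h ≠ V ⊓ L → t h = 0)) ∧ IsChain ω (V ⊓ L) Ls ts
  | _, _, _ => False

theorem IsChain.append {ω : ℂ} : ∀ {V : Submodule ℂ (Fin m → ℂ)}
    {Ls Ls' : List (Submodule ℂ (Fin m → ℂ))} {ts ts' : List (Diag T m → ℂ)},
    IsChain ω V Ls ts → IsChain ω (V ⊓ Ls.foldr (· ⊓ ·) ⊤) Ls' ts' →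
    IsChain ω V (Ls ++ Ls') (ts ++ ts')
  | V, [], Ls', [], ts', _, h' => by simpa using h'
  | V, L :: Ls, Ls', t :: ts, ts', h, h' => by
    refine ⟨h.1, IsChain.append h.2 ?_⟩
    rw [inf_assoc]; exact h'
  | V, [], _, t :: ts, _, h, _ => h.elim
  | V, L :: Ls, _, [], _, h, _ => h.elim

theorem IsChain.get {ω : ℂ} : ∀ {V : Submodule ℂ (Fin m → ℂ)}
    {Ls : List (Submodule ℂ (Fin m → ℂ))} {ts : List (Diag T m → ℂ)},
    IsChain ω V Ls ts → ∀ (n : ℕ) (hn : n < ts.length) (h : Diag T m),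
    (V ⊓ cumInf Ls n ⊓ diagHyperplane ω h = V ⊓ cumInf Ls (n + 1) → ts.get ⟨n, hn⟩ h = 1) ∧
    (V ⊓ cumInf Ls n ⊓ diagHyperplane ω h ≠ V ⊓ cumInf Ls (n + 1) → ts.get ⟨n, hn⟩ h = 0)
  | V, [], [], _, n, hn, h => by simp at hn
  | V, L :: Ls, t :: ts, hc, 0, hn, h => by
    have := hc.1 h
    simp only [cumInf, List.take_zero, List.foldr_nil, inf_top_eq, List.take_succ_cons,
      List.foldr_cons]
    exact this
  | V, L :: Ls, t :: ts, hc, n + 1, hn, h => by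
    have := IsChain.get hc.2 n (by simpa using hn) h
    simpa [cumInf, ← inf_assoc] using this
  | V, [], t :: ts, hc, n, hn, h => hc.elim
  | V, L :: Ls, [], hc, n, hn, h => hc.elim

theorem content_ne_zero {X : Type*} (w : FreeMagma X) : content w ≠ 0 := by
  induction w using FreeMagma.recOnMul with
  | ih1 x => exact Multiset.singleton_ne_zero x
  | ih2 a b ha hb =>
    intro h
    exact ha (add_eq_zero.mp (show content a + content b = 0 from h)).1

theorem foldr_joins (ω : ℂ) (w : FreeMagma (Letter T m)) :
    (joins ω w).foldr (· ⊓ ·) ⊤ = edge ω (content w) := by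
  induction w using FreeMagma.recOnMul with
  | ih1 x =>
    refine (eq_top_iff.mpr fun t _ => ?_).symm
    intro y hy z hz
    rw [Multiset.mem_singleton.mp hy, Multiset.mem_singleton.mp hz]
  | ih2 a b ha hb =>
    change (joins ω b ++ joins ω a ++ [edge ω (content a + content b)]).foldr _ _ =
      edge ω (content a + content b)
    have happ : ∀ (l l' : List (Submodule ℂ (Fin m → ℂ))), (l ++ l').foldr (· ⊓ ·) ⊤ =
        l.foldr (· ⊓ ·) ⊤ ⊓ l'.foldr (· ⊓ ·) ⊤ := by
      intro l l'
      induction l with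
      | nil => simp
      | cons x l ih => simp [ih, inf_assoc]
    rw [happ, happ, ha, hb]
    simp only [List.foldr_cons, List.foldr_nil, inf_top_eq]
    rw [inf_eq_right]
    exact le_inf (edge_mono (Multiset.subset_of_le (Multiset.le_add_left _ _)))
      (edge_mono (Multiset.subset_of_le (Multiset.le_add_right _ _)))

theorem isChain_joins {ω : ℂ} [NeZero T] (hω : IsPrimitiveRoot ω T)
    (w : FreeMagma (Letter T m)) : ∀ (V : Submodule ℂ (Fin m → ℂ)),
    Multilinear (content w) → FreeOn V (content w) → IsChain ω V (joins ω w) (linkList w) := by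
  induction w using FreeMagma.recOnMul with
  | ih1 x => intro V _ _; trivial
  | ih2 a b ha hb =>
    intro V hm hV
    change Multilinear (content a + content b) at hm
    change FreeOn V (content a + content b) at hV
    change IsChain ω V (joins ω b ++ joins ω a ++ [_]) (linkList b ++ linkList a ++ [_])
    rw [List.append_assoc, List.append_assoc]
    refine (hb V hm.right fun t ht => hV t fun i hi => ?_).append ?_
    · obtain ⟨x, hx, hxi⟩ := ht i hi
      exact ⟨x, Multiset.mem_add.mpr (Or.inr hx), hxi⟩
    rw [foldr_joins]
    refine (ha _ hm.left fun t ht => Submodule.mem_inf.mpr ⟨hV t fun i hi => ?_, ?_⟩).append ?_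
    · obtain ⟨x, hx, hxi⟩ := ht i hi
      exact ⟨x, Multiset.mem_add.mpr (Or.inl hx), hxi⟩
    · refine edge_of_eq 0 fun y hy => ?_
      by_contra hne
      obtain ⟨x, hx, hxi⟩ := ht y.2 (fun h0 => hne (by rw [h0, mul_zero]))
      exact hm.disj hx hy hxi
    rw [foldr_joins]
    refine ⟨fun h => ?_, trivial⟩
    have key := join_iff hω hm (content_ne_zero a) (content_ne_zero b) hV h
    rw [inf_right_comm V (edge ω (content a))] at key
    constructor
    · intro heq
      obtain ⟨x, hx, y, hy, hxy⟩ := key.mp heq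
      exact linkSum_eq_one hm hx hy hxy
    · intro hne
      refine linkSum_eq_zero fun x hx y hy => ?_
      by_contra hxy
      exact hne (key.mpr ⟨x, hx, y, hy, hxy⟩)

open Classical in
/-- The hyperplanes which cut out `L_g^0` inside `L_g`. -/
def zeroVec (ω : ℂ) (c : Multiset (Letter T m)) : Diag T m → ℂ := fun h =>
  if edge ω c ⊓ diagHyperplane ω h = edge ω c ⊓ zeroEdge c then 1 else 0

theorem coe_wedgeOrder {X : Type*} (w : FreeMagma X) : (wedgeOrder w : Multiset X) = content w := by
  induction w using FreeMagma.recOnMul with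
  | ih1 x => rfl
  | ih2 a b ha hb =>
    change ((wedgeOrder b ++ wedgeOrder a : List X) : Multiset X) = content a + content b
    rw [← Multiset.coe_add, ha, hb, add_comm]

theorem multilinear_of_wedgeCoeff {w : FreeMagma (Letter T m)}
    (h : wedgeCoeff (wedgeOrder w) ≠ 0) : Multilinear (content w) := by
  unfold Multilinear
  rw [← coe_wedgeOrder, Multiset.map_coe, Multiset.coe_nodup]
  by_contra hnd
  apply h
  unfold wedgeCoeff
  split_ifs with hl
  · rw [List.nodup_iff_injective_get] at hnd
    unfold Function.Injective at hnd
    push Not at hnd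
    obtain ⟨i, j, hij, hne⟩ := hnd
    have hl' : ((wedgeOrder w).map Prod.snd).length = m := by simpa using hl
    refine Matrix.det_zero_of_row_eq (i := Fin.cast hl' i) (j := Fin.cast hl' j) ?_ ?_
    · intro he; apply hne; exact Fin.cast_injective hl' he
    · ext b
      simp only [List.get_eq_getElem, List.getElem_map] at hij
      simp [Matrix.of_apply, hij]
  · rfl

/-- The rule `psiWord` extends to a linear map on the free Lie algebra. -/
theorem exists_psi {ω : ℂ} [NeZero T] (hω : IsPrimitiveRoot ω T) :
    ∃ P : FreeLieAlgebra ℂ (Letter T m) →ₗ[ℂ] ((Fin m → Diag T m) → ℂ),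
      ∀ w, P (commutatorOf w) = psiWord ω w := by
  obtain ⟨L, hL⟩ := exists_wordExt_lift (T := T) (m := m)
  let Q : (Fin m → Diag T m) → WordSpace T m →ₗ[ℂ] ℂ := fun H =>
    Finsupp.lsum ℂ fun c => coefExt H ∘ₗ
      LinearMap.mulRight ℂ (ExteriorAlgebra.ι ℂ (eVec (zeroVec ω c)))
  refine ⟨LinearMap.pi fun H => Q H ∘ₗ L, fun w => ?_⟩
  ext H
  have h1 : (LinearMap.pi (fun H => Q H ∘ₗ L)) (commutatorOf w) H =
      coefExt H (wordExt w * ExteriorAlgebra.ι ℂ (eVec (zeroVec ω (content w)))) := by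
    simp [Q, hL]
  rw [h1, wordExt_eq, smul_mul_assoc, map_smul, mul_assoc]
  have h2 : ((linkList w).map fun t => ExteriorAlgebra.ι ℂ (eVec t)).prod *
      ExteriorAlgebra.ι ℂ (eVec (zeroVec ω (content w))) =
      ((linkList w ++ [zeroVec ω (content w)]).map fun t => ExteriorAlgebra.ι ℂ (eVec t)).prod := by
    simp
  rw [h2, psiWord, smul_eq_mul, mul_assoc]
  congr 1
  have hlen := length_linkList w
  have hlen' := length_wedgeOrder w
  by_cases hw : w.length = m
  · have ht : (linkList w ++ [zeroVec ω (content w)]).length = m := by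
      simp only [List.length_append, List.length_singleton]; omega
    rw [coefExt_append H _ _ (hlen'.trans hw) ht]
    by_cases h0 : wedgeCoeff (wedgeOrder w) = 0
    · rw [h0, zero_mul, zero_mul]
    · congr 1
      have hm := multilinear_of_wedgeCoeff h0
      have hch : IsChain ω (⊤ : Submodule ℂ (Fin m → ℂ)) (joins ω w ++ [zeroEdge (content w)])
          (linkList w ++ [zeroVec ω (content w)]) := by
        refine (isChain_joins hω w ⊤ hm fun _ _ => trivial).append ?_
        rw [foldr_joins, top_inf_eq]
        refine ⟨fun h => ⟨fun heq => ?_, fun hne => ?_⟩, trivial⟩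
        · simp [zeroVec, heq]
        · simp [zeroVec, hne]
      symm
      refine flagPairing_eq_det ω _ H _ ?_ ?_
      · intro a b hab
        have := (hch.get a (lt_of_lt_of_eq a.2 ht.symm) (H b)).1
        rw [top_inf_eq, top_inf_eq] at this
        exact this hab
      · intro a b hab
        have := (hch.get a (lt_of_lt_of_eq a.2 ht.symm) (H b)).2
        rw [top_inf_eq, top_inf_eq] at this
        exact this hab
  · have h0 : wedgeCoeff (wedgeOrder w) = 0 := by
      rw [wedgeCoeff, dif_neg]; rwa [hlen']
    rw [h0, zero_mul]
    have : (List.map (fun x => ExteriorAlgebra.ι ℂ (xiVec x)) (wedgeOrder w)).prod *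
        (List.map (fun t => ExteriorAlgebra.ι ℂ (eVec t))
          (linkList w ++ [zeroVec ω (content w)])).prod =
        (((wedgeOrder w).map xiVec ++ (linkList w ++ [zeroVec ω (content w)]).map eVec).map
          (ExteriorAlgebra.ι ℂ)).prod := by
      simp only [List.map_append, List.map_map, List.prod_append, Function.comp_def]
    rw [this]
    apply coefExt_prod_of_ne
    simp only [List.length_append, List.length_map, List.length_singleton]
    omega

end Flags

/-! ### The bilinear form `Geom_0`, symmetrization, and the cocycle `Ω` -/

section Cocycle

open scoped Nat

variable {R r T : ℕ}

/-- Given a weight `λ` with `m = λ_1 + ⋯ + λ_r`, the indices `1, …, m` are grouped into consecutive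
blocks of lengths `λ_1, …, λ_r`; `colour` is the number of the block. -/
def colour (lam : Fin r → ℕ) (p : Fin (∑ i, lam i)) : Fin r := (finSigmaFinEquiv.symm p).1

/-- The homomorphism `𝔫 → 𝔞` which sends the generator number `q` to the sum of all `f^k_p` such that
`q = σ^k ι(i)`, where `i` is the block of `p`. Equivalently
`σ^k F_{ι(i)} ↦ ∑_{l < T/T_i} ∑_{p in block i} f^{k + T_i l}_p`. -/
def jmath [NeZero T] (π : Equiv.Perm (Fin R)) (ι : Fin r → Fin R) (lam : Fin r → ℕ) :
    FreeLieAlgebra ℂ (Fin R) →ₗ⁅ℂ⁆ FreeLieAlgebra ℂ (Letter T (∑ i, lam i)) :=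
  FreeLieAlgebra.lift ℂ fun q =>
    ∑ x : Letter T (∑ i, lam i) with (π ^ x.1.val) (ι (colour lam x.2)) = q,
      FreeLieAlgebra.of ℂ x

/-- The linear map `u ↦ ψ(\bar u v_0)`, projected to the weight `(1, …, 1)`, where
`\bar u = ∑_k τ^k u`, the automorphism `τ` being `f^k_p ↦ f^{k+1}_p`. Flags are regarded as functionals
on tuples of diagonal hyperplanes. It is determined by its values `psiWord` on commutators. -/
def psi {m : ℕ} [NeZero T] {ω : ℂ} (hω : IsPrimitiveRoot ω T) :
    FreeLieAlgebra ℂ (Letter T m) →ₗ[ℂ] ((Fin m → Diag T m) → ℂ) :=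
  Classical.choose (exists_psi hω)

theorem psi_commutatorOf {m : ℕ} [NeZero T] {ω : ℂ} (hω : IsPrimitiveRoot ω T)
    (w : FreeMagma (Letter T m)) : psi hω (commutatorOf w) = psiWord ω w :=
  Classical.choose_spec (exists_psi hω) w

/-- The anti-involution `φ : 𝔞₊ → 𝔞`, `φ [x, y] = - [φ x, φ y]`, `φ (e^k_p) = f^k_p`, both algebras being
identified with the free Lie algebra on the letters. -/
def antiInv {X : Type*} : FreeLieAlgebra ℂ X →ₗ[ℂ] FreeLieAlgebra ℂ X :=
  - (FreeLieAlgebra.lift ℂ (fun x => - FreeLieAlgebra.of ℂ x) :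
      FreeLieAlgebra ℂ X →ₗ⁅ℂ⁆ FreeLieAlgebra ℂ X).toLinearMap

/-- The weight of the hyperplane `t_p = ω^k t_q`: it is `(α_{ι(i)}, σ^k α_{ι(j)})`, where `i`, `j` are the
blocks of `p`, `q`. -/
def diagWeight (b : Fin R → Fin R → ℂ) (π : Equiv.Perm (Fin R)) (ι : Fin r → Fin R)
    (lam : Fin r → ℕ) (h : Diag T (∑ i, lam i)) : ℂ :=
  b (ι (colour lam h.1.1)) ((π ^ h.1.2.2.val) (ι (colour lam h.1.2.1)))

/-- The geometric form of the weighted arrangement of the diagonal hyperplanes on full flags,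
`∑ ⟨P, H_1 ∧ ⋯ ∧ H_m⟩ ⟨Q, H_1 ∧ ⋯ ∧ H_m⟩ a(H_1) ⋯ a(H_m)`, a sum over tuples up to reordering (whence the
factor `1 / m!`). -/
def flagForm {m : ℕ} [NeZero T] (a : Diag T m → ℂ) (P Q : (Fin m → Diag T m) → ℂ) : ℂ :=
  (m ! : ℂ)⁻¹ * ∑ H : Fin m → Diag T m, P H * Q H * ∏ i, a (H i)

/-- The form `Geom_0(u, v) = G(ψ(u v_0), ψ(v v_0))` of `τ`-invariant elements `u`, `v` of `𝔞`; such an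
element is the projection `\bar x` of `x = u / T`. -/
def geomZero {m : ℕ} [NeZero T] {ω : ℂ} (hω : IsPrimitiveRoot ω T) (a : Diag T m → ℂ)
    (u v : FreeLieAlgebra ℂ (Letter T m)) : ℂ :=
  flagForm a (psi hω ((T : ℂ)⁻¹ • u)) (psi hω ((T : ℂ)⁻¹ • v))

/-- The order `∏ (T / T_i) ^ λ_i * λ_i !` of the product of the wreath products of the symmetric
groups `Σ_{λ_i}` and the cyclic groups of order `T / T_i`. -/
def symOrder (T : ℕ) (π : Equiv.Perm (Fin R)) (ι : Fin r → Fin R) (lam : Fin r → ℕ) : ℕ :=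
  ∏ i, (T / Function.minimalPeriod π (ι i)) ^ lam i * (lam i)!

/-- The contribution of the weight `λ` to `Ω(x, y)` for `x ∈ 𝔫₊` and `y ∈ 𝔫` invariant (given by elements
`u`, `v` of the free Lie algebra), namely `|ΣZ_λ|⁻¹ Geom_0(φ (s x), s y)`. -/
def cocycleTerm [NeZero T] {ω : ℂ} (hω : IsPrimitiveRoot ω T) (b : Fin R → Fin R → ℂ)
    (π : Equiv.Perm (Fin R)) (ι : Fin r → Fin R) (lam : Fin r → ℕ)
    (u v : FreeLieAlgebra ℂ (Fin R)) : ℂ :=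
  (symOrder T π ι lam : ℂ)⁻¹ *
    geomZero hω (diagWeight b π ι lam) (antiInv (jmath π ι lam u)) (jmath π ι lam v)

theorem flagForm_add_left {m : ℕ} [NeZero T] (a : Diag T m → ℂ)
    (P P' Q : (Fin m → Diag T m) → ℂ) :
    flagForm a (P + P') Q = flagForm a P Q + flagForm a P' Q := by
  simp only [flagForm, Pi.add_apply, add_mul, Finset.sum_add_distrib, mul_add]

theorem flagForm_smul_left {m : ℕ} [NeZero T] (a : Diag T m → ℂ) (c : ℂ)
    (P Q : (Fin m → Diag T m) → ℂ) :
    flagForm a (c • P) Q = c * flagForm a P Q := by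
  simp only [flagForm, Pi.smul_apply, smul_eq_mul, Finset.mul_sum]
  exact Finset.sum_congr rfl fun _ _ => by ring

theorem flagForm_comm {m : ℕ} [NeZero T] (a : Diag T m → ℂ) (P Q : (Fin m → Diag T m) → ℂ) :
    flagForm a P Q = flagForm a Q P := by
  simp only [flagForm, mul_comm (P _)]

theorem flagForm_add_right {m : ℕ} [NeZero T] (a : Diag T m → ℂ)
    (P Q Q' : (Fin m → Diag T m) → ℂ) :
    flagForm a P (Q + Q') = flagForm a P Q + flagForm a P Q' := by
  rw [flagForm_comm, flagForm_add_left, flagForm_comm a Q, flagForm_comm a Q']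

theorem flagForm_smul_right {m : ℕ} [NeZero T] (a : Diag T m → ℂ) (c : ℂ)
    (P Q : (Fin m → Diag T m) → ℂ) :
    flagForm a P (c • Q) = c * flagForm a P Q := by
  rw [flagForm_comm, flagForm_smul_left, flagForm_comm]

theorem cocycleTerm_add_left [NeZero T] {ω : ℂ} (hω : IsPrimitiveRoot ω T)
    (b : Fin R → Fin R → ℂ) (π : Equiv.Perm (Fin R)) (ι : Fin r → Fin R) (lam : Fin r → ℕ)
    (u u' v : FreeLieAlgebra ℂ (Fin R)) : cocycleTerm hω b π ι lam (u + u') v =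
      cocycleTerm hω b π ι lam u v + cocycleTerm hω b π ι lam u' v := by
  simp only [cocycleTerm, geomZero, map_add, map_smul, smul_add, flagForm_add_left, mul_add]

theorem cocycleTerm_add_right [NeZero T] {ω : ℂ} (hω : IsPrimitiveRoot ω T)
    (b : Fin R → Fin R → ℂ) (π : Equiv.Perm (Fin R)) (ι : Fin r → Fin R) (lam : Fin r → ℕ)
    (u v v' : FreeLieAlgebra ℂ (Fin R)) : cocycleTerm hω b π ι lam u (v + v') =
      cocycleTerm hω b π ι lam u v + cocycleTerm hω b π ι lam u v' := by
  simp only [cocycleTerm, geomZero, map_add, map_smul, smul_add, flagForm_add_right, mul_add]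

theorem cocycleTerm_smul_left [NeZero T] {ω : ℂ} (hω : IsPrimitiveRoot ω T)
    (b : Fin R → Fin R → ℂ) (π : Equiv.Perm (Fin R)) (ι : Fin r → Fin R) (lam : Fin r → ℕ)
    (c : ℂ) (u v : FreeLieAlgebra ℂ (Fin R)) : cocycleTerm hω b π ι lam (c • u) v =
      c * cocycleTerm hω b π ι lam u v := by
  simp only [cocycleTerm, geomZero, map_smul, flagForm_smul_left]
  ring

theorem cocycleTerm_smul_right [NeZero T] {ω : ℂ} (hω : IsPrimitiveRoot ω T)
    (b : Fin R → Fin R → ℂ) (π : Equiv.Perm (Fin R)) (ι : Fin r → Fin R) (lam : Fin r → ℕ)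
    (c : ℂ) (u v : FreeLieAlgebra ℂ (Fin R)) : cocycleTerm hω b π ι lam u (c • v) =
      c * cocycleTerm hω b π ι lam u v := by
  simp only [cocycleTerm, geomZero, map_smul, flagForm_smul_right]
  ring

theorem jmath_mem_span [NeZero T] (π : Equiv.Perm (Fin R)) (ι : Fin r → Fin R)
    (lam : Fin r → ℕ) (w : FreeMagma (Fin R)) :
    jmath (T := T) π ι lam (commutatorOf w) ∈
      Submodule.span ℂ (commutatorOf '' {x | x.length = w.length}) := by
  induction w using FreeMagma.recOnMul with
  | ih1 q =>
    change FreeLieAlgebra.lift ℂ _ (FreeLieAlgebra.of ℂ q) ∈ _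
    rw [FreeLieAlgebra.lift_of_apply]
    exact sum_mem fun x _ => Submodule.subset_span ⟨.of x, rfl, rfl⟩
  | ih2 a b ha hb =>
    change jmath π ι lam ⁅commutatorOf a, commutatorOf b⁆ ∈ _
    rw [LieHom.map_lie]
    generalize jmath (T := T) π ι lam (commutatorOf a) = p at ha ⊢
    generalize jmath (T := T) π ι lam (commutatorOf b) = q at hb ⊢
    induction ha using Submodule.span_induction with
    | mem x hx =>
      obtain ⟨x, hx, rfl⟩ := hx
      induction hb using Submodule.span_induction with
      | mem y hy =>
        obtain ⟨y, hy, rfl⟩ := hy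
        refine Submodule.subset_span ⟨x * y, ?_, rfl⟩
        change x.length + y.length = a.length + b.length
        rw [show x.length = _ from hx, show y.length = _ from hy]
      | zero => simp
      | add y z _ _ h1 h2 => rw [lie_add]; exact add_mem h1 h2
      | smul c y _ h => rw [lie_smul]; exact Submodule.smul_mem _ _ h
    | zero => simp
    | add y z _ _ h1 h2 => rw [add_lie]; exact add_mem h1 h2
    | smul c y _ h => rw [smul_lie]; exact Submodule.smul_mem _ _ h

theorem psi_eq_zero {m n : ℕ} [NeZero T] {ω : ℂ} (hω : IsPrimitiveRoot ω T) (hn : n ≠ m)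
    {u : FreeLieAlgebra ℂ (Letter T m)}
    (hu : u ∈ Submodule.span ℂ (commutatorOf '' {x | x.length = n})) : psi hω u = 0 := by
  induction hu using Submodule.span_induction with
  | mem x hx =>
    obtain ⟨w, hw, rfl⟩ := hx
    have hw' : w.length = n := hw
    rw [psi_commutatorOf]
    ext H
    rw [psiWord, wedgeCoeff, dif_neg (by rw [length_wedgeOrder, hw']; exact hn)]
    simp
  | zero => simp
  | add x y _ _ h1 h2 => rw [map_add, h1, h2, add_zero]
  | smul c x _ h => rw [map_smul, h, smul_zero]

theorem finite_weights (n : ℕ) : {lam : Fin r → ℕ | ∑ i, lam i = n}.Finite := by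
  refine (Set.finite_Iic (fun _ : Fin r => n)).subset fun lam hlam i => ?_
  rw [← show ∑ i, lam i = n from hlam]
  exact Finset.single_le_sum (fun _ _ => Nat.zero_le _) (Finset.mem_univ i)

theorem cocycleTerm_finite [NeZero T] {ω : ℂ} (hω : IsPrimitiveRoot ω T)
    (b : Fin R → Fin R → ℂ) (π : Equiv.Perm (Fin R)) (ι : Fin r → Fin R)
    (u v : FreeLieAlgebra ℂ (Fin R)) :
    (Function.support fun lam : Fin r → ℕ => cocycleTerm hω b π ι lam u v).Finite := by
  have hv : v ∈ Submodule.span ℂ (Set.range (commutatorOf (X := Fin R))) := by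
    rw [span_commutators]; trivial
  induction hv using Submodule.span_induction with
  | mem x hx =>
    obtain ⟨w, rfl⟩ := hx
    refine (finite_weights w.length).subset fun lam hlam => ?_
    by_contra hne
    apply hlam
    have h0 := psi_eq_zero hω (Ne.symm hne) (jmath_mem_span (T := T) π ι lam w)
    simp [cocycleTerm, geomZero, h0, flagForm]
  | zero =>
    convert Set.finite_empty
    ext lam
    simp [cocycleTerm, geomZero, flagForm]
  | add x y _ _ h1 h2 =>
    simp only [cocycleTerm_add_right]
    exact (h1.union h2).subset (Function.support_add _ _)
  | smul c x _ h =>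
    simp only [cocycleTerm_smul_right]
    refine h.subset fun lam hlam => ?_
    exact right_ne_zero_of_mul hlam

/-- The form `Ω(x, y)` for `x ∈ 𝔫₊` and `y ∈ 𝔫`: the sum of `cocycleTerm` over all weights, only finitely
many of which contribute. -/
def cocycleBilin [NeZero T] {ω : ℂ} (hω : IsPrimitiveRoot ω T)
    (b : Fin R → Fin R → ℂ) (π : Equiv.Perm (Fin R)) (ι : Fin r → Fin R) :
    FreeLieAlgebra ℂ (Fin R) →ₗ[ℂ] FreeLieAlgebra ℂ (Fin R) →ₗ[ℂ] ℂ :=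
  LinearMap.mk₂ ℂ (fun u v => ∑ᶠ lam : Fin r → ℕ, cocycleTerm hω b π ι lam u v)
    (fun u u' v => by
      simp only [cocycleTerm_add_left]
      exact finsum_add_distrib (cocycleTerm_finite hω b π ι u v)
        (cocycleTerm_finite hω b π ι u' v))
    (fun c u v => by
      simp only [cocycleTerm_smul_left, smul_eq_mul]
      exact (mul_finsum' _ _ (cocycleTerm_finite hω b π ι u v)).symm)
    (fun u v v' => by
      simp only [cocycleTerm_add_right]
      exact finsum_add_distrib (cocycleTerm_finite hω b π ι u v)
        (cocycleTerm_finite hω b π ι u v'))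
    (fun c u v => by
      simp only [cocycleTerm_smul_right, smul_eq_mul]
      exact (mul_finsum' _ _ (cocycleTerm_finite hω b π ι u v)).symm)

variable {𝔥 : Type*} [AddCommGroup 𝔥] [Module ℂ 𝔥]
  {α : Fin R → Module.Dual ℂ 𝔥} {cr : Fin R → 𝔥}

/-- The component in `𝔫`. -/
def minusPart : 𝔤 α cr →ₗ[ℂ] FreeLieAlgebra ℂ (Fin R) :=
  LinearMap.fst ℂ _ _ ∘ₗ (triangular α cr).symm.toLinearMap

/-- The component in `𝔫₊`. -/
def plusPart : 𝔤 α cr →ₗ[ℂ] FreeLieAlgebra ℂ (Fin R) :=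
  LinearMap.snd ℂ _ _ ∘ₗ LinearMap.snd ℂ _ _ ∘ₗ (triangular α cr).symm.toLinearMap

/-- The subalgebra `𝔤^σ` of fixed points. -/
def fixedSubalgebra (σ : 𝔤 α cr ≃ₗ⁅ℂ⁆ 𝔤 α cr) : LieSubalgebra ℂ (𝔤 α cr) where
  carrier := {x | σ x = x}
  zero_mem' := map_zero σ
  add_mem' := by
    intro x y hx hy
    change σ (x + y) = x + y
    rw [map_add, show σ x = x from hx, show σ y = y from hy]
  smul_mem' := by
    intro c x hx
    change σ (c • x) = c • x
    rw [map_smul, show σ x = x from hx]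
  lie_mem' := by
    intro x y hx hy
    change σ ⁅x, y⁆ = ⁅x, y⁆
    rw [LieEquiv.map_lie, show σ x = x from hx, show σ y = y from hy]

/-- The skew-symmetric bilinear form `Ω` on `𝔤^σ`:
`Ω(x, y) = Ω₀(x₊, y₋) - Ω₀(y₊, x₋)`, with `Ω₀` the form `cocycleBilin`. -/
def cocycle [NeZero T] {ω : ℂ} (hω : IsPrimitiveRoot ω T) (π : Equiv.Perm (Fin R))
    (ι : Fin r → Fin R) (σ : 𝔤 α cr ≃ₗ⁅ℂ⁆ 𝔤 α cr) :
    fixedSubalgebra σ →ₗ[ℂ] fixedSubalgebra σ →ₗ[ℂ] ℂ :=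
  let Φ := cocycleBilin hω (fun i j => α j (cr i)) π ι
  let incl := (fixedSubalgebra σ).toSubmodule.subtype
  Φ.compl₁₂ (plusPart ∘ₗ incl) (minusPart ∘ₗ incl) -
    (Φ.compl₁₂ (plusPart ∘ₗ incl) (minusPart ∘ₗ incl)).flip

/-- The subalgebra of `𝔤^σ` generated by the projections `∑_{k < T} σ^k E_i`, `∑_{k < T} σ^k F_i` and by
the projections of the elements of `𝔥` (which are the fixed points of `σ` in `𝔥`). -/
def foldedSubalgebra (T : ℕ) (σ : 𝔤 α cr ≃ₗ⁅ℂ⁆ 𝔤 α cr) : LieSubalgebra ℂ (fixedSubalgebra σ) :=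
  LieSubalgebra.lieSpan ℂ (fixedSubalgebra σ)
    {x | (∃ i, (x : 𝔤 α cr) = ∑ k ∈ Finset.range T, σ^[k] (Eg α cr i)) ∨
      (∃ i, (x : 𝔤 α cr) = ∑ k ∈ Finset.range T, σ^[k] (Fg α cr i)) ∨
      ∃ h : 𝔥, (x : 𝔤 α cr) = Hg α cr h}

/-- The elements `H_i` of `𝔥` with `(H_i, H) = α_i(H)` for all `H`, so that `α_j(H_i) = (α_i, α_j)` for
the induced form on the dual. -/
def coroot (form : LinearMap.BilinForm ℂ 𝔥) [FiniteDimensional ℂ 𝔥] (hnd : form.Nondegenerate)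
    (α : Fin R → Module.Dual ℂ 𝔥) (i : Fin R) : 𝔥 :=
  (form.toDual hnd).symm (α i)

end Cocycle

end Cyclotomic

end

open Cyclotomic

noncomputable section

namespace Cyclotomic

/-! The value Ω(y, x) involves x only through ψ of the images of its 𝔫-component and of its
𝔫₊-component, the latter after `antiInv`. It is therefore enough that these two flag vectors vanish
when x lies in 𝔤(B^σ). This follows from an algebraic fact and a geometric one.

Algebra. The sum of the Lie algebra generated by the orbit sums of the F_i, of 𝔥^σ, and of the one
generated by the orbit sums of the E_i is stable under ad of the generators of 𝔤(B^σ). Hence it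
contains 𝔤(B^σ) (`foldedSubalgebra_le`), and since the triangular decomposition is direct, both
components of x lie in `orbitAlgebra`. The map `jmath` sends an orbit sum to a combination of full
sums Σ_k f^k_p (`jmath_orbitSum_mem`). So the images of x₋ and x₊ lie in the subalgebra generated by
these full sums, the range of `barLie`.

Geometry. The map ψ vanishes on that range (`psi_barLie`). A signed flag is encoded as a product in
the exterior algebra on indices and hyperplanes: each formation of [a, b] contributes the sum of the
hyperplanes joining a letter of a to a letter of b, and the last member {0} contributes the sum of
the hyperplanes that do not contain the line L_g. The hyperplanes that do contain L_g are those
joining two letters of g, and their sum multiplies the product to zero (`wordExt_mul_linkSum`). Thus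
the last factor may be replaced by the sum of all hyperplanes, the same for every word
(`psiWord_eq_coefExt_one`).

Now sum over all superscripts. Shifting all superscripts of b at once affects only the factor
joining a and b, and averaging over the shifts turns it into the sum of all hyperplanes between the
indices of a and those of b. The result is a multiple of a product of the same shape in which the T
hyperplanes over each pair of indices are merged (`exists_sumLifts_wordExt`). After merging, every
hyperplane joins two letters of g, so the previous argument now annihilates the last factor itself
(`barExt_mul_one`). -/

section Averaging

variable {T m : ℕ}

/-! ### The functional `psiWord` in terms of the exterior algebra -/

/-- Only words in which every index occurs exactly once contribute to `coefExt`. -/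
theorem coefExt_wordExt_eq_zero {w : FreeMagma (Letter T m)}
    (hw : (content w).map Prod.snd ≠ Finset.univ.val) (H : Fin m → Diag T m) (t : Diag T m → ℂ) :
    coefExt H (wordExt w * ExteriorAlgebra.ι ℂ (eVec t)) = 0 := by
  have h2 : ((linkList w).map fun t => ExteriorAlgebra.ι ℂ (eVec t)).prod *
      ExteriorAlgebra.ι ℂ (eVec t) =
      ((linkList w ++ [t]).map fun t => ExteriorAlgebra.ι ℂ (eVec t)).prod := by
    simp
  rw [wordExt_eq, smul_mul_assoc, map_smul, mul_assoc, h2]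
  have hlen := length_linkList w
  have hlen' := length_wedgeOrder w
  by_cases hl : w.length = m
  · rw [coefExt_append H _ _ (hlen'.trans hl)
      (by simp only [List.length_append, List.length_singleton]; omega)]
    by_cases h0 : wedgeCoeff (wedgeOrder w) = 0
    · rw [h0, zero_mul, smul_zero]
    -- A nonzero `wedgeCoeff` makes the indices distinct; as there are `m` of them, they exhaust
    -- `Fin m`, against `hw`.
    · have hm := multilinear_of_wedgeCoeff h0
      refine absurd ?_ hw
      have hcard : Multiset.card ((content w).map Prod.snd) = m := by
        rw [Multiset.card_map, ← coe_wedgeOrder, Multiset.coe_card, hlen', hl]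
      have := Finset.eq_univ_of_card (⟨(content w).map Prod.snd, hm⟩ : Finset (Fin m))
        (hcard.trans (Fintype.card_fin m).symm)
      rw [← this]
  · have : (List.map (fun x => ExteriorAlgebra.ι ℂ (xiVec x)) (wedgeOrder w)).prod *
        (List.map (fun t => ExteriorAlgebra.ι ℂ (eVec t)) (linkList w ++ [t])).prod =
        (((wedgeOrder w).map xiVec ++ (linkList w ++ [t]).map eVec).map
          (ExteriorAlgebra.ι ℂ)).prod := by
      simp only [List.map_append, List.map_map, List.prod_append, Function.comp_def]
    -- The product has `w.length` letter factors, `w.length - 1` joining factors and the factor of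
    -- `t`, hence degree `2 * w.length`, while `coefExt` only sees degree `2 * m`.
    rw [this, coefExt_prod_of_ne, smul_zero]
    simp only [List.length_append, List.length_map, List.length_singleton]
    omega

/-- The coefficient is a block determinant. The letter block gives `wedgeCoeff`. The hyperplane
block gives `flagPairing`, because its rows record which hyperplanes cut each member of the flag out
of the preceding one. -/
theorem psiWord_eq_coefExt {ω : ℂ} [NeZero T] (hω : IsPrimitiveRoot ω T)
    (w : FreeMagma (Letter T m)) (H : Fin m → Diag T m) :
    psiWord ω w H =
      coefExt H (wordExt w * ExteriorAlgebra.ι ℂ (eVec (zeroVec ω (content w)))) := by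
  have hlen := length_linkList w
  have hlen' := length_wedgeOrder w
  -- The determinant formula for the flag pairing needs a multilinear word, which only a nonzero
  -- `wedgeCoeff` provides; otherwise both sides vanish.
  by_cases h0 : wedgeCoeff (wedgeOrder w) = 0
  · rw [psiWord, h0, mul_zero, zero_mul]
    by_cases hl : w.length = m
    · rw [wordExt_eq, smul_mul_assoc, map_smul, mul_assoc]
      have h2 : ((linkList w).map fun t => ExteriorAlgebra.ι ℂ (eVec t)).prod *
          ExteriorAlgebra.ι ℂ (eVec (zeroVec ω (content w))) =
          ((linkList w ++ [zeroVec ω (content w)]).map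
            fun t => ExteriorAlgebra.ι ℂ (eVec t)).prod := by
        simp
      rw [h2, coefExt_append H _ _ (hlen'.trans hl)
        (by simp only [List.length_append, List.length_singleton]; omega), h0, zero_mul, smul_zero]
    · refine (coefExt_wordExt_eq_zero (fun hc => hl ?_) H _).symm
      have := congrArg Multiset.card hc
      rwa [Multiset.card_map, ← coe_wedgeOrder, Multiset.coe_card, hlen', Finset.card_val,
        Finset.card_univ, Fintype.card_fin] at this
  · have hl : w.length = m := by
      by_contra hl
      exact h0 (by rw [wedgeCoeff, dif_neg (by rwa [hlen'])])
    have hm := multilinear_of_wedgeCoeff h0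
    have h2 : ((linkList w).map fun t => ExteriorAlgebra.ι ℂ (eVec t)).prod *
        ExteriorAlgebra.ι ℂ (eVec (zeroVec ω (content w))) =
        ((linkList w ++ [zeroVec ω (content w)]).map fun t => ExteriorAlgebra.ι ℂ (eVec t)).prod := by
      simp
    have ht : (linkList w ++ [zeroVec ω (content w)]).length = m := by
      simp only [List.length_append, List.length_singleton]; omega
    rw [wordExt_eq, smul_mul_assoc, map_smul, mul_assoc, h2, psiWord, smul_eq_mul, mul_assoc,
      coefExt_append H _ _ (hlen'.trans hl) ht]
    congr 2
    -- After all joins the flag has reached the edge of `w`, and `zeroVec` is by definition the row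
    -- for the passage from there to the last member.
    have hch : IsChain ω (⊤ : Submodule ℂ (Fin m → ℂ)) (joins ω w ++ [zeroEdge (content w)])
        (linkList w ++ [zeroVec ω (content w)]) := by
      refine (isChain_joins hω w ⊤ hm fun _ _ => trivial).append ?_
      rw [foldr_joins, top_inf_eq]
      refine ⟨fun h => ⟨fun heq => ?_, fun hne => ?_⟩, trivial⟩
      · simp [zeroVec, heq]
      · simp [zeroVec, hne]
    refine flagPairing_eq_det ω _ H _ (fun a b hab => ?_) (fun a b hab => ?_)
    · have := (hch.get a (lt_of_lt_of_eq a.2 ht.symm) (H b)).1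
      rw [top_inf_eq, top_inf_eq] at this
      exact this hab
    · have := (hch.get a (lt_of_lt_of_eq a.2 ht.symm) (H b)).2
      rw [top_inf_eq, top_inf_eq] at this
      exact this hab

/-! ### The last member of the flag -/

theorem exists_superscripts {c : Multiset (Letter T m)} (hc : c.map Prod.snd = Finset.univ.val) :
    ∃ κ : Fin m → ZMod T, c = Finset.univ.val.map fun p => (κ p, p) := by
  have hm : Multilinear c := by
    unfold Multilinear; rw [hc]; exact Finset.univ.nodup
  have hex : ∀ p : Fin m, ∃ k, ((k, p) : Letter T m) ∈ c := by
    intro p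
    have hp : p ∈ c.map Prod.snd := by rw [hc]; exact Finset.mem_univ p
    obtain ⟨x, hx, rfl⟩ := Multiset.mem_map.mp hp
    exact ⟨x.1, hx⟩
  choose κ hκ using hex
  refine ⟨κ, ?_⟩
  rw [← hc, Multiset.map_map]
  conv_lhs => rw [← Multiset.map_id c]
  exact Multiset.map_congr rfl fun x hx => hm.inj hx (hκ x.2) rfl

/-- The value is 2 and not 1 because the double sum meets the two indices of `h` in both orders. -/
theorem linkSum_self {κ : Fin m → ZMod T} (h : Diag T m) :
    linkSum (Finset.univ.val.map fun p => (κ p, p)) (Finset.univ.val.map fun p => (κ p, p)) h =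
      if h.1.2.2 = κ h.1.2.1 - κ h.1.1 then 2 else 0 := by
  have hne := h.2.ne
  -- The two alternatives in `linkVec` exclude each other, since the two indices of `h` differ; so
  -- the indicator is a sum of two indicators.
  have hl : ∀ p q : Fin m, linkVec (κ p, p) (κ q, q) h =
      (if h.1.1 = p then if h.1.2.1 = q then if h.1.2.2 = κ q - κ p then (1 : ℂ) else 0 else 0
        else 0) +
      (if h.1.1 = q then if h.1.2.1 = p then if h.1.2.2 = κ p - κ q then (1 : ℂ) else 0 else 0
        else 0) := by
    intro p q
    unfold linkVec
    grind
  rw [linkSum_apply]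
  simp only [Multiset.map_map, Function.comp_def]
  change (∑ p : Fin m, ∑ q : Fin m, linkVec (κ p, p) (κ q, q) h) = _
  simp only [hl, Finset.sum_add_distrib]
  rw [Finset.sum_comm (f := fun p q => if h.1.1 = q then _ else _)]
  simp only [Finset.sum_ite_irrel, Finset.sum_const_zero, Finset.sum_ite_eq, Finset.mem_univ,
    if_true]
  split_ifs <;> norm_num

/-- When every index occurs once, the edge of `c` is a line and its zero edge is the origin. A
hyperplane cuts the line down to the origin exactly if it does not contain it, and those containing
it are the ones joining two letters of `c`, counted twice by `linkSum c c`. -/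
theorem zeroVec_eq {ω : ℂ} [NeZero T] (hω : IsPrimitiveRoot ω T) {c : Multiset (Letter T m)}
    (hc : c.map Prod.snd = Finset.univ.val) :
    zeroVec ω c = 1 - (2 : ℂ)⁻¹ • linkSum c c := by
  obtain ⟨κ, rfl⟩ := exists_superscripts hc
  have hne := root_ne hω
  set c := Finset.univ.val.map fun p => ((κ p, p) : Letter T m) with hcdef
  have hmem : ∀ p, ((κ p, p) : Letter T m) ∈ c := fun p =>
    Multiset.mem_map_of_mem _ (Finset.mem_univ p)
  have hedge : ∀ t, t ∈ edge ω c ↔ ∀ p q, ω ^ (κ p).val * t p = ω ^ (κ q).val * t q := by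
    intro t
    refine ⟨fun h p q => h _ (hmem p) _ (hmem q), fun h x hx y hy => ?_⟩
    obtain ⟨p, -, rfl⟩ := Multiset.mem_map.mp hx
    obtain ⟨q, -, rfl⟩ := Multiset.mem_map.mp hy
    exact h p q
  have hzero : ∀ t, t ∈ zeroEdge c ↔ ∀ p, t p = 0 := by
    intro t
    refine ⟨fun h p => h _ (hmem p), fun h x _ => h _⟩
  ext h
  rw [Pi.sub_apply, Pi.smul_apply, linkSum_self, zeroVec, Pi.one_apply]
  have hdiag : ∀ t, t ∈ diagHyperplane ω h ↔ t h.1.1 = ω ^ h.1.2.2.val * t h.1.2.1 :=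
    fun t => Iff.rfl
  by_cases hk : h.1.2.2 = κ h.1.2.1 - κ h.1.1
  · have hsplit : ω ^ (κ h.1.2.1).val = ω ^ h.1.2.2.val * ω ^ (κ h.1.1).val := by
      rw [← root_add hω, hk, sub_add_cancel]
    rw [if_pos hk, if_neg]
    · norm_num
    · intro he
      -- This vector spans the line. It lies in the hyperplane `h`, yet none of its coordinates is
      -- zero.
      have hv : (fun p => (ω ^ (κ p).val)⁻¹) ∈ edge ω c ⊓ diagHyperplane ω h := by
        refine ⟨(hedge _).mpr fun p q => ?_, (hdiag _).mpr ?_⟩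
        · rw [mul_inv_cancel₀ (hne _), mul_inv_cancel₀ (hne _)]
        · have h1 := hne h.1.2.2
          have h2 := hne (κ h.1.1)
          simp only [hsplit]
          field_simp
      rw [he] at hv
      exact inv_ne_zero (hne _) ((hzero _).mp hv.2 h.1.1)
  · rw [if_neg hk, if_pos]
    · norm_num
    · ext t
      simp only [Submodule.mem_inf, hdiag, hzero]
      refine ⟨fun ⟨h1, h2⟩ => ⟨h1, ?_⟩, fun ⟨h1, h2⟩ => ⟨h1, by rw [h2, h2, mul_zero]⟩⟩
      rw [hedge] at h1
      have h3 := h1 h.1.1 h.1.2.1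
      -- If this coordinate were nonzero, comparing the equation of `h` with that of the line would
      -- identify two powers of `ω` and contradict `hk`. The equations of the line then carry the
      -- vanishing to all coordinates.
      have hj : t h.1.2.1 = 0 := by
        by_contra hj
        apply hk
        have : ω ^ (κ h.1.2.1).val = ω ^ (h.1.2.2 + κ h.1.1).val := by
          rw [root_add hω]
          apply mul_right_cancel₀ hj
          rw [← h3, h2]; ring
        rw [root_inj hω this, add_sub_cancel_right]
      intro p
      have := h1 p h.1.2.1
      rw [hj, mul_zero] at this
      exact (mul_eq_zero.mp this).resolve_left (hne _)

/-! ### Products which vanish in the exterior algebra -/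

/-- The factor of `u` is moved next to `A`, the factor of `v` past the odd element `A` to `B`, and
the factor of `l` meets its own copy and squares to zero. The sum `u + l + (l + v)` is the expansion
of the internal links of a commutator into those of its two entries and twice the links between
them. -/
theorem iota_add_mul_eq_zero {A B : Ext T m} (hA : OddEl A) {u v : Diag T m → ℂ}
    (hu : A * ExteriorAlgebra.ι ℂ (eVec u) = 0) (hv : B * ExteriorAlgebra.ι ℂ (eVec v) = 0)
    (l : Diag T m → ℂ) :
    B * A * ExteriorAlgebra.ι ℂ (eVec l) * ExteriorAlgebra.ι ℂ (eVec (u + l + (l + v))) = 0 := by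
  simp only [eVec_add, map_add, mul_add]
  have h1 : B * A * ExteriorAlgebra.ι ℂ (eVec l) * ExteriorAlgebra.ι ℂ (eVec u) = 0 := by
    rw [mul_assoc, iota_anti, mul_neg, ← mul_assoc, mul_assoc B, hu, mul_zero, zero_mul, neg_zero]
  have h2 : B * A * ExteriorAlgebra.ι ℂ (eVec l) * ExteriorAlgebra.ι ℂ (eVec v) = 0 := by
    rw [mul_assoc, iota_anti, mul_neg, ← mul_assoc, mul_assoc B, hA, mul_neg, ← mul_assoc, hv]
    simp
  have h3 : B * A * ExteriorAlgebra.ι ℂ (eVec l) * ExteriorAlgebra.ι ℂ (eVec l) = 0 := by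
    rw [mul_assoc, ExteriorAlgebra.ι_sq_zero, mul_zero]
  rw [h1, h2, h3]
  simp

theorem eVec_zero : eVec (0 : Diag T m → ℂ) = 0 := rfl

theorem linkVec_self (x : Letter T m) : linkVec x x = 0 := by
  ext h
  have := h.2.ne
  simp only [linkVec, Pi.zero_apply]
  grind

/-- A hyperplane that joins two letters of `w` contains the edge of `w`, so it cannot continue the
flag. Algebraically, a letter has no link with itself, and the inductive step is
`iota_add_mul_eq_zero`. -/
theorem wordExt_mul_linkSum (w : FreeMagma (Letter T m)) :
    wordExt w * ExteriorAlgebra.ι ℂ (eVec (linkSum (content w) (content w))) = 0 := by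
  induction w using FreeMagma.recOnMul with
  | ih1 x => simp [content, linkSum, linkVec_self, eVec_zero]
  | ih2 a b ha hb =>
    have h := iota_add_mul_eq_zero (oddEl_wordExt a) ha hb (linkSum (content a) (content b))
    change wordExt b * wordExt a * ExteriorAlgebra.ι ℂ _ * ExteriorAlgebra.ι ℂ
      (eVec (linkSum (content a + content b) (content a + content b))) = 0
    rw [linkSum_add_left, linkSum_add_right, linkSum_add_right,
      linkSum_comm (content b) (content a)]
    exact h

theorem eVec_smul (r : ℂ) (v : Diag T m → ℂ) : eVec (r • v) = r • eVec v := by simp [eVec]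

/-- The factor `zeroVec` depends on the superscripts of `w`, but differs from the sum of all
hyperplanes only by half of a vector that annihilates `wordExt w`. With a last factor independent of
`w`, the sum over superscripts can be taken inside `coefExt`. -/
theorem psiWord_eq_coefExt_one {ω : ℂ} [NeZero T] (hω : IsPrimitiveRoot ω T)
    (w : FreeMagma (Letter T m)) (H : Fin m → Diag T m) :
    psiWord ω w H = coefExt H (wordExt w * ExteriorAlgebra.ι ℂ (eVec 1)) := by
  rw [psiWord_eq_coefExt hω]
  by_cases hc : (content w).map Prod.snd = Finset.univ.val
  · have h1 : (1 : Diag T m → ℂ) = zeroVec ω (content w) +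
        (2 : ℂ)⁻¹ • linkSum (content w) (content w) := by
      rw [zeroVec_eq hω hc, sub_add_cancel]
    conv_rhs => rw [h1]
    rw [eVec_add, eVec_smul, map_add, map_smul, mul_add, mul_smul_comm, wordExt_mul_linkSum,
      smul_zero, add_zero]
  -- Outside the weight (1, …, 1) the formula for `zeroVec` is not available, but there both
  -- coefficients are zero.
  · rw [coefExt_wordExt_eq_zero hc, coefExt_wordExt_eq_zero hc]

/-! ### Products in which all hyperplanes over a pair of indices are merged. -/

/-- The indicator of the hyperplanes joining two indices. -/
def pairVec (T : ℕ) (p q : Fin m) : Diag T m → ℂ := fun h =>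
  if (h.1.1 = p ∧ h.1.2.1 = q) ∨ (h.1.1 = q ∧ h.1.2.1 = p) then 1 else 0

theorem pairVec_comm (p q : Fin m) : pairVec T p q = pairVec T q p := by
  ext h; simp only [pairVec, or_comm]

theorem pairVec_self (p : Fin m) : pairVec T p p = 0 := by
  ext h
  have := h.2.ne
  simp only [pairVec, Pi.zero_apply]
  grind

/-- The sum of the indicators of all hyperplanes that join two multisets of indices. -/
def pairSum (T : ℕ) (c d : Multiset (Fin m)) : Diag T m → ℂ :=
  (c.map fun p => (d.map fun q => pairVec T p q).sum).sum

theorem pairSum_comm (c d : Multiset (Fin m)) : pairSum T c d = pairSum T d c := by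
  unfold pairSum
  rw [Multiset.sum_map_sum_map]
  simp_rw [pairVec_comm]

/-- Each hyperplane of the arrangement joins exactly one pair of indices, met in both orders. So the
internal links of a merged word of weight (1, …, 1) comprise all hyperplanes, without regard to
superscripts. -/
theorem pairSum_univ :
    pairSum T (Finset.univ : Finset (Fin m)).val (Finset.univ : Finset (Fin m)).val =
      (2 : ℂ) • 1 := by
  change (∑ p : Fin m, ∑ q : Fin m, pairVec T p q) = _
  ext h
  have hne := h.2.ne
  have hl : ∀ p q : Fin m, pairVec T p q h =
      (if h.1.1 = p then if h.1.2.1 = q then (1 : ℂ) else 0 else 0) +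
      (if h.1.1 = q then if h.1.2.1 = p then (1 : ℂ) else 0 else 0) := by
    intro p q
    unfold pairVec
    grind
  simp only [Finset.sum_apply, hl, Finset.sum_add_distrib]
  rw [Finset.sum_comm (f := fun p q => if h.1.1 = q then _ else _)]
  simp only [Finset.sum_ite_irrel, Finset.sum_const_zero, Finset.sum_ite_eq, Finset.mem_univ,
    if_true]
  norm_num

/-- The analogue of `wordExt` for letters without superscripts, all hyperplanes joining the same two
indices being identified. -/
def barExt (T : ℕ) : FreeMagma (Fin m) → Ext T m
  | .of p => ExteriorAlgebra.ι ℂ (Pi.single p 1, 0)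
  | .mul a b => barExt T b * barExt T a *
      ExteriorAlgebra.ι ℂ (eVec (pairSum T (content a) (content b)))

theorem oddEl_barExt (w : FreeMagma (Fin m)) : OddEl (barExt T w) := by
  induction w using FreeMagma.recOnMul with
  | ih1 x => exact fun v => iota_anti _ _
  | ih2 a b ha hb => exact hb.mul3 ha (fun v => iota_anti _ _)

theorem barExt_mul_pairSum (w : FreeMagma (Fin m)) :
    barExt T w * ExteriorAlgebra.ι ℂ (eVec (pairSum T (content w) (content w))) = 0 := by
  induction w using FreeMagma.recOnMul with
  | ih1 x => simp [content, pairSum, pairVec_self, eVec_zero]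
  | ih2 a b ha hb =>
    have h := iota_add_mul_eq_zero (oddEl_barExt a) ha hb (pairSum T (content a) (content b))
    have hs : pairSum T (content a + content b) (content a + content b) =
        pairSum T (content a) (content a) + pairSum T (content a) (content b) +
          (pairSum T (content a) (content b) + pairSum T (content b) (content b)) := by
      -- One of the two mixed terms is turned round, so that both sides expand into the same four
      -- double sums.
      nth_rewrite 3 [pairSum_comm]
      simp only [pairSum, Multiset.map_add, Multiset.sum_add, Multiset.sum_map_add]
      abel
    change barExt T b * barExt T a * ExteriorAlgebra.ι ℂ _ * ExteriorAlgebra.ι ℂ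
      (eVec (pairSum T (content a + content b) (content a + content b))) = 0
    rw [hs]
    exact h

/-- This is the source of the vanishing. After merging, every hyperplane is an internal link of `w`,
so none is left to cut the last line down to the origin. -/
theorem barExt_mul_one {w : FreeMagma (Fin m)} (hw : content w = Finset.univ.val) :
    barExt T w * ExteriorAlgebra.ι ℂ (eVec 1) = 0 := by
  have h := barExt_mul_pairSum (T := T) w
  rw [hw, pairSum_univ, eVec_smul, map_smul, mul_smul_comm] at h
  exact (smul_eq_zero.mp h).resolve_left two_ne_zero

/-! ### Sums over all superscripts -/

/-- Adding `k` to all superscripts. -/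
def shiftWord (k : ZMod T) : FreeMagma (Letter T m) → FreeMagma (Letter T m)
  | .of x => .of (x.1 + k, x.2)
  | .mul a b => shiftWord k a * shiftWord k b

theorem content_shiftWord (k : ZMod T) (w : FreeMagma (Letter T m)) :
    content (shiftWord k w) = (content w).map fun x => (x.1 + k, x.2) := by
  induction w using FreeMagma.recOnMul with
  | ih1 x => rfl
  | ih2 a b ha hb =>
    change content (shiftWord k a) + content (shiftWord k b) = (content a + content b).map _
    rw [ha, hb, Multiset.map_add]

/-- The generators of the letters ignore superscripts, and a joining hyperplane depends only on the
difference of two superscripts. -/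
theorem wordExt_shiftWord (k : ZMod T) (w : FreeMagma (Letter T m)) :
    wordExt (shiftWord k w) = wordExt w := by
  induction w using FreeMagma.recOnMul with
  | ih1 x => rfl
  | ih2 a b ha hb =>
    change wordExt (shiftWord k b) * wordExt (shiftWord k a) * ExteriorAlgebra.ι ℂ (eVec (linkSum
      (content (shiftWord k a)) (content (shiftWord k b)))) = wordExt b * wordExt a * _
    rw [ha, hb, content_shiftWord, content_shiftWord]
    have h : ∀ x y : Letter T m, linkVec (x.1 + k, x.2) (y.1 + k, y.2) = linkVec x y := by
      intro x y
      ext h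
      simp [linkVec]
    simp [linkSum, Multiset.map_map, h]

variable [NeZero T] {M : Type*} [AddCommGroup M]

/-- The sum of `f` over all words obtained by attaching superscripts to the letters of `w`. -/
def sumLifts : FreeMagma (Fin m) → (FreeMagma (Letter T m) → M) → M
  | .of p, f => ∑ k : ZMod T, f (.of (k, p))
  | .mul a b, f => sumLifts a fun x => sumLifts b fun y => f (x * y)

theorem sumLifts_mul (a b : FreeMagma (Fin m)) (f : FreeMagma (Letter T m) → M) :
    sumLifts (a * b) f = sumLifts a fun x => sumLifts b fun y => f (x * y) := rfl

theorem map_sumLifts {N : Type*} [AddCommGroup N] [Module ℂ M] [Module ℂ N] (φ : M →ₗ[ℂ] N) (w : FreeMagma (Fin m)) :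
    ∀ f : FreeMagma (Letter T m) → M, φ (sumLifts w f) = sumLifts w fun x => φ (f x) := by
  induction w using FreeMagma.recOnMul with
  | ih1 p => intro f; exact map_sum φ _ _
  | ih2 a b ha hb => intro f; rw [sumLifts_mul, sumLifts_mul, ha]; simp only [hb]

theorem sumLifts_congr (w : FreeMagma (Fin m)) : ∀ {f g : FreeMagma (Letter T m) → M},
    (∀ x, (content x).map Prod.snd = content w → f x = g x) → sumLifts w f = sumLifts w g := by
  induction w using FreeMagma.recOnMul with
  | ih1 p => intro f g h; exact Finset.sum_congr rfl fun k _ => h _ rfl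
  | ih2 a b ha hb =>
    intro f g h
    refine ha fun x hx => hb fun y hy => h _ ?_
    change (content x + content y).map Prod.snd = content a + content b
    rw [Multiset.map_add, hx, hy]

theorem sumLifts_sum {ι : Type*} (s : Finset ι) (w : FreeMagma (Fin m)) :
    ∀ f : ι → FreeMagma (Letter T m) → M,
      sumLifts w (fun x => ∑ i ∈ s, f i x) = ∑ i ∈ s, sumLifts w (f i) := by
  induction w using FreeMagma.recOnMul with
  | ih1 p => intro f; exact Finset.sum_comm
  | ih2 a b ha hb => intro f; simp only [sumLifts_mul, hb, ha]

/-- A common shift permutes the choices of superscripts. -/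
theorem sumLifts_shiftWord (k : ZMod T) (w : FreeMagma (Fin m)) :
    ∀ f : FreeMagma (Letter T m) → M, sumLifts w (fun x => f (shiftWord k x)) = sumLifts w f := by
  induction w using FreeMagma.recOnMul with
  | ih1 p =>
    intro f
    exact Equiv.sum_comp (Equiv.addRight k) (fun l => f (.of ((l, p) : Letter T m)))
  | ih2 a b ha hb =>
    intro f
    exact (congrArg (sumLifts a) (funext fun x => hb fun y => f (shiftWord k x * y))).trans
      (ha fun x => sumLifts b fun y => f (x * y))

/-- If the indices of `x` and `y` differ, then as `k` varies the hyperplane joining `x` to the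
shifted `y` runs once through all hyperplanes over this pair of indices; if they agree, both sides
are zero. -/
theorem sum_linkVec_shift (x y : Letter T m) :
    ∑ k : ZMod T, linkVec x (y.1 + k, y.2) = pairVec T x.2 y.2 := by
  ext h
  have hne := h.2.ne
  -- Solving for `k` shows that for a given `h` exactly one shift contributes in each of the two
  -- orders.
  have e1 : ∀ k : ZMod T, h.1.2.2 = y.1 + k - x.1 ↔ h.1.2.2 - y.1 + x.1 = k := by
    intro k; constructor
    · intro e; rw [e]; ring
    · rintro rfl; ring
  have e2 : ∀ k : ZMod T, h.1.2.2 = x.1 - (y.1 + k) ↔ x.1 - y.1 - h.1.2.2 = k := by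
    intro k; constructor
    · intro e; rw [e]; ring
    · rintro rfl; ring
  have hl : ∀ k : ZMod T, linkVec x (y.1 + k, y.2) h =
      (if h.1.1 = x.2 ∧ h.1.2.1 = y.2 then if h.1.2.2 - y.1 + x.1 = k then (1 : ℂ) else 0 else 0) +
      (if h.1.1 = y.2 ∧ h.1.2.1 = x.2 then if x.1 - y.1 - h.1.2.2 = k then (1 : ℂ) else 0
        else 0) := by
    intro k
    simp only [linkVec, e1, e2]
    grind
  rw [Finset.sum_apply]
  simp only [hl, Finset.sum_add_distrib, Finset.sum_ite_irrel, Finset.sum_const_zero,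
    Finset.sum_ite_eq, Finset.mem_univ, if_true, pairVec]
  grind

theorem sum_linkSum_shift (c d : Multiset (Letter T m)) :
    ∑ k : ZMod T, linkSum c (d.map fun y => (y.1 + k, y.2)) =
      pairSum T (c.map Prod.snd) (d.map Prod.snd) := by
  simp only [linkSum, pairSum, Multiset.map_map, Function.comp_def, ← sum_linkVec_shift,
    Finset.sum_eq_multiset_sum]
  rw [Multiset.sum_map_sum_map]
  simp only [Multiset.sum_map_sum_map Finset.univ.val]

/-- The sum over the superscripts of `b` is unchanged if these are all shifted by `k`, so `T` times
it is a sum over `k` as well. Only the factor joining the two entries sees `k`, and its sum over `k`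
depends on the indices alone, so it can be taken out of the sums over the superscripts of `a` and of
`b`. -/
theorem sumLifts_wordExt_mul (a b : FreeMagma (Fin m)) :
    (T : ℂ) • sumLifts (T := T) (a * b) wordExt =
      sumLifts (T := T) b wordExt * sumLifts (T := T) a wordExt *
        ExteriorAlgebra.ι ℂ (eVec (pairSum T (content a) (content b))) := by
  set e : Ext T m := ExteriorAlgebra.ι ℂ (eVec (pairSum T (content a) (content b)))
  have h1 : ∀ x : FreeMagma (Letter T m), (content x).map Prod.snd = content a →
      (T : ℂ) • sumLifts b (fun y => wordExt (x * y)) =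
        sumLifts (T := T) b wordExt * wordExt x * e := by
    intro x hx
    have : (T : ℂ) • sumLifts b (fun y => wordExt (x * y)) =
        ∑ k : ZMod T, sumLifts b (fun y => wordExt (x * shiftWord k y)) := by
      simp only [sumLifts_shiftWord _ b (fun y => wordExt (x * y)), Finset.sum_const,
        Finset.card_univ, ZMod.card]
      exact Nat.cast_smul_eq_nsmul ℂ _ _
    -- The sum over `k` becomes the inner one, so that it can be evaluated for each fixed choice of
    -- superscripts.
    rw [this, ← sumLifts_sum, mul_assoc]
    change _ = LinearMap.mulRight ℂ (wordExt x * e) _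
    rw [map_sumLifts]
    refine sumLifts_congr b fun y hy => ?_
    rw [LinearMap.mulRight_apply, ← mul_assoc]
    change ∑ k : ZMod T, wordExt (shiftWord k y) * wordExt x * ExteriorAlgebra.ι ℂ
      (eVec (linkSum (content x) (content (shiftWord k y)))) = _
    simp only [wordExt_shiftWord, content_shiftWord]
    rw [← Finset.mul_sum, ← map_sum]
    congr 2
    rw [← hx, ← hy, ← sum_linkSum_shift]
    exact (map_sum (LinearMap.inr ℂ (Fin m → ℂ) (Diag T m → ℂ)) _ _).symm
  change _ = (LinearMap.mulRight ℂ e ∘ₗ LinearMap.mulLeft ℂ (sumLifts (T := T) b wordExt)) _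
  rw [map_sumLifts, sumLifts_mul]
  change LinearMap.lsmul ℂ _ (T : ℂ) _ = _
  rw [map_sumLifts]
  exact sumLifts_congr a h1

/-- Only the existence of a scalar matters. The construction always gives `T`: it does so for a
letter, and a bracket yields `T⁻¹ * (T * T)`. -/
theorem exists_sumLifts_wordExt (w : FreeMagma (Fin m)) :
    ∃ r : ℂ, sumLifts (T := T) w wordExt = r • barExt T w := by
  have hT : (T : ℂ) ≠ 0 := Nat.cast_ne_zero.mpr (NeZero.ne T)
  induction w using FreeMagma.recOnMul with
  | ih1 p =>
    refine ⟨T, ?_⟩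
    change ∑ k : ZMod T, ExteriorAlgebra.ι ℂ (xiVec (k, p)) = _
    simp only [xiVec, Finset.sum_const, Finset.card_univ, ZMod.card]
    exact (Nat.cast_smul_eq_nsmul ℂ _ _).symm
  | ih2 a b ha hb =>
    obtain ⟨r, ha⟩ := ha
    obtain ⟨s, hb⟩ := hb
    refine ⟨(T : ℂ)⁻¹ * (s * r), ?_⟩
    rw [mul_smul, eq_inv_smul_iff₀ hT, sumLifts_wordExt_mul, ha, hb]
    simp only [smul_mul_assoc, mul_smul_comm, smul_smul, mul_comm r]
    rfl

/-! ### Vanishing of ψ on the subalgebra generated by the full sums of letters. -/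

/-- The homomorphism sending a letter without superscript to the sum of the letters with all
superscripts. -/
def barLie (T : ℕ) [NeZero T] :
    FreeLieAlgebra ℂ (Fin m) →ₗ⁅ℂ⁆ FreeLieAlgebra ℂ (Letter T m) :=
  FreeLieAlgebra.lift ℂ fun p => ∑ k : ZMod T, FreeLieAlgebra.of ℂ (k, p)

attribute [local instance] LieRing.ofAssociativeRing in
theorem barLie_commutatorOf (w : FreeMagma (Fin m)) :
    barLie T (commutatorOf w) = sumLifts w commutatorOf := by
  induction w using FreeMagma.recOnMul with
  | ih1 p => exact FreeLieAlgebra.lift_of_apply _ _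
  | ih2 a b ha hb =>
    change barLie T ⁅commutatorOf a, commutatorOf b⁆ = _
    rw [LieHom.map_lie, ha, hb]
    -- The bracket is written as a linear map of its first entry, so that `map_sumLifts` applies;
    -- the second entry is treated in the same way below.
    change (LieModule.toEnd ℂ (FreeLieAlgebra ℂ (Letter T m))
      (FreeLieAlgebra ℂ (Letter T m))).toLinearMap.flip
      (sumLifts b commutatorOf) (sumLifts a commutatorOf) = _
    rw [map_sumLifts, sumLifts_mul]
    congr 1
    ext x
    change LieModule.toEnd ℂ _ (FreeLieAlgebra ℂ (Letter T m)) (commutatorOf x)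
      (sumLifts b commutatorOf) = _
    rw [map_sumLifts]
    rfl

/-- The functional `psi` vanishes on commutators of the sums over all superscripts. -/
theorem psi_barLie {ω : ℂ} (hω : IsPrimitiveRoot ω T) (u : FreeLieAlgebra ℂ (Fin m)) :
    psi hω (barLie T u) = 0 := by
  have hu : u ∈ Submodule.span ℂ (Set.range (commutatorOf (X := Fin m))) := by
    rw [span_commutators]; trivial
  induction hu using Submodule.span_induction with
  | zero => simp
  | add x y _ _ h1 h2 => rw [map_add, map_add, h1, h2, add_zero]
  | smul c x _ h => rw [map_smul, map_smul, h, smul_zero]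
  | mem x hx =>
    obtain ⟨w, rfl⟩ := hx
    rw [barLie_commutatorOf, map_sumLifts]
    simp only [psi_commutatorOf]
    ext H
    change LinearMap.proj (R := ℂ) (φ := fun _ : Fin m → Diag T m => ℂ) H _ = 0
    rw [map_sumLifts]
    simp only [LinearMap.proj_apply, psiWord_eq_coefExt_one hω]
    by_cases hw : content w = Finset.univ.val
    -- The summand is now one fixed linear functional applied to `wordExt x`, so the sum over
    -- superscripts passes inside and becomes a multiple of `barExt T w`.
    · change sumLifts w (fun x => (coefExt H ∘ₗ
        LinearMap.mulRight ℂ (ExteriorAlgebra.ι ℂ (eVec 1))) (wordExt x)) = 0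
      rw [← map_sumLifts]
      obtain ⟨r, hr⟩ := exists_sumLifts_wordExt (T := T) w
      rw [hr, map_smul, LinearMap.comp_apply, LinearMap.mulRight_apply, barExt_mul_one hw, map_zero,
        smul_zero]
    -- Superscripts do not affect the indices, so every summand vanishes. Zero is written as a value
    -- of the zero map to let `map_sumLifts` collapse the sum.
    · rw [sumLifts_congr w (g := fun _ => (0 : ℂ →ₗ[ℂ] ℂ) 0)
        fun x hx => coefExt_wordExt_eq_zero (hx.trans_ne hw) H 1, ← map_sumLifts]
      rfl

end Averaging

section Folding

variable {R r T : ℕ}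

/-! ### The subalgebra generated by the projected generators -/

/-- The projected generator `∑_{k < T} σ^k` of the free Lie algebra. -/
def orbitSum (T : ℕ) (π : Equiv.Perm (Fin R)) (i : Fin R) : FreeLieAlgebra ℂ (Fin R) :=
  ∑ k ∈ Finset.range T, FreeLieAlgebra.of ℂ ((π ^ k) i)

/-- The subalgebra of the free Lie algebra generated by the projected generators. -/
def orbitAlgebra (T : ℕ) (π : Equiv.Perm (Fin R)) : LieSubalgebra ℂ (FreeLieAlgebra ℂ (Fin R)) :=
  LieSubalgebra.lieSpan ℂ _ (Set.range (orbitSum T π))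

theorem orbitSum_mem (T : ℕ) (π : Equiv.Perm (Fin R)) (i : Fin R) :
    orbitSum T π i ∈ orbitAlgebra T π := LieSubalgebra.subset_lieSpan ⟨i, rfl⟩

theorem pow_val_add [NeZero T] {π : Equiv.Perm (Fin R)} (hT : π ^ T = 1) (k l : ZMod T) :
    π ^ (k + l).val = π ^ k.val * π ^ l.val := by
  rw [ZMod.val_add, ← pow_add]
  exact (pow_eq_pow_mod _ hT).symm

theorem sum_range_eq_sum_zmod [NeZero T] {M : Type*} [AddCommMonoid M] (f : ℕ → M) :
    ∑ k ∈ Finset.range T, f k = ∑ k : ZMod T, f k.val := by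
  obtain ⟨n, rfl⟩ := Nat.exists_eq_succ_of_ne_zero (NeZero.ne T)
  exact Finset.sum_range f

/-- The coefficient of the letter `(l, p)` in the image is the number of `k` in `ZMod T` for which
`π ^ l` of the representative of the block of `p` equals `π ^ k` of `q`. Replacing `k` by `l + k`
shows that it does not depend on `l`. -/
theorem jmath_orbitSum_mem [NeZero T] {π : Equiv.Perm (Fin R)} (hT : π ^ T = 1)
    (ι : Fin r → Fin R) (lam : Fin r → ℕ) (q : Fin R) :
    jmath (T := T) π ι lam (orbitSum T π q) ∈ (barLie T (m := ∑ i, lam i)).range := by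
  have hcount : ∀ (l : ZMod T) (s : Fin R),
      (∑ k : ZMod T, if (π ^ l.val) s = (π ^ k.val) q then (1 : ℂ) else 0) =
        ∑ k : ZMod T, if s = (π ^ k.val) q then (1 : ℂ) else 0 := by
    intro l s
    rw [← Equiv.sum_comp (Equiv.addLeft l)]
    refine Finset.sum_congr rfl fun k _ => ?_
    simp only [Equiv.coe_addLeft, pow_val_add hT, Equiv.Perm.mul_apply,
      (π ^ l.val).injective.eq_iff]
  have h : jmath (T := T) π ι lam (orbitSum T π q) = barLie T
      (∑ p, (∑ k : ZMod T, if ι (colour lam p) = (π ^ k.val) q then (1 : ℂ) else 0) •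
        FreeLieAlgebra.of ℂ p) := by
    rw [orbitSum, sum_range_eq_sum_zmod, map_sum, map_sum]
    simp only [jmath, barLie, map_smul, FreeLieAlgebra.lift_of_apply, Finset.sum_filter]
    rw [Finset.sum_comm]
    have h1 : ∀ x : Letter T (∑ i, lam i), (∑ k : ZMod T,
        if (π ^ x.1.val) (ι (colour lam x.2)) = (π ^ k.val) q then FreeLieAlgebra.of ℂ x else 0) =
        (∑ k : ZMod T, if ι (colour lam x.2) = (π ^ k.val) q then (1 : ℂ) else 0) •
          FreeLieAlgebra.of ℂ x := by
      intro x
      rw [← hcount x.1, Finset.sum_smul]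
      refine Finset.sum_congr rfl fun k _ => ?_
      split_ifs <;> simp
    simp only [h1]
    rw [Fintype.sum_prod_type_right]
    simp only [Finset.smul_sum]
  rw [h]
  exact LieHom.mem_range_self _ _

theorem jmath_mem_range [NeZero T] {π : Equiv.Perm (Fin R)} (hT : π ^ T = 1)
    (ι : Fin r → Fin R) (lam : Fin r → ℕ) {v : FreeLieAlgebra ℂ (Fin R)}
    (hv : v ∈ orbitAlgebra T π) :
    jmath (T := T) π ι lam v ∈ (barLie T (m := ∑ i, lam i)).range := by
  have : orbitAlgebra T π ≤
      (barLie T (m := ∑ i, lam i)).range.comap (jmath (T := T) π ι lam) := by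
    refine LieSubalgebra.lieSpan_le.mpr ?_
    rintro _ ⟨q, rfl⟩
    exact jmath_orbitSum_mem hT ι lam q
  exact this hv

/-- Up to an overall sign `antiInv` is the Lie homomorphism that negates the letters, and this one
commutes with `barLie` on generators. -/
theorem antiInv_barLie {m : ℕ} [NeZero T] (u : FreeLieAlgebra ℂ (Fin m)) :
    antiInv (barLie T u) = barLie T (antiInv u) := by
  let s := fun X : Type => (FreeLieAlgebra.lift ℂ (fun x : X => - FreeLieAlgebra.of ℂ x) :
      FreeLieAlgebra ℂ X →ₗ⁅ℂ⁆ FreeLieAlgebra ℂ X)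
  have h : (s (Letter T m)).comp (barLie T) = (barLie T).comp (s (Fin m)) := by
    apply FreeLieAlgebra.hom_ext
    intro p
    simp [s, barLie, FreeLieAlgebra.lift_of_apply]
  have h' := LieHom.congr_fun h u
  change - s (Letter T m) (barLie T u) = barLie T (- s (Fin m) u)
  rw [map_neg]
  exact congrArg Neg.neg h'

/-- Every weight contributes zero separately, because the flag vector of the second argument already
vanishes. -/
theorem cocycleBilin_eq_zero_right [NeZero T] {ω : ℂ} (hω : IsPrimitiveRoot ω T)
    (b : Fin R → Fin R → ℂ) {π : Equiv.Perm (Fin R)} (hT : π ^ T = 1) (ι : Fin r → Fin R)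
    (u : FreeLieAlgebra ℂ (Fin R)) {v : FreeLieAlgebra ℂ (Fin R)} (hv : v ∈ orbitAlgebra T π) :
    cocycleBilin hω b π ι u v = 0 := by
  change ∑ᶠ lam : Fin r → ℕ, cocycleTerm hω b π ι lam u v = 0
  refine finsum_eq_zero_of_forall_eq_zero fun lam => ?_
  obtain ⟨z, hz⟩ := jmath_mem_range hT ι lam hv
  have h0 : psi hω (jmath π ι lam v) = 0 := by rw [← hz]; exact psi_barLie hω z
  simp [cocycleTerm, geomZero, h0, flagForm]

theorem cocycleBilin_eq_zero_left [NeZero T] {ω : ℂ} (hω : IsPrimitiveRoot ω T)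
    (b : Fin R → Fin R → ℂ) {π : Equiv.Perm (Fin R)} (hT : π ^ T = 1) (ι : Fin r → Fin R)
    {u : FreeLieAlgebra ℂ (Fin R)} (hu : u ∈ orbitAlgebra T π) (v : FreeLieAlgebra ℂ (Fin R)) :
    cocycleBilin hω b π ι u v = 0 := by
  change ∑ᶠ lam : Fin r → ℕ, cocycleTerm hω b π ι lam u v = 0
  refine finsum_eq_zero_of_forall_eq_zero fun lam => ?_
  obtain ⟨z, hz⟩ := jmath_mem_range hT ι lam hu
  have h0 : psi hω (antiInv (jmath π ι lam u)) = 0 := by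
    rw [← hz]
    exact (congrArg (psi hω) (antiInv_barLie z)).trans (psi_barLie hω _)
  simp [cocycleTerm, geomZero, h0, flagForm]

/-! ### Triangular decomposition of the folded subalgebra -/

variable {𝔥 : Type*} [AddCommGroup 𝔥] [Module ℂ 𝔥]
  {α : Fin R → Module.Dual ℂ 𝔥} {cr : Fin R → 𝔥}

/-- In a Verma module `Fg α cr i` sends the vacuum to a basis word. The highest weight is
immaterial, and zero is taken. -/
theorem Fg_ne_zero (i : Fin R) : Fg α cr i ≠ 0 := by
  intro h0
  obtain ⟨ρ, -, hF, -⟩ := exists_verma α cr 0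
  have h1 := congrArg (fun z : Module.End ℂ (Words R) => z (Finsupp.single [] 1)) (hF i)
  simp only [h0, map_zero, LinearMap.zero_apply, consW_single] at h1
  exact one_ne_zero (Finsupp.single_eq_zero.mp h1.symm)

/-- The elements of `𝔥` whose image in `𝔤` is fixed. -/
def fixedCartan (σ : 𝔤 α cr ≃ₗ⁅ℂ⁆ 𝔤 α cr) : Submodule ℂ 𝔥 :=
  LinearMap.eqLocus ((σ : 𝔤 α cr →ₗ[ℂ] 𝔤 α cr) ∘ₗ Hg α cr) (Hg α cr)

theorem mem_fixedCartan {σ : 𝔤 α cr ≃ₗ⁅ℂ⁆ 𝔤 α cr} {h : 𝔥} :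
    h ∈ fixedCartan σ ↔ σ (Hg α cr h) = Hg α cr h := Iff.rfl

variable {σ : 𝔤 α cr ≃ₗ⁅ℂ⁆ 𝔤 α cr} {π : Equiv.Perm (Fin R)}

/-- Apply `σ` to the relation between `h` and `F i`: since `h` is fixed, this gives the relation for
`F (π i)` with the old eigenvalue, and `F (π i)` is nonzero. -/
theorem root_apply_pow (hσF : ∀ i, σ (Fg α cr i) = Fg α cr (π i)) {h : 𝔥}
    (hh : h ∈ fixedCartan σ) (k : ℕ) (i : Fin R) : α ((π ^ k) i) h = α i h := by
  have step : ∀ i, α (π i) h = α i h := by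
    intro i
    have h1 := congrArg σ (lie_HF α cr h i)
    rw [LieEquiv.map_lie, mem_fixedCartan.mp hh, hσF, map_neg, map_smul, hσF, lie_HF,
      neg_inj] at h1
    exact smul_left_injective ℂ (Fg_ne_zero (π i)) h1
  induction k with
  | zero => rfl
  | succ k ih => rw [pow_succ', Equiv.Perm.mul_apply, step, ih]

theorem map_orbit {x : Fin R → 𝔤 α cr} (hx : ∀ i, σ (x i) = x (π i)) (hT : π ^ T = 1)
    (i : Fin R) : σ (∑ k ∈ Finset.range T, x ((π ^ k) i)) = ∑ k ∈ Finset.range T, x ((π ^ k) i) := by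
  -- The sum of `T + 1` consecutive terms is split at its last and at its first term; these two
  -- terms agree because `π ^ T = 1`.
  have h1 := Finset.sum_range_succ (fun k => x ((π ^ k) i)) T
  rw [Finset.sum_range_succ', hT, pow_zero] at h1
  rw [map_sum]
  simp only [hx, ← Equiv.Perm.mul_apply, ← pow_succ']
  exact add_right_cancel h1

theorem iterate_orbit {x : Fin R → 𝔤 α cr} (hx : ∀ i, σ (x i) = x (π i)) (k : ℕ) (i : Fin R) :
    σ^[k] (x i) = x ((π ^ k) i) := by
  induction k with
  | zero => rfl
  | succ k ih => rw [Function.iterate_succ_apply', ih, hx, pow_succ', Equiv.Perm.mul_apply]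

theorem jF_orbitSum (i : Fin R) :
    jF α cr (orbitSum T π i) = ∑ k ∈ Finset.range T, Fg α cr ((π ^ k) i) := by
  simp [orbitSum]

theorem jE_orbitSum (i : Fin R) :
    jE α cr (orbitSum T π i) = ∑ k ∈ Finset.range T, Eg α cr ((π ^ k) i) := by
  simp [orbitSum]

/-- A fixed `h` takes the same root value along each orbit, so orbit sums are eigenvectors of its
adjoint action, which is a derivation. -/
theorem lie_fixedCartan_jF (hσF : ∀ i, σ (Fg α cr i) = Fg α cr (π i)) {h : 𝔥}
    (hh : h ∈ fixedCartan σ) {a : FreeLieAlgebra ℂ (Fin R)} (ha : a ∈ orbitAlgebra T π) :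
    ∃ a' ∈ orbitAlgebra T π, ⁅Hg α cr h, jF α cr a⁆ = jF α cr a' := by
  induction ha using LieSubalgebra.lieSpan_induction with
  | mem x hx =>
    obtain ⟨i, rfl⟩ := hx
    refine ⟨- (α i h • orbitSum T π i), neg_mem (SMulMemClass.smul_mem _ (orbitSum_mem T π i)), ?_⟩
    simp only [map_neg, map_smul, jF_orbitSum, lie_sum, lie_HF, root_apply_pow hσF hh,
      Finset.sum_neg_distrib, Finset.smul_sum]
  | zero => exact ⟨0, zero_mem _, by simp⟩
  | add x y _ _ hx hy =>
    obtain ⟨a', ha', hx⟩ := hx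
    obtain ⟨b', hb', hy⟩ := hy
    exact ⟨a' + b', add_mem ha' hb', by rw [map_add, lie_add, hx, hy, map_add]⟩
  | smul c x _ hx =>
    obtain ⟨a', ha', hx⟩ := hx
    exact ⟨c • a', SMulMemClass.smul_mem _ ha', by rw [map_smul, lie_smul, hx, map_smul]⟩
  | lie x y hxm hym hx hy =>
    obtain ⟨a', ha', hx⟩ := hx
    obtain ⟨b', hb', hy⟩ := hy
    refine ⟨⁅a', y⁆ + ⁅x, b'⁆, add_mem (LieSubalgebra.lie_mem _ ha' hym)
      (LieSubalgebra.lie_mem _ hxm hb'), ?_⟩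
    rw [LieHom.map_lie, leibniz_lie, hx, hy, map_add, LieHom.map_lie, LieHom.map_lie]

/-- On generators the bracket lands in the image of 𝔥. On longer commutators the Leibniz rule
applies, and the terms from 𝔥 are absorbed by `lie_fixedCartan_jF`, which is why the component in 𝔥
must be known to be fixed. -/
theorem lie_orbit_jF (hσE : ∀ i, σ (Eg α cr i) = Eg α cr (π i))
    (hσF : ∀ i, σ (Fg α cr i) = Fg α cr (π i)) (hT : π ^ T = 1) (i : Fin R)
    {a : FreeLieAlgebra ℂ (Fin R)} (ha : a ∈ orbitAlgebra T π) :
    ∃ a' ∈ orbitAlgebra T π, ∃ h ∈ fixedCartan σ,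
      ⁅jE α cr (orbitSum T π i), jF α cr a⁆ = jF α cr a' + Hg α cr h := by
  induction ha using LieSubalgebra.lieSpan_induction with
  | mem x hx =>
    obtain ⟨j, rfl⟩ := hx
    have hH : ⁅jE α cr (orbitSum T π i), jF α cr (orbitSum T π j)⁆ =
        Hg α cr (∑ l ∈ Finset.range T, ∑ k ∈ Finset.range T,
          if (π ^ k) i = (π ^ l) j then cr ((π ^ k) i) else 0) := by
      simp only [jE_orbitSum, jF_orbitSum, sum_lie, lie_sum, lie_EF, map_sum]
      refine Finset.sum_congr rfl fun l _ => Finset.sum_congr rfl fun k _ => ?_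
      split_ifs
      · rfl
      · rw [map_zero]
    -- That this element of 𝔥 is fixed is read off from its being the bracket of two fixed elements,
    -- not from the double sum.
    refine ⟨0, zero_mem _, _, mem_fixedCartan.mpr ?_, by rw [hH, map_zero, zero_add]⟩
    rw [← hH, LieEquiv.map_lie, jE_orbitSum, jF_orbitSum, map_orbit hσE hT, map_orbit hσF hT]
  | zero => exact ⟨0, zero_mem _, 0, zero_mem _, by simp⟩
  | add x y _ _ hx hy =>
    obtain ⟨a', ha', h, hh, hx⟩ := hx
    obtain ⟨b', hb', h', hh', hy⟩ := hy
    refine ⟨a' + b', add_mem ha' hb', h + h', add_mem hh hh', ?_⟩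
    rw [map_add, lie_add, hx, hy, map_add, map_add]; abel
  | smul c x _ hx =>
    obtain ⟨a', ha', h, hh, hx⟩ := hx
    exact ⟨c • a', SMulMemClass.smul_mem _ ha', c • h, Submodule.smul_mem _ _ hh, by
      rw [map_smul, lie_smul, hx, map_smul, map_smul, smul_add]⟩
  | lie x y hxm hym hx hy =>
    obtain ⟨a', ha', h, hh, hx⟩ := hx
    obtain ⟨b', hb', h', hh', hy⟩ := hy
    obtain ⟨c, hc, hc'⟩ := lie_fixedCartan_jF hσF hh hym
    obtain ⟨d, hd, hd'⟩ := lie_fixedCartan_jF hσF hh' hxm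
    -- Here `c` and `d` are the brackets of the 𝔥-parts with the other entry; the minus sign comes
    -- from turning round the second one. No component in 𝔥 is left.
    refine ⟨⁅a', y⁆ + c + (⁅x, b'⁆ - d), add_mem (add_mem (LieSubalgebra.lie_mem _ ha' hym) hc)
      (sub_mem (LieSubalgebra.lie_mem _ hxm hb') hd), 0, zero_mem _, ?_⟩
    rw [LieHom.map_lie, leibniz_lie, hx, hy, add_lie, lie_add, hc', ← lie_skew _ (Hg α cr h'), hd']
    simp only [map_add, map_sub, LieHom.map_lie, map_zero]
    abel

/-- The sum of `𝔥^σ` and of the subalgebras generated by the projections of the `F i` and the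
`E i`. -/
def foldedSum (T : ℕ) (π : Equiv.Perm (Fin R)) (σ : 𝔤 α cr ≃ₗ⁅ℂ⁆ 𝔤 α cr) :
    Submodule ℂ (𝔤 α cr) :=
  ((orbitAlgebra T π).toSubmodule.prod
    ((fixedCartan σ).prod (orbitAlgebra T π).toSubmodule)).map (triSum α cr)

theorem jF_mem_foldedSum {a : FreeLieAlgebra ℂ (Fin R)} (ha : a ∈ orbitAlgebra T π) :
    jF α cr a ∈ foldedSum T π σ :=
  ⟨(a, 0, 0), ⟨ha, zero_mem _, zero_mem _⟩, by simp [triSum]⟩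

theorem Hg_mem_foldedSum {h : 𝔥} (hh : h ∈ fixedCartan σ) : Hg α cr h ∈ foldedSum T π σ :=
  ⟨(0, h, 0), ⟨zero_mem _, hh, zero_mem _⟩, by simp [triSum]⟩

theorem jE_mem_foldedSum {b : FreeLieAlgebra ℂ (Fin R)} (hb : b ∈ orbitAlgebra T π) :
    jE α cr b ∈ foldedSum T π σ :=
  ⟨(0, 0, b), ⟨zero_mem _, zero_mem _, hb⟩, by simp [triSum]⟩

/-- The Chevalley involution exchanges the two halves and preserves `foldedSum`, so stability under
the orbit sums of the F_i follows from that under the orbit sums of the E_i. -/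
theorem lie_mem_foldedSum (hσE : ∀ i, σ (Eg α cr i) = Eg α cr (π i))
    (hσF : ∀ i, σ (Fg α cr i) = Fg α cr (π i)) (hT : π ^ T = 1) :
    (∀ i, ∀ s ∈ foldedSum T π σ, ⁅jE α cr (orbitSum T π i), s⁆ ∈ foldedSum T π σ) ∧
    (∀ i, ∀ s ∈ foldedSum T π σ, ⁅jF α cr (orbitSum T π i), s⁆ ∈ foldedSum T π σ) ∧
    ∀ h ∈ fixedCartan σ, ∀ s ∈ foldedSum T π σ, ⁅Hg α cr h, s⁆ ∈ foldedSum T π σ := by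
  obtain ⟨θ, hθE, hθF, hθH⟩ := exists_chevalley α cr
  have θE : ∀ b, θ (jE α cr b) = jF α cr b := by
    intro b
    have : θ.comp (jE α cr) = jF α cr := by
      apply FreeLieAlgebra.hom_ext
      intro i
      simp [hθE]
    exact LieHom.congr_fun this b
  have θF : ∀ b, θ (jF α cr b) = jE α cr b := by
    intro b
    have : θ.comp (jF α cr) = jE α cr := by
      apply FreeLieAlgebra.hom_ext
      intro i
      simp [hθF]
    exact LieHom.congr_fun this b
  have θS : ∀ s ∈ foldedSum T π σ, θ s ∈ foldedSum T π σ ∧ θ (θ s) = s := by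
    rintro _ ⟨⟨a, h, b⟩, ⟨ha, hh, hb⟩, rfl⟩
    constructor
    · refine ⟨(b, -h, a), ⟨hb, neg_mem hh, ha⟩, ?_⟩
      simp [triSum, θE, θF, hθH]; abel
    · simp [triSum, θE, θF, hθH]
  have adHF : ∀ h ∈ fixedCartan σ, ∀ a ∈ orbitAlgebra T π,
      ⁅Hg α cr h, jF α cr a⁆ ∈ foldedSum T π σ := by
    intro h hh a ha
    obtain ⟨a', ha', e⟩ := lie_fixedCartan_jF hσF hh ha
    rw [e]; exact jF_mem_foldedSum ha'
  have adHE : ∀ h ∈ fixedCartan σ, ∀ b ∈ orbitAlgebra T π,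
      ⁅Hg α cr h, jE α cr b⁆ ∈ foldedSum T π σ := by
    intro h hh b hb
    -- The involution negates 𝔥, hence the use of `-h`.
    have := (θS _ (adHF (-h) (neg_mem hh) b hb)).1
    rwa [LieHom.map_lie, θF, hθH, map_neg, neg_neg] at this
  have adE : ∀ i, ∀ s ∈ foldedSum T π σ, ⁅jE α cr (orbitSum T π i), s⁆ ∈ foldedSum T π σ := by
    rintro i _ ⟨⟨a, h, b⟩, ⟨ha, hh, hb⟩, rfl⟩
    change ⁅_, jF α cr a + (Hg α cr h + jE α cr b)⁆ ∈ _
    obtain ⟨a', ha', h', hh', e⟩ := lie_orbit_jF hσE hσF hT i ha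
    rw [lie_add, lie_add, e, ← lie_skew _ (Hg α cr h), ← LieHom.map_lie]
    exact add_mem (add_mem (jF_mem_foldedSum ha') (Hg_mem_foldedSum hh'))
      (add_mem (neg_mem (adHE h hh _ (orbitSum_mem T π i)))
        (jE_mem_foldedSum (LieSubalgebra.lie_mem _ (orbitSum_mem T π i) hb)))
  refine ⟨adE, fun i s hs => ?_, ?_⟩
  · have := (θS _ (adE i (θ s) (θS s hs).1)).1
    rwa [LieHom.map_lie, θE, (θS s hs).2] at this
  · rintro h hh _ ⟨⟨a, h', b⟩, ⟨ha, hh', hb⟩, rfl⟩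
    change ⁅_, jF α cr a + (Hg α cr h' + jE α cr b)⁆ ∈ _
    rw [lie_add, lie_add, lie_HH]
    exact add_mem (adHF h hh a ha) (add_mem (zero_mem _) (adHE h hh b hb))

/-- It is not necessary to know that `foldedSum` is closed under brackets. Membership is proved
together with stability of `foldedSum` under ad x, and by the Jacobi identity the pair of properties
passes to brackets. -/
theorem foldedSubalgebra_le (hσE : ∀ i, σ (Eg α cr i) = Eg α cr (π i))
    (hσF : ∀ i, σ (Fg α cr i) = Fg α cr (π i)) (hT : π ^ T = 1) {x : fixedSubalgebra σ}
    (hx : x ∈ foldedSubalgebra T σ) : (x : 𝔤 α cr) ∈ foldedSum T π σ := by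
  obtain ⟨adE, adF, adH⟩ := lie_mem_foldedSum hσE hσF hT
  suffices h : (x : 𝔤 α cr) ∈ foldedSum T π σ ∧
      ∀ s ∈ foldedSum T π σ, ⁅(x : 𝔤 α cr), s⁆ ∈ foldedSum T π σ from h.1
  induction hx using LieSubalgebra.lieSpan_induction with
  | mem x hx =>
    obtain ⟨i, hi⟩ | ⟨i, hi⟩ | ⟨h, hh⟩ := hx
    · simp only [iterate_orbit hσE, ← jE_orbitSum] at hi
      rw [hi]
      exact ⟨jE_mem_foldedSum (orbitSum_mem T π i), adE i⟩
    · simp only [iterate_orbit hσF, ← jF_orbitSum] at hi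
      rw [hi]
      exact ⟨jF_mem_foldedSum (orbitSum_mem T π i), adF i⟩
    · have hfix : h ∈ fixedCartan σ := by
        rw [mem_fixedCartan, ← hh]; exact x.2
      rw [hh]
      exact ⟨Hg_mem_foldedSum hfix, adH h hfix⟩
  | zero => simp
  | add x y _ _ h1 h2 =>
    refine ⟨add_mem h1.1 h2.1, fun s hs => ?_⟩
    change ⁅(x : 𝔤 α cr) + (y : 𝔤 α cr), s⁆ ∈ _
    rw [add_lie]
    exact add_mem (h1.2 s hs) (h2.2 s hs)
  | smul c x _ h =>
    refine ⟨Submodule.smul_mem _ c h.1, fun s hs => ?_⟩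
    change ⁅c • (x : 𝔤 α cr), s⁆ ∈ _
    rw [smul_lie]
    exact Submodule.smul_mem _ c (h.2 s hs)
  | lie x y _ _ h1 h2 =>
    refine ⟨h1.2 _ h2.1, fun s hs => ?_⟩
    change ⁅⁅(x : 𝔤 α cr), (y : 𝔤 α cr)⁆, s⁆ ∈ _
    rw [lie_lie]
    exact sub_mem (h1.2 _ (h2.2 _ hs)) (h2.2 _ (h1.2 _ hs))

/-! ### Conclusion for the form Ω. -/

theorem parts_mem_orbitAlgebra {x : 𝔤 α cr} (hx : x ∈ foldedSum T π σ) :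
    minusPart x ∈ orbitAlgebra T π ∧ plusPart x ∈ orbitAlgebra T π := by
  obtain ⟨z, ⟨ha, -, hb⟩, rfl⟩ := hx
  have h : (triangular α cr).symm (triSum α cr z) = z := (triangular α cr).symm_apply_apply z
  simp only [minusPart, plusPart, LinearMap.comp_apply, LinearEquiv.coe_coe, h]
  exact ⟨ha, hb⟩

theorem cocycle_apply [NeZero T] {ω : ℂ} (hω : IsPrimitiveRoot ω T) (ι : Fin r → Fin R)
    (y x : fixedSubalgebra σ) : cocycle hω π ι σ y x =
      cocycleBilin hω (fun i j => α j (cr i)) π ι (plusPart (y : 𝔤 α cr)) (minusPart (x : 𝔤 α cr)) -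
      cocycleBilin hω (fun i j => α j (cr i)) π ι (plusPart (x : 𝔤 α cr))
        (minusPart (y : 𝔤 α cr)) := by
  simp only [cocycle, LinearMap.sub_apply, LinearMap.flip_apply, LinearMap.compl₁₂_apply,
    LinearMap.comp_apply]
  rfl

/-- The 𝔫-component of `x` enters one of the two terms of Ω and its 𝔫₊-component the other. Both lie
in `orbitAlgebra`, so each term vanishes by itself, whatever `y` is. -/
theorem cocycle_eq_zero [NeZero T] {ω : ℂ} (hω : IsPrimitiveRoot ω T) (ι : Fin r → Fin R)
    (hσE : ∀ i, σ (Eg α cr i) = Eg α cr (π i)) (hσF : ∀ i, σ (Fg α cr i) = Fg α cr (π i))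
    (hT : π ^ T = 1) {x : fixedSubalgebra σ} (hx : x ∈ foldedSubalgebra T σ)
    (y : fixedSubalgebra σ) : cocycle hω π ι σ y x = 0 := by
  obtain ⟨h1, h2⟩ := parts_mem_orbitAlgebra (foldedSubalgebra_le hσE hσF hT hx)
  rw [cocycle_apply, cocycleBilin_eq_zero_right hω _ hT ι _ h1,
    cocycleBilin_eq_zero_left hω _ hT ι h2, sub_zero]

end Folding

end Cyclotomic

end

theorem mainTheorem10 {𝔥 : Type*} [AddCommGroup 𝔥] [Module ℂ 𝔥] [FiniteDimensional ℂ 𝔥]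
    (form : LinearMap.BilinForm ℂ 𝔥) (hsymm : form.IsSymm) (hnd : form.Nondegenerate)
    {R : ℕ} (α : Fin R → Module.Dual ℂ 𝔥) (hα : LinearIndependent ℂ α)
    (σ : 𝔤 α (coroot form hnd α) ≃ₗ⁅ℂ⁆ 𝔤 α (coroot form hnd α))
    (π : Equiv.Perm (Fin R))
    (hσE : ∀ i, σ (Eg α (coroot form hnd α) i) = Eg α (coroot form hnd α) (π i))
    (hσF : ∀ i, σ (Fg α (coroot form hnd α) i) = Fg α (coroot form hnd α) (π i))
    (hσH : ∀ i, σ (Hg α (coroot form hnd α) (coroot form hnd α i)) =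
      Hg α (coroot form hnd α) (coroot form hnd α (π i)))
    (T : ℕ) [NeZero T] (hT : π ^ T = 1) {ω : ℂ} (hω : IsPrimitiveRoot ω T)
    {r : ℕ} (ι : Fin r → Fin R) (hι : ∀ q, ∃! i, π.SameCycle (ι i) q) :
    (∀ x ∈ foldedSubalgebra T σ, ∀ y : fixedSubalgebra σ, cocycle hω π ι σ y x = 0) ∧
      (foldedSubalgebra T σ = ⊤ → cocycle hω π ι σ = 0) := by
  have main : ∀ x ∈ foldedSubalgebra T σ, ∀ y : fixedSubalgebra σ, cocycle hω π ι σ y x = 0 :=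
    fun x hx y => cocycle_eq_zero hω ι hσE hσF hT hx y
  refine ⟨main, fun htop => LinearMap.ext fun y => LinearMap.ext fun x => main x ?_ y⟩
  rw [htop]
  exact LieSubalgebra.mem_top x
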